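/- **Setting.** Let $X=(X_t)_{t\in\mathbb Z}$ be a strictly stationary real-valued process with marginal distribution function $F$, $\bar F=1-F$, and $M_n=\max(X_1,\dots,X_n)$. For $h:\mathbb R^u\to\mathbb R$ let $\operatorname{Lip}h=\sup_{x\ne y}|h(y)-h(x)|/\sum_{i}|y_i-x_i|$. For $r\in\mathbb N$ let $$\eta(r)=\sup\frac{|\operatorname{Cov}(f(X_{s_1},\dots,X_{s_u}),g(X_{t_1},\dots,X_{t_v}))|}{u\operatorname{Lip}f+v\operatorname{Lip}g}\in[0,\infty],$$ the supremum being over $u,v\ge1$, integers $s_1\le\dots\le s_u\le t_1\le\dots\le t_v$ with $t_1-s_u=r$, and functions $f,g$ with finite Lipschitz coefficient and $\|f\|_\infty,\|g\|_\infty\le1$ (with $0/0=0$); $\lambda(r)$ is defined in the same way with denominator $u\operatorname{Lip}f+v\operatorname{Lip}g+uv\operatorname{Lip}f\operatorname{Lip}g$. $X$ is $\eta$- (resp. $\lambda$-) weakly dependent if $\eta(r)\to0$ (resp. $\lambda(r)\to0$) as $r\to\infty$. For nonnegative sequences, $\alpha_n\prec\beta_n$ means $\alpha_n\le K\beta_n$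 for a constant $K$. For $\gamma\in\mathbb R$ let $G_\gamma(x)=\exp(-(1+\gamma x)_+^{-1/\gamma})$ if $\gamma\ne0$ (read as $0$ for $1+\gamma x\le0$, $\gamma>0$) and $G_0(x)=\exp(-e^{-x})$. **Assumptions on $X$.** $F$ is absolutely continuous and in the domain of attraction of $G_\gamma$: there are $u_n>0$ and $v_n\in\mathbb R$ such that, with $w_n(x)=x/u_n+v_n$, $F^n(w_n(x))\to G_\gamma(x)$ for all $x$; moreover $\frac{\partial}{\partial x}F^n(w_n(x))\to\frac{\partial}{\partial x}G_\gamma(x)$ whenever $1+\gamma x>0$. There are positive integers $a_n=o(n)$, $l_n=o(a_n)$ and $\theta\in(0,1]$ such that $\mathbb P(M_{a_n}>w_n(x))/(a_n\bar F(w_n(x)))\to\theta$ whenever $1+\gamma x>0$. Finally, either $X$ is $\eta$-weakly dependent and $\frac n{a_n}(n\,\eta(l_n)u_n)^{1/2}\to0$, or $X$ is $\lambda$-weakly dependent and $\frac n{a_n}\big([n\lambda(l_n)u_n]^{1/2}\vee[na_n\lambda(l_n)u_n^2]^{1/3}\big)\to0$. Put $\mathbb H=G_\gamma^\theta$. **Subsampler.**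 Let $b=b_n$ be integers with $b_n\to\infty$, $n/b_n\to\infty$, let $\epsilon_n>0$, $\epsilon_n\to0$, and let $\varphi$ be the continuous function with $\varphi=1$ on $(-\infty,0]$, $\varphi=0$ on $[1,\infty)$ and $\varphi$ affine on $[0,1]$. Put $$\widetilde{\mathbb H}_{b,n}(x)=\frac1N\sum_{i=0}^{N-1}\varphi\Big(\frac{m_{b,i}-x}{\epsilon_n}\Big),$$ where in the overlapping case $N=n-b$ and $m_{b,i}=\max(X_{i+1},\dots,X_{i+b})$, and in the non-overlapping case $N=\lfloor n/b\rfloor$ and $m_{b,i}=\max(X_{ib+1},\dots,X_{(i+1)b})$. With $K^{\leftarrow}(t)=\inf\{x:K(x)\ge t\}$ and fixed $0<t_1<t_2<1$, put $\widetilde v_{b,n}=\widetilde{\mathbb H}_{b,n}^{\leftarrow}(1/2)$, $\widetilde u_{b,n}=|\widetilde{\mathbb H}_{b,n}^{\leftarrow}(t_2)-\widetilde{\mathbb H}_{b,n}^{\leftarrow}(t_1)|^{-1}$ and $C=\mathbb H^{\leftarrow}(t_2)-\mathbb H^{\leftarrow}(t_1)$. **Theorem.** Let $\delta>0$ and let $p\ge1$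 be an integer. Assume $\epsilon_nu_{b_n}\to0$ and, as $n\to\infty$, * in the overlapping case: either $X$ is $\eta$-weakly dependent, $\sum_{t\ge0}(t+1)^{p-2}\eta(t)<\infty$ and $\frac{b}{n^{1-\delta}\epsilon_n}\prec1$; or $X$ is $\lambda$-weakly dependent, $\sum_{t\ge0}(t+1)^{p-2}\lambda(t)<\infty$ and $\frac{b^2}{n^{1-\delta}\epsilon_n^2}\prec1$; * in the non-overlapping case: either $X$ is $\eta$-weakly dependent, $\sum_{t=0}^{n-1}(t+1)^{p-2}\eta(t)\prec b^{p-2}$ and $\frac{b^2}{n^{1-\delta}\epsilon_n}\prec1$; or $X$ is $\lambda$-weakly dependent, $\sum_{t=0}^{n-1}(t+1)^{p-2}\lambda(t)\prec b^{p-2}$ and $\frac{b^2}{n^{1-\delta}\epsilon_n^2}\prec1$. Then there is a constant $K$ such that for all $n\ge1$ and $x\in\mathbb R$ $$\Big|\mathbb E\Big[\widetilde{\mathbb H}_{b,n}(w_b(x))-\mathbb E\,\widetilde{\mathbb H}_{b,n}(w_b(x))\Big]^p\Big|\le K\,n^{-\lfloor p/2\rfloor\delta}.$$ If moreover $p$ is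 even and $p\delta>2$, then almost surely $$\sup_{x\in\mathbb R}\Big|\widetilde{\mathbb H}_{b,n}\Big(\widetilde v_{b,n}+\frac x{\widetilde u_{b,n}}\Big)-\mathbb H\big(\mathbb H^{\leftarrow}(1/2)+Cx\big)\Big|\longrightarrow0\qquad(n\to\infty).$$ -/

import Mathlib

open MeasureTheory ProbabilityTheory Filter Topology Asymptotics
open scoped ENNReal

namespace ExtremeSubsampling

noncomputable section

/-- Strict stationarity: finite-dimensional laws are invariant under time shifts. -/
def StrictlyStationary {Ω : Type*} [MeasurableSpace Ω] (X : ℤ → Ω → ℝ) (μ : Measure Ω) : Prop :=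
  ∀ (m : ℕ) (t : Fin m → ℤ) (h : ℤ),
    μ.map (fun ω i => X (t i + h) ω) = μ.map (fun ω i => X (t i) ω)

/-- Lipschitz coefficient of `f : ℝ^u → ℝ` with respect to the `ℓ¹` distance. -/
def lip {u : ℕ} (f : (Fin u → ℝ) → ℝ) : ℝ≥0∞ :=
  ⨆ (x : Fin u → ℝ) (y : Fin u → ℝ) (_ : y ≠ x),
    ENNReal.ofReal |f y - f x| / ENNReal.ofReal (∑ i, |y i - x i|)

/-- The weak dependence coefficient at lag `r` for the weight `Ψ(u, v, Lip f, Lip g)`.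
The tuples have `u + 1 ≥ 1` and `v + 1 ≥ 1` entries. Constant pairs contribute `0 / 0 = 0`. -/
def depCoeff {Ω : Type*} [MeasurableSpace Ω] (Ψ : ℕ → ℕ → ℝ≥0∞ → ℝ≥0∞ → ℝ≥0∞)
    (X : ℤ → Ω → ℝ) (μ : Measure Ω) (r : ℕ) : ℝ≥0∞ :=
  ⨆ (u : ℕ) (v : ℕ) (s : Fin (u + 1) → ℤ) (t : Fin (v + 1) → ℤ)
    (f : (Fin (u + 1) → ℝ) → ℝ) (g : (Fin (v + 1) → ℝ) → ℝ)
    (_ : Monotone s) (_ : Monotone t) (_ : t 0 - s (Fin.last u) = (r : ℤ))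
    (_ : lip f < ⊤) (_ : lip g < ⊤) (_ : ∀ x, |f x| ≤ 1) (_ : ∀ x, |g x| ≤ 1),
    ENNReal.ofReal |cov[fun ω => f (fun i => X (s i) ω), fun ω => g (fun j => X (t j) ω); μ]|
      / Ψ (u + 1) (v + 1) (lip f) (lip g)

/-- The coefficient `η(r)`. -/
def etaCoeff {Ω : Type*} [MeasurableSpace Ω] (X : ℤ → Ω → ℝ) (μ : Measure Ω) : ℕ → ℝ≥0∞ :=
  depCoeff (fun u v Lf Lg => (u : ℝ≥0∞) * Lf + (v : ℝ≥0∞) * Lg) X μ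

/-- The coefficient `λ(r)`. -/
def lambdaCoeff {Ω : Type*} [MeasurableSpace Ω] (X : ℤ → Ω → ℝ) (μ : Measure Ω) : ℕ → ℝ≥0∞ :=
  depCoeff (fun u v Lf Lg => (u : ℝ≥0∞) * Lf + (v : ℝ≥0∞) * Lg
    + (u : ℝ≥0∞) * (v : ℝ≥0∞) * Lf * Lg) X μ

/-- The process is `η`-weakly dependent. -/
def EtaWeaklyDependent {Ω : Type*} [MeasurableSpace Ω] (X : ℤ → Ω → ℝ) (μ : Measure Ω) : Prop :=
  Tendsto (etaCoeff X μ) atTop (𝓝 0)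

/-- The process is `λ`-weakly dependent. -/
def LambdaWeaklyDependent {Ω : Type*} [MeasurableSpace Ω] (X : ℤ → Ω → ℝ) (μ : Measure Ω) :
    Prop :=
  Tendsto (lambdaCoeff X μ) atTop (𝓝 0)

/-- The stationary distribution function `F`. -/
def marginalCdf {Ω : Type*} [MeasurableSpace Ω] (X : ℤ → Ω → ℝ) (μ : Measure Ω) (x : ℝ) : ℝ :=
  cdf (μ.map (X 0)) x

/-- The generalized extreme value distribution function `G_γ`, with its values `0` (for `γ > 0`)
and `1` (for `γ < 0`) outside `{x : 1 + γ x > 0}`. -/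
def gev (γ x : ℝ) : ℝ :=
  if γ = 0 then Real.exp (-Real.exp (-x))
  else if 0 < 1 + γ * x then Real.exp (-(1 + γ * x) ^ (-1 / γ))
  else if γ < 0 then 1 else 0

/-- The limit distribution function `H = G_γ ^ θ`. -/
def limitCdf (γ θ x : ℝ) : ℝ := gev γ x ^ θ

/-- The normalization `w_n(x) = x / u_n + v_n`. -/
def normLevel (u v : ℕ → ℝ) (n : ℕ) (x : ℝ) : ℝ := x / u n + v n

/-- The generalized inverse `K^←(t) = inf {x : K(x) ≥ t}`. -/
def genInv (K : ℝ → ℝ) (t : ℝ) : ℝ := sInf {x : ℝ | t ≤ K x}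

/-- The maximum of `X_{s+1}, …, X_{s+m}`. -/
def blockMax {Ω : Type*} (X : ℤ → Ω → ℝ) (s : ℤ) (m : ℕ) (ω : Ω) : ℝ :=
  ⨆ k : Fin m, X (s + 1 + (k : ℕ)) ω

/-- The dependence condition, under `η`- or under `λ`-weak dependence, for convergence of the
normalized maximum with extremal index. -/
def ExtremalMixing {Ω : Type*} [MeasurableSpace Ω] (X : ℤ → Ω → ℝ) (μ : Measure Ω)
    (u : ℕ → ℝ) (a l : ℕ → ℕ) : Prop :=
  (EtaWeaklyDependent X μ ∧
    Tendsto (fun n : ℕ => ENNReal.ofReal ((n : ℝ) / a n) *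
      ((n : ℝ≥0∞) * etaCoeff X μ (l n) * ENNReal.ofReal (u n)) ^ (1 / 2 : ℝ)) atTop (𝓝 0)) ∨
  (LambdaWeaklyDependent X μ ∧
    Tendsto (fun n : ℕ => ENNReal.ofReal ((n : ℝ) / a n) *
      max (((n : ℝ≥0∞) * lambdaCoeff X μ (l n) * ENNReal.ofReal (u n)) ^ (1 / 2 : ℝ))
        (((n : ℝ≥0∞) * (a n : ℝ≥0∞) * lambdaCoeff X μ (l n) * ENNReal.ofReal (u n ^ 2))
          ^ (1 / 3 : ℝ))) atTop (𝓝 0))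

/-- The two subsampling schemes. -/
inductive Scheme : Type
  | overlapping
  | nonOverlapping

/-- The number `N` of subsamples. -/
def numBlocks : Scheme → ℕ → ℕ → ℕ
  | .overlapping, n, b => n - b
  | .nonOverlapping, n, b => n / b

/-- The subsample with number `i` (`0 ≤ i < N`) is `X_{s+1}, …, X_{s+b}` where `s` is
`blockStart S b i`. -/
def blockStart : Scheme → ℕ → ℕ → ℤ
  | .overlapping, _, i => i
  | .nonOverlapping, b, i => i * b

/-- The function equal to `1` on `(-∞, 0]`, to `0` on `[1, ∞)` and affine in between. -/
def ramp (x : ℝ) : ℝ := max 0 (min 1 (1 - x))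

/-- The smooth subsampler of the (non-normalized) maximum, for sample size `n`, subsample size `b`
and smoothing parameter `e`. -/
def smoothSubsampler {Ω : Type*} (S : Scheme) (X : ℤ → Ω → ℝ) (n b : ℕ) (e : ℝ) (ω : Ω)
    (x : ℝ) : ℝ :=
  (1 / (numBlocks S n b : ℝ)) *
    ∑ i ∈ Finset.range (numBlocks S n b), ramp ((blockMax X (blockStart S b i) b ω - x) / e)

/-- Estimated centering: the median of the subsampler `K`. -/
def estCenter (K : ℝ → ℝ) : ℝ := genInv K (1 / 2)

/-- Estimated scaling: the inverse of the distance of two quantiles of the subsampler `K`. -/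
def estScale (K : ℝ → ℝ) (t₁ t₂ : ℝ) : ℝ := |genInv K t₂ - genInv K t₁|⁻¹

/-- The condition on the sums of the weak dependence coefficients `c`. -/
def CoeffSumCondition : Scheme → (ℕ → ℝ≥0∞) → ℕ → (ℕ → ℕ) → Prop
  | .overlapping, c, p, _ =>
      ∑' t : ℕ, ENNReal.ofReal (((t : ℝ) + 1) ^ ((p : ℤ) - 2)) * c t < ⊤
  | .nonOverlapping, c, p, b =>
      ∃ K : ℝ, ∀ᶠ n : ℕ in atTop,
        ∑ t ∈ Finset.range n, ENNReal.ofReal (((t : ℝ) + 1) ^ ((p : ℤ) - 2)) * c t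
          ≤ ENNReal.ofReal (K * (b n : ℝ) ^ ((p : ℤ) - 2))

/-- The bandwidth condition under `η`-weak dependence. -/
def EtaBandwidth : Scheme → ℝ → (ℕ → ℕ) → (ℕ → ℝ) → Prop
  | .overlapping, δ, b, ε =>
      (fun n : ℕ => (b n : ℝ) / ((n : ℝ) ^ (1 - δ) * ε n)) =O[atTop] (fun _ => (1 : ℝ))
  | .nonOverlapping, δ, b, ε =>
      (fun n : ℕ => (b n : ℝ) ^ 2 / ((n : ℝ) ^ (1 - δ) * ε n)) =O[atTop] (fun _ => (1 : ℝ))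

/-- The bandwidth condition under `λ`-weak dependence; it is the same for both schemes. -/
def LambdaBandwidth (δ : ℝ) (b : ℕ → ℕ) (ε : ℕ → ℝ) : Prop :=
  (fun n : ℕ => (b n : ℝ) ^ 2 / ((n : ℝ) ^ (1 - δ) * ε n ^ 2)) =O[atTop] (fun _ => (1 : ℝ))

/-- The summability and bandwidth conditions, under `η`- or under `λ`-weak dependence. -/
def SubsamplingCondition {Ω : Type*} [MeasurableSpace Ω] (S : Scheme) (X : ℤ → Ω → ℝ)
    (μ : Measure Ω) (p : ℕ) (δ : ℝ) (b : ℕ → ℕ) (ε : ℕ → ℝ) : Prop :=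
  (EtaWeaklyDependent X μ ∧ CoeffSumCondition S (etaCoeff X μ) p b ∧ EtaBandwidth S δ b ε) ∨
  (LambdaWeaklyDependent X μ ∧ CoeffSumCondition S (lambdaCoeff X μ) p b ∧ LambdaBandwidth δ b ε)

end

end ExtremeSubsampling

namespace ExtremeSubsampling

noncomputable section

/-! ### Covariance inequalities from the weak dependence coefficients. -/

section WeakDependence

/-! The smooth subsampler concentrates around its mean, its mean converges to `limitCdf γ θ`, and
convergence of distribution functions survives normalization by their own quantiles.

Concentration. The `p`-th central moment is at most `N⁻ᵖ` times the sum of the absolute mixed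
moments of the centered smoothed block indicators over all `p`-tuples of blocks. An ordered
`q`-tuple is cut at its largest gap `r`. Its moment differs from the product of the moments of the
two groups by at most a covariance bound `C r`, and for a given cut position at most `N (r + 1) ^ (q
- 2)` ordered tuples have largest gap `r`. Recursion on `q`, started from the vanishing first
moments, gives the order `N ^ q * B ^ ⌈q/2⌉` as soon as `∑ C r (r + 1) ^ (q - 2)` is of order `(N B)
^ (q - 1)` (`exists_absMoment_le`). A block maximum is 1-Lipschitz for the `ℓ¹` distance, so a
product of at most `p` ramps is Lipschitz of order `1 / ε` in `O(b)` coordinates. Weak dependence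
then bounds `C r` by a coefficient times `b / ε`, or by one times `b / ε + (b / ε) ^ 2` for `λ`
(`abs_integral_blockProd_le`). The bandwidth condition permits `B = n ^ (-δ)`.

Mean. By stationarity the mean is the expectation of one smoothed indicator, which lies between the
probabilities that `M_b` stays below `w_b(x)` and below `w_b(x + ε u_b)`. It remains to find the
limit law of `M_n` (`tendsto_maxCdf`). The sample is cut into blocks of length `a` separated by gaps
of length `l`, which makes the blocks nearly independent. Independence of the indicators is obtained
after smoothing the level over a width `s / u_n`, and the smoothing costs an increment of `F`. A
pigeonhole argument (`exists_small_increment`) finds a level near the given one where this increment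
is small, and monotonicity in the level carries the estimate back. The definition of `θ` makes the
product over blocks converge to `exp (-θ τ)`, where `τ` is the limit of `n (1 - F(w_n(x)))`.

Almost sure statement. For even `p` with `p δ > 2` the moments are summable, so convergence holds
almost surely at all rational points at once. Monotonicity, Pólya's theorem and the convergence of
quantiles finish the proof for each such path; the unknown `u` and `v` cancel
(`tendstoUniformly_estimated_normalization`). -/

lemma lip_le {u : ℕ} {f : (Fin u → ℝ) → ℝ} {L : ℝ} (hL : 0 ≤ L)
    (h : ∀ x y, |f y - f x| ≤ L * ∑ i, |y i - x i|) : lip f ≤ ENNReal.ofReal L := by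
  refine iSup_le fun x => iSup_le fun y => iSup_le fun _ => ?_
  apply ENNReal.div_le_of_le_mul
  rw [← ENNReal.ofReal_mul hL]
  exact ENNReal.ofReal_le_ofReal (h x y)

lemma eq_of_lip_eq_zero {u : ℕ} {f : (Fin u → ℝ) → ℝ} (h : lip f = 0) (x y : Fin u → ℝ) :
    f y = f x := by
  by_cases hxy : y = x
  · rw [hxy]
  have h1 : ENNReal.ofReal |f y - f x| / ENNReal.ofReal (∑ i, |y i - x i|) ≤ lip f :=
    le_iSup_of_le x <| le_iSup_of_le y <| le_iSup_of_le hxy le_rfl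
  rw [h, nonpos_iff_eq_zero, ENNReal.div_eq_zero_iff] at h1
  rcases h1 with h1 | h1
  · rw [ENNReal.ofReal_eq_zero] at h1
    have := abs_nonpos_iff.1 h1
    linarith
  · exact absurd h1 ENNReal.ofReal_ne_top

variable {Ω : Type*} [MeasurableSpace Ω] {μ : Measure Ω} {X : ℤ → Ω → ℝ}

/-- The supremum gives the bound by clearing the denominator. This fails for a vanishing weight, but
then `hΨ` makes `f` constant and the covariance is zero. -/
lemma ofReal_abs_cov_le_depCoeff_mul [IsProbabilityMeasure μ]
    {Ψ : ℕ → ℕ → ℝ≥0∞ → ℝ≥0∞ → ℝ≥0∞} {r u v : ℕ}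
    {s : Fin (u + 1) → ℤ} {t : Fin (v + 1) → ℤ}
    {f : (Fin (u + 1) → ℝ) → ℝ} {g : (Fin (v + 1) → ℝ) → ℝ}
    (hs : Monotone s) (ht : Monotone t) (hst : t 0 - s (Fin.last u) = (r : ℤ))
    (hf : lip f < ⊤) (hg : lip g < ⊤) (hf1 : ∀ x, |f x| ≤ 1) (hg1 : ∀ x, |g x| ≤ 1)
    (hΨ : Ψ (u + 1) (v + 1) (lip f) (lip g) = 0 → lip f = 0)
    (hΨtop : Ψ (u + 1) (v + 1) (lip f) (lip g) ≠ ⊤) :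
    ENNReal.ofReal |cov[fun ω => f (fun i => X (s i) ω), fun ω => g (fun j => X (t j) ω); μ]|
      ≤ depCoeff Ψ X μ r * Ψ (u + 1) (v + 1) (lip f) (lip g) := by
  by_cases h0 : Ψ (u + 1) (v + 1) (lip f) (lip g) = 0
  · have hc : (fun ω => f (fun i => X (s i) ω)) = fun _ => f 0 := by
      funext ω
      exact eq_of_lip_eq_zero (hΨ h0) _ _
    rw [hc]
    simp
  · rw [← ENNReal.div_le_iff h0 hΨtop]
    exact le_iSup_of_le u <| le_iSup_of_le v <| le_iSup_of_le s <| le_iSup_of_le t <|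
      le_iSup_of_le f <| le_iSup_of_le g <| le_iSup_of_le hs <| le_iSup_of_le ht <|
      le_iSup_of_le hst <| le_iSup_of_le hf <| le_iSup_of_le hg <| le_iSup_of_le hf1 <|
      le_iSup_of_le hg1 le_rfl

/-- Extension by zero of a vector indexed by the sorted elements of `A`. -/
def extendZero (A : Finset ℤ) (z : Fin A.card → ℝ) (t : ℤ) : ℝ :=
  if h : t ∈ A then z ((A.orderIsoOfFin rfl).symm ⟨t, h⟩) else 0

lemma extendZero_apply_orderEmb (A : Finset ℤ) (z : Fin A.card → ℝ) (i : Fin A.card) :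
    extendZero A z (A.orderEmbOfFin rfl i) = z i := by
  have h : A.orderEmbOfFin rfl i ∈ A := A.orderEmbOfFin_mem rfl i
  rw [extendZero, dif_pos h]
  congr 1
  rw [OrderIso.symm_apply_eq]
  rfl

lemma sum_orderEmb (A : Finset ℤ) (φ : ℤ → ℝ) :
    ∑ t ∈ A, φ t = ∑ i, φ (A.orderEmbOfFin rfl i) := by
  rw [← Finset.sum_coe_sort A, ← (A.orderIsoOfFin rfl).toEquiv.sum_comp]
  rfl

lemma sum_abs_extendZero (A : Finset ℤ) (z z' : Fin A.card → ℝ) :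
    ∑ t ∈ A, |extendZero A z t - extendZero A z' t| = ∑ i, |z i - z' i| := by
  rw [sum_orderEmb]
  simp only [extendZero_apply_orderEmb]

/-- The Lipschitz bound sees only the coordinates in `A`, so `ψ` cannot depend on the others. This
turns path functionals into functions of finite tuples. -/
lemma apply_extendZero {A : Finset ℤ} {ψ : (ℤ → ℝ) → ℝ} {L : ℝ}
    (hψ : ∀ x y, |ψ x - ψ y| ≤ L * ∑ t ∈ A, |x t - y t|) (x : ℤ → ℝ) :
    ψ (extendZero A fun i => x (A.orderEmbOfFin rfl i)) = ψ x := by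
  have h := hψ (extendZero A fun i => x (A.orderEmbOfFin rfl i)) x
  rw [sum_orderEmb] at h
  simp only [extendZero_apply_orderEmb, sub_self, abs_zero, Finset.sum_const_zero, mul_zero] at h
  linarith [abs_nonpos_iff.1 h]

/-- Covariances of bounded Lipschitz functionals of `(X_t)_{t ∈ A}` and `(X_t)_{t ∈ B}`, where `B`
lies at least `r` time units after `A`, are bounded by `c` times the weight
`|A| L + |B| M + κ |A| |B| L M`. -/
def CovBound {Ω : Type*} [MeasurableSpace Ω] (X : ℤ → Ω → ℝ) (μ : Measure Ω)
    (κ : ℝ) (r : ℕ) (c : ℝ) : Prop :=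
  ∀ (A B : Finset ℤ) (ψ χ : (ℤ → ℝ) → ℝ) (L M : ℝ), A.Nonempty → B.Nonempty →
    (∀ a ∈ A, ∀ b ∈ B, a + r ≤ b) → 0 ≤ L → 0 ≤ M → (∀ x, |ψ x| ≤ 1) → (∀ x, |χ x| ≤ 1) →
    (∀ x y, |ψ x - ψ y| ≤ L * ∑ t ∈ A, |x t - y t|) →
    (∀ x y, |χ x - χ y| ≤ M * ∑ t ∈ B, |x t - y t|) →
    |cov[fun ω => ψ (fun t => X t ω), fun ω => χ (fun t => X t ω); μ]| ≤
      c * (A.card * L + B.card * M + κ * (A.card * B.card * L * M))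

/-- The coefficient at lag `r` only speaks of tuples whose distance is exactly `r`, whereas `B` may
lie farther from `A`. One dummy index is therefore added to each tuple: `min B - r` after `A`, and a
second copy of `min B` before `B`. The functions ignore the dummy entries, and the only price is
`A.card + 1` and `B.card + 1` in the weight. -/
lemma ofReal_abs_cov_le [IsProbabilityMeasure μ]
    {Ψ : ℕ → ℕ → ℝ≥0∞ → ℝ≥0∞ → ℝ≥0∞} {r : ℕ} {A B : Finset ℤ} {ψ χ : (ℤ → ℝ) → ℝ} {L M : ℝ}
    (hmono : ∀ u v L L' M M', L ≤ L' → M ≤ M' → Ψ u v L M ≤ Ψ u v L' M')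
    (hzero : ∀ u v L M, Ψ (u + 1) (v + 1) L M = 0 → L = 0)
    (htop : ∀ u v (L M : ℝ), Ψ u v (ENNReal.ofReal L) (ENNReal.ofReal M) ≠ ⊤)
    (hB : B.Nonempty) (hAB : ∀ a ∈ A, ∀ b ∈ B, a + r ≤ b)
    (hL : 0 ≤ L) (hM : 0 ≤ M) (hψ1 : ∀ x, |ψ x| ≤ 1) (hχ1 : ∀ x, |χ x| ≤ 1)
    (hψ : ∀ x y, |ψ x - ψ y| ≤ L * ∑ t ∈ A, |x t - y t|)
    (hχ : ∀ x y, |χ x - χ y| ≤ M * ∑ t ∈ B, |x t - y t|) :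
    ENNReal.ofReal |cov[fun ω => ψ (fun t => X t ω), fun ω => χ (fun t => X t ω); μ]| ≤
      depCoeff Ψ X μ r * Ψ (A.card + 1) (B.card + 1) (ENNReal.ofReal L) (ENNReal.ofReal M) := by
  set m := B.min' hB with hm
  let s : Fin (A.card + 1) → ℤ := Fin.snoc (α := fun _ => ℤ) (A.orderEmbOfFin rfl) (m - r)
  let t : Fin (B.card + 1) → ℤ := Fin.cons (α := fun _ => ℤ) m (B.orderEmbOfFin rfl)
  let f : (Fin (A.card + 1) → ℝ) → ℝ := fun z => ψ (extendZero A fun i => z i.castSucc)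
  let g : (Fin (B.card + 1) → ℝ) → ℝ := fun z => χ (extendZero B fun i => z i.succ)
  have hs : Monotone s := by
    intro i j hij
    induction j using Fin.lastCases with
    | last =>
      induction i using Fin.lastCases with
      | last => exact le_rfl
      | cast i =>
        simp only [s, Fin.snoc_castSucc, Fin.snoc_last]
        have := hAB _ (A.orderEmbOfFin_mem rfl i) m (B.min'_mem hB)
        omega
    | cast j =>
      induction i using Fin.lastCases with
      | last => exact absurd hij (not_le.2 (Fin.castSucc_lt_last j))
      | cast i =>
        simp only [s, Fin.snoc_castSucc]
        exact (A.orderEmbOfFin rfl).monotone (by simpa using hij)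
  have ht : Monotone t := by
    intro i j hij
    induction i using Fin.cases with
    | zero =>
      induction j using Fin.cases with
      | zero => exact le_rfl
      | succ j =>
        simp only [t, Fin.cons_zero, Fin.cons_succ]
        exact B.min'_le _ (B.orderEmbOfFin_mem rfl j)
    | succ i =>
      induction j using Fin.cases with
      | zero => exact absurd hij (not_le.2 (Fin.succ_pos i))
      | succ j =>
        simp only [t, Fin.cons_succ]
        exact (B.orderEmbOfFin rfl).monotone (by simpa using hij)
  have hst : t 0 - s (Fin.last A.card) = (r : ℤ) := by
    simp [s, t]
  have hfl : lip f ≤ ENNReal.ofReal L := by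
    refine lip_le hL fun x y => (hψ _ _).trans ?_
    rw [sum_abs_extendZero, Fin.sum_univ_castSucc (n := A.card)]
    gcongr
    simp
  have hgl : lip g ≤ ENNReal.ofReal M := by
    refine lip_le hM fun x y => (hχ _ _).trans ?_
    rw [sum_abs_extendZero, Fin.sum_univ_succ (n := B.card)]
    gcongr
    simp
  have hle := hmono (A.card + 1) (B.card + 1) _ _ _ _ hfl hgl
  have key := ofReal_abs_cov_le_depCoeff_mul (X := X) (μ := μ) (Ψ := Ψ) hs ht hst
    (hfl.trans_lt ENNReal.ofReal_lt_top) (hgl.trans_lt ENNReal.ofReal_lt_top)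
    (fun x => hψ1 _) (fun x => hχ1 _) (hzero _ _ _ _) (ne_top_of_le_ne_top (htop _ _ _ _) hle)
  have e1 : (fun ω => f (fun i => X (s i) ω)) = fun ω => ψ (fun t => X t ω) := by
    funext ω
    simp only [f, s, Fin.snoc_castSucc]
    exact apply_extendZero hψ fun t => X t ω
  have e2 : (fun ω => g (fun i => X (t i) ω)) = fun ω => χ (fun t => X t ω) := by
    funext ω
    simp only [g, t, Fin.cons_succ]
    exact apply_extendZero hχ fun t => X t ω
  rw [e1, e2] at key
  exact key.trans (by gcongr)

/-- The dummy indices at most double each cardinality. The factor `4` covers this here and also in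
the product term of `covBound_lambda`. -/
lemma covBound_eta [IsProbabilityMeasure μ] {r : ℕ} (h : etaCoeff X μ r ≠ ⊤) :
    CovBound X μ 0 r (4 * (etaCoeff X μ r).toReal) := by
  intro A B ψ χ L M hA hB hAB hL hM hψ1 hχ1 hψ hχ
  have key := ofReal_abs_cov_le (X := X) (μ := μ)
    (Ψ := fun u v Lf Lg => (u : ℝ≥0∞) * Lf + (v : ℝ≥0∞) * Lg)
    (fun u v L L' M M' h1 h2 => by gcongr)
    (fun u v L M h => by
      simp only [add_eq_zero, mul_eq_zero, Nat.cast_eq_zero] at h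
      simpa using h.1)
    (fun u v L M => by finiteness) hB hAB hL hM hψ1 hχ1 hψ hχ
  change _ ≤ etaCoeff X μ r * _ at key
  have hA1 : (1 : ℝ) ≤ A.card := by exact_mod_cast hA.card_pos
  have hB1 : (1 : ℝ) ≤ B.card := by exact_mod_cast hB.card_pos
  rw [ENNReal.ofReal_le_iff_le_toReal (by finiteness)] at key
  refine key.trans ?_
  rw [ENNReal.toReal_mul, ENNReal.toReal_add (by finiteness) (by finiteness)]
  simp only [ENNReal.toReal_mul, ENNReal.toReal_natCast, ENNReal.toReal_ofReal hL,
    ENNReal.toReal_ofReal hM]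
  push_cast
  rw [mul_comm (4 : ℝ), mul_assoc (_ : ℝ) 4]
  refine mul_le_mul_of_nonneg_left ?_ ENNReal.toReal_nonneg
  nlinarith [mul_le_mul_of_nonneg_right hA1 hL, mul_le_mul_of_nonneg_right hB1 hM]

lemma covBound_lambda [IsProbabilityMeasure μ] {r : ℕ} (h : lambdaCoeff X μ r ≠ ⊤) :
    CovBound X μ 1 r (4 * (lambdaCoeff X μ r).toReal) := by
  intro A B ψ χ L M hA hB hAB hL hM hψ1 hχ1 hψ hχ
  have key := ofReal_abs_cov_le (X := X) (μ := μ)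
    (Ψ := fun u v Lf Lg => (u : ℝ≥0∞) * Lf + (v : ℝ≥0∞) * Lg
      + (u : ℝ≥0∞) * (v : ℝ≥0∞) * Lf * Lg)
    (fun u v L L' M M' h1 h2 => by gcongr)
    (fun u v L M h => by
      simp only [add_eq_zero, mul_eq_zero, Nat.cast_eq_zero] at h
      simpa using h.1.1)
    (fun u v L M => by finiteness) hB hAB hL hM hψ1 hχ1 hψ hχ
  change _ ≤ lambdaCoeff X μ r * _ at key
  have hA1 : (1 : ℝ) ≤ A.card := by exact_mod_cast hA.card_pos
  have hB1 : (1 : ℝ) ≤ B.card := by exact_mod_cast hB.card_pos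
  rw [ENNReal.ofReal_le_iff_le_toReal (by finiteness)] at key
  refine key.trans ?_
  rw [ENNReal.toReal_mul, ENNReal.toReal_add (by finiteness) (by finiteness),
    ENNReal.toReal_add (by finiteness) (by finiteness)]
  simp only [ENNReal.toReal_mul, ENNReal.toReal_natCast, ENNReal.toReal_ofReal hL,
    ENNReal.toReal_ofReal hM]
  push_cast
  rw [mul_comm (4 : ℝ), mul_assoc (_ : ℝ) 4]
  refine mul_le_mul_of_nonneg_left ?_ ENNReal.toReal_nonneg
  have h3 : ((A.card : ℝ) + 1) * (B.card + 1) * L * M ≤ 4 * (A.card * B.card * L * M) := by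
    have : ((A.card : ℝ) + 1) * (B.card + 1) ≤ (2 * A.card) * (2 * B.card) := by
      gcongr <;> linarith
    have := mul_le_mul_of_nonneg_right this (mul_nonneg hL hM)
    linarith
  nlinarith [mul_le_mul_of_nonneg_right hA1 hL, mul_le_mul_of_nonneg_right hB1 hM]

end WeakDependence

/-! ### A moment inequality by cutting tuples at their largest gap. -/

section MomentInequality

/-- The gap between consecutive entries of a tuple. -/
def gap {m N : ℕ} (i : Fin (m + 2) → Fin N) (j : Fin (m + 1)) : ℕ :=
  (i j.succ : ℕ) - (i j.castSucc : ℕ)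

lemma eq_of_gap_eq {m N : ℕ} {i i' : Fin (m + 2) → Fin N} (hi : Monotone i) (hi' : Monotone i')
    (h0 : i 0 = i' 0) (hg : ∀ j, gap i j = gap i' j) : i = i' := by
  funext j
  induction j using Fin.induction with
  | zero => exact h0
  | succ j ih =>
    have h1 : (i j.castSucc : ℕ) ≤ i j.succ := hi (Fin.castSucc_le_succ j)
    have h2 : (i' j.castSucc : ℕ) ≤ i' j.succ := hi' (Fin.castSucc_le_succ j)
    have h3 := hg j
    simp only [gap] at h3
    rw [← ih] at h2 h3
    apply Fin.ext
    omega

/-- Monotone tuples are determined by their first entry and their gaps. -/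
lemma card_monotone_maxGap_le {m N : ℕ} (j₀ : Fin (m + 1)) (r : ℕ)
    (s : Finset (Fin (m + 2) → Fin N))
    (hs : ∀ i ∈ s, Monotone i ∧ gap i j₀ = r ∧ ∀ j, gap i j ≤ r) :
    s.card ≤ N * (r + 1) ^ m := by
  classical
  let T : Fin (m + 1) → Finset ℕ := fun j => if j = j₀ then {r} else Finset.range (r + 1)
  have h := Finset.card_le_card_of_injOn (s := s)
    (t := (Finset.univ : Finset (Fin N)) ×ˢ Fintype.piFinset T)
    (fun i => (i 0, gap i)) (by
      intro i hi
      obtain ⟨-, h1, h2⟩ := hs i hi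
      simp only [Finset.coe_product, Set.mem_prod, Finset.mem_coe, Finset.mem_univ,
        Fintype.mem_piFinset, true_and, T]
      intro j
      split_ifs with hj
      · simp [hj, h1]
      · simpa [Nat.lt_succ_iff] using h2 j) (by
      intro i hi i' hi' heq
      simp only [Prod.mk.injEq] at heq
      exact eq_of_gap_eq (hs i hi).1 (hs i' hi').1 heq.1 (congrFun heq.2))
  refine h.trans (le_of_eq ?_)
  rw [Finset.card_product, Fintype.card_piFinset, Finset.card_univ, Fintype.card_fin]
  congr 1
  rw [← Finset.mul_prod_erase _ _ (Finset.mem_univ j₀), Finset.prod_congr rfl (g := fun _ => r + 1)]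
  · simp [T]
  · intro j hj
    simp [T, Finset.ne_of_mem_erase hj]

/-- The tuples are grouped by the value `r` of their largest gap; each group is counted by
`card_monotone_maxGap_le`. -/
lemma sum_maxGap_le {m N : ℕ} (C : ℕ → ℝ) (hC : ∀ r, 0 ≤ C r) (j₀ : Fin (m + 1))
    (s : Finset (Fin (m + 2) → Fin N))
    (hs : ∀ i ∈ s, Monotone i ∧ ∀ j, gap i j ≤ gap i j₀) :
    ∑ i ∈ s, C (gap i j₀) ≤ N * ∑ r ∈ Finset.range N, C r * ((r : ℝ) + 1) ^ m := by
  classical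
  have h1 : ∀ i ∈ s, gap i j₀ ∈ Finset.range N := by
    intro i _
    have := (i j₀.succ).2
    simp only [gap, Finset.mem_range]
    omega
  rw [← Finset.sum_fiberwise_of_maps_to h1, Finset.mul_sum]
  refine Finset.sum_le_sum fun r _ => ?_
  rw [Finset.sum_congr rfl (g := fun _ => C r), Finset.sum_const, nsmul_eq_mul]
  · have hcard := card_monotone_maxGap_le j₀ r (s.filter fun i => gap i j₀ = r) (by
      intro i hi
      rw [Finset.mem_filter] at hi
      exact ⟨(hs i hi.1).1, hi.2, fun j => hi.2 ▸ (hs i hi.1).2 j⟩)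
    have : ((s.filter fun i => gap i j₀ = r).card : ℝ) ≤ N * ((r : ℝ) + 1) ^ m := by
      exact_mod_cast hcard
    calc _ ≤ (N * ((r : ℝ) + 1) ^ m) * C r := by gcongr; exact hC r
      _ = _ := by ring
  · intro i hi
    rw [(Finset.mem_filter.1 hi).2]

variable {Ω : Type*} [MeasurableSpace Ω]

/-- The sum of the absolute mixed moments over all tuples indexed by `ι`. -/
def absMoment (μ : Measure Ω) (Z : ℕ → Ω → ℝ) (N : ℕ) (ι : Type) [Fintype ι] [DecidableEq ι] : ℝ :=
  ∑ i : ι → Fin N, |∫ ω, ∏ j, Z (i j) ω ∂μ|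

variable {μ : Measure Ω} {Z : ℕ → Ω → ℝ} {N : ℕ}

lemma absMoment_nonneg (ι : Type) [Fintype ι] [DecidableEq ι] : 0 ≤ absMoment μ Z N ι :=
  Finset.sum_nonneg fun _ _ => abs_nonneg _

lemma absMoment_congr {ι ι' : Type} [Fintype ι] [DecidableEq ι] [Fintype ι'] [DecidableEq ι']
    (e : ι ≃ ι') : absMoment μ Z N ι = absMoment μ Z N ι' := by
  unfold absMoment
  rw [← (e.arrowCongr (Equiv.refl (Fin N))).sum_comp]
  refine Finset.sum_congr rfl fun i _ => ?_
  congr 2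
  funext ω
  rw [← e.prod_comp]
  simp

/-- A tuple indexed by `ι` is a free pair of tuples indexed by the two halves, so the sum
factorizes. -/
lemma sum_abs_split (ι : Type) [Fintype ι] [DecidableEq ι] (P : ι → Prop) [DecidablePred P] :
    ∑ i : ι → Fin N, |∫ ω, ∏ j : {j // P j}, Z (i j) ω ∂μ| *
      |∫ ω, ∏ j : {j // ¬ P j}, Z (i j) ω ∂μ| =
    absMoment μ Z N {j // P j} * absMoment μ Z N {j // ¬ P j} := by
  unfold absMoment
  rw [Finset.sum_mul_sum, ← Fintype.sum_prod_type',
    ← (Equiv.piEquivPiSubtypeProd P fun _ => Fin N).sum_comp]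
  rfl

/-- The product is symmetric and each tuple becomes monotone under some permutation, so summing over
all permutations counts every tuple at least once. -/
lemma absMoment_le_factorial_mul (q : ℕ) :
    absMoment μ Z N (Fin q) ≤ q.factorial *
      ∑ i ∈ (Finset.univ.filter Monotone : Finset (Fin q → Fin N)),
        |∫ ω, ∏ j, Z (i j) ω ∂μ| := by
  classical
  unfold absMoment
  have h1 : ∀ i : Fin q → Fin N, |∫ ω, ∏ j, Z (i j) ω ∂μ| ≤
      ∑ σ : Equiv.Perm (Fin q), if Monotone (i ∘ σ) then |∫ ω, ∏ j, Z ((i ∘ σ) j) ω ∂μ| else 0 := by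
    intro i
    refine le_trans (le_of_eq ?_) (Finset.single_le_sum (f := fun σ : Equiv.Perm (Fin q) =>
      if Monotone (i ∘ σ) then |∫ ω, ∏ j, Z ((i ∘ σ) j) ω ∂μ| else 0)
      (fun σ _ => by split_ifs <;> positivity) (Finset.mem_univ (Tuple.sort i)))
    rw [if_pos (Tuple.monotone_sort i)]
    congr 2
    funext ω
    exact (Equiv.prod_comp (Tuple.sort i) fun j => Z (i j) ω).symm
  refine (Finset.sum_le_sum fun i _ => h1 i).trans (le_of_eq ?_)
  rw [Finset.sum_comm]
  have h2 : ∀ σ : Equiv.Perm (Fin q),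
      (∑ i : Fin q → Fin N,
        if Monotone (i ∘ σ) then |∫ ω, ∏ j, Z ((i ∘ σ) j) ω ∂μ| else 0) =
      ∑ i ∈ (Finset.univ.filter Monotone : Finset (Fin q → Fin N)),
        |∫ ω, ∏ j, Z (i j) ω ∂μ| := by
    intro σ
    rw [Finset.sum_filter]
    exact (σ.symm.arrowCongr (Equiv.refl (Fin N))).sum_comp
      (fun i : Fin q → Fin N => if Monotone i then |∫ ω, ∏ j, Z (i j) ω ∂μ| else 0)
  rw [Finset.sum_congr rfl fun σ _ => h2 σ, Finset.sum_const, nsmul_eq_mul, Finset.card_univ,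
    Fintype.card_perm, Fintype.card_fin]

/-- Products of at most `p` of the variables `Z` in two groups of indices which are `r` apart are
uncorrelated up to `C r`. -/
def GapDecorrelation (μ : Measure Ω) (Z : ℕ → Ω → ℝ) (N p : ℕ) (C : ℕ → ℝ) : Prop :=
  ∀ (ι₁ ι₂ : Type) [Fintype ι₁] [Fintype ι₂] [Nonempty ι₁] [Nonempty ι₂]
    (i₁ : ι₁ → Fin N) (i₂ : ι₂ → Fin N) (r : ℕ),
    Fintype.card ι₁ + Fintype.card ι₂ ≤ p → (∀ a b, (i₁ a : ℕ) + r ≤ i₂ b) →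
    |∫ ω, (∏ a, Z (i₁ a) ω) * ∏ b, Z (i₂ b) ω ∂μ
      - (∫ ω, ∏ a, Z (i₁ a) ω ∂μ) * ∫ ω, ∏ b, Z (i₂ b) ω ∂μ| ≤ C r

/-- A monotone tuple is cut at a largest gap, where decorrelation replaces its moment by the product
of two shorter ones. Summing over all cut positions, with the error charged only where the gap is
maximal, avoids choosing the position as a function of the tuple. -/
lemma sum_monotone_le {m p : ℕ} {C : ℕ → ℝ} (hC : ∀ r, 0 ≤ C r)
    (hmp : m + 2 ≤ p) (hdec : GapDecorrelation μ Z N p C) :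
    ∑ i ∈ (Finset.univ.filter Monotone : Finset (Fin (m + 2) → Fin N)),
        |∫ ω, ∏ j, Z (i j) ω ∂μ| ≤
      ∑ j₀ : Fin (m + 1), (N * ∑ r ∈ Finset.range N, C r * ((r : ℝ) + 1) ^ m
        + absMoment μ Z N {j // j ≤ j₀.castSucc} * absMoment μ Z N {j // ¬ j ≤ j₀.castSucc}) := by
  classical
  have hpt : ∀ i : Fin (m + 2) → Fin N, Monotone i →
      |∫ ω, ∏ j, Z (i j) ω ∂μ| ≤ ∑ j₀ : Fin (m + 1),
        ((if ∀ j, gap i j ≤ gap i j₀ then C (gap i j₀) else 0) +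
        |∫ ω, ∏ j : {j // j ≤ j₀.castSucc}, Z (i j) ω ∂μ| *
          |∫ ω, ∏ j : {j // ¬ j ≤ j₀.castSucc}, Z (i j) ω ∂μ|) := by
    intro i hi
    obtain ⟨j₀, hj₀⟩ := Finite.exists_max (gap i)
    refine le_trans ?_ (Finset.single_le_sum (f := fun j₀ : Fin (m + 1) =>
      (if ∀ j, gap i j ≤ gap i j₀ then C (gap i j₀) else 0) +
        |∫ ω, ∏ j : {j // j ≤ j₀.castSucc}, Z (i j) ω ∂μ| *
          |∫ ω, ∏ j : {j // ¬ j ≤ j₀.castSucc}, Z (i j) ω ∂μ|) (fun σ _ => by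
            have := hC (gap i σ)
            split_ifs <;> positivity) (Finset.mem_univ j₀))
    rw [if_pos hj₀]
    have : Nonempty {j : Fin (m + 2) // j ≤ j₀.castSucc} := ⟨⟨_, le_rfl⟩⟩
    have : Nonempty {j : Fin (m + 2) // ¬ j ≤ j₀.castSucc} :=
      ⟨⟨j₀.succ, not_le.2 (Fin.castSucc_lt_succ)⟩⟩
    have hd := hdec {j // j ≤ j₀.castSucc} {j // ¬ j ≤ j₀.castSucc}
      (fun j => i j) (fun j => i j) (gap i j₀) (by
        rw [← Fintype.card_sum, Fintype.card_congr (Equiv.sumCompl _), Fintype.card_fin]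
        exact hmp) (by
        intro a b
        have h1 : (i a : ℕ) ≤ i j₀.castSucc := hi a.2
        have h2 : (i j₀.succ : ℕ) ≤ i b := hi (by
          have := not_le.1 b.2
          exact Fin.castSucc_lt_iff_succ_le.1 this)
        have h3 : (i j₀.castSucc : ℕ) ≤ i j₀.succ := hi (Fin.castSucc_le_succ j₀)
        simp only [gap]
        omega)
    have hprod : ∀ ω, (∏ j : {j // j ≤ j₀.castSucc}, Z (i j) ω) *
        ∏ j : {j // ¬ j ≤ j₀.castSucc}, Z (i j) ω = ∏ j, Z (i j) ω := fun ω =>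
      Fintype.prod_subtype_mul_prod_subtype (fun j => j ≤ j₀.castSucc) fun j => Z (i j) ω
    simp only [hprod] at hd
    rw [← abs_mul]
    have := abs_sub_abs_le_abs_sub (∫ ω, ∏ j, Z (i j) ω ∂μ)
      ((∫ ω, ∏ j : {j // j ≤ j₀.castSucc}, Z (i j) ω ∂μ) *
          ∫ ω, ∏ j : {j // ¬ j ≤ j₀.castSucc}, Z (i j) ω ∂μ)
    linarith
  refine (Finset.sum_le_sum fun i hi => hpt i (Finset.mem_filter.1 hi).2).trans ?_
  rw [Finset.sum_comm]
  refine Finset.sum_le_sum fun j₀ _ => ?_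
  rw [Finset.sum_add_distrib]
  refine add_le_add ?_ ?_
  · rw [← Finset.sum_filter]
    refine sum_maxGap_le C hC j₀ _ fun i hi => ?_
    simp only [Finset.mem_filter, Finset.mem_univ, true_and] at hi
    exact hi
  -- Dropping the monotonicity constraint is what lets the sum of products factorize.
  · rw [← sum_abs_split]
    exact Finset.sum_le_sum_of_subset_of_nonneg (Finset.filter_subset _ _)
      fun i _ _ => by positivity

/-- A moment inequality for bounded variables whose correlations decay with the gap. -/
lemma exists_absMoment_le (D : ℝ) (p q : ℕ) (hq1 : 1 ≤ q) (hqp : q ≤ p) :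
    ∃ K : ℝ, 0 ≤ K ∧ ∀ (Z : ℕ → Ω → ℝ) (N : ℕ) (C : ℕ → ℝ) (B : ℝ), (∀ r, 0 ≤ C r) → 0 ≤ B →
      B ≤ 1 → (∀ i < N, ∫ ω, Z i ω ∂μ = 0) → GapDecorrelation μ Z N p C →
      (∀ q, 2 ≤ q → q ≤ p → N * ∑ r ∈ Finset.range N, C r * ((r : ℝ) + 1) ^ (q - 2) ≤
        D * (N ^ q * B ^ (q - 1))) →
      ∀ (ι : Type) [Fintype ι] [DecidableEq ι], Fintype.card ι = q →
        absMoment μ Z N ι ≤ K * (N ^ q * B ^ ((q + 1) / 2)) := by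
  classical
  induction q using Nat.strong_induction_on with
  | _ q ih =>
  -- First moments vanish by centering. Without this base case no power of `B` would be gained.
  rcases Nat.lt_or_ge q 2 with hq2 | hq2
  · obtain rfl : q = 1 := by omega
    refine ⟨0, le_rfl, fun Z N C B hC hB hB1 hZ hdec hV ι _ _ hι => ?_⟩
    rw [absMoment_congr (Fintype.equivFinOfCardEq hι)]
    simp only [absMoment, zero_mul]
    refine le_of_eq (Finset.sum_eq_zero fun i _ => ?_)
    simpa using hZ (i 0) (i 0).2
  obtain ⟨m, rfl⟩ : ∃ m, q = m + 2 := ⟨q - 2, by omega⟩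
  choose! K hK0 hK using fun k (h : k < m + 2) (h1 : 1 ≤ k) => ih k h h1 (h.le.trans hqp)
  have hKnn : ∀ j₀ : Fin (m + 1), 0 ≤ K (j₀ + 1) * K (m + 1 - j₀) := fun j₀ =>
    mul_nonneg (hK0 _ (by omega) (by omega)) (hK0 _ (by omega) (by omega))
  refine ⟨(m + 2).factorial * ∑ j₀ : Fin (m + 1), (|D| + K (j₀ + 1) * K (m + 1 - j₀)),
    mul_nonneg (by positivity) (Finset.sum_nonneg fun j₀ _ =>
      add_nonneg (abs_nonneg _) (hKnn j₀)),
    fun Z N C B hC hB hB1 hZ hdec hV ι _ _ hι => ?_⟩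
  rw [absMoment_congr (Fintype.equivFinOfCardEq hι)]
  refine (absMoment_le_factorial_mul (m + 2)).trans ?_
  rw [mul_assoc]
  refine mul_le_mul_of_nonneg_left ?_ (by positivity)
  refine (sum_monotone_le hC hqp hdec).trans ?_
  rw [Finset.sum_mul]
  refine Finset.sum_le_sum fun j₀ _ => ?_
  rw [add_mul]
  refine add_le_add ?_ ?_
  · refine (hV (m + 2) hq2 hqp).trans ?_
    refine (mul_le_mul_of_nonneg_right (le_abs_self D) (by positivity)).trans ?_
    refine mul_le_mul_of_nonneg_left ?_ (abs_nonneg D)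
    refine mul_le_mul_of_nonneg_left ?_ (by positivity)
    -- `(q + 1) / 2` is `⌈q/2⌉`, which is at most `q - 1` once `q ≥ 2`.
    exact pow_le_pow_of_le_one hB hB1 (by omega)
  · have hc1 : Fintype.card {j : Fin (m + 2) // j ≤ j₀.castSucc} = j₀ + 1 := by
      rw [Fintype.card_subtype]
      have : (Finset.univ.filter fun j : Fin (m + 2) => j ≤ j₀.castSucc) =
        Finset.Iic j₀.castSucc := by ext; simp
      rw [this, Fin.card_Iic]
      simp
    have hc2 : Fintype.card {j : Fin (m + 2) // ¬ j ≤ j₀.castSucc} = m + 1 - j₀ := by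
      rw [Fintype.card_subtype_compl, hc1, Fintype.card_fin]
      omega
    have hj := j₀.2
    have e1 := hK (j₀ + 1) (by omega) (by omega) Z N C B hC hB hB1 hZ hdec hV _ hc1
    have e2 := hK (m + 1 - j₀) (by omega) (by omega) Z N C B hC hB hB1 hZ hdec hV _ hc2
    refine (mul_le_mul e1 e2 (absMoment_nonneg _) ((absMoment_nonneg _).trans e1)).trans ?_
    -- Subadditivity of `⌈q/2⌉`: the two groups together gain at least the required power of `B`.
    have hexp : (m + 2 + 1) / 2 ≤ ((j₀ : ℕ) + 1 + 1) / 2 + (m + 1 - j₀ + 1) / 2 := by omega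
    have hN : (N : ℝ) ^ ((j₀ : ℕ) + 1) * (N : ℝ) ^ (m + 1 - (j₀ : ℕ)) = (N : ℝ) ^ (m + 2) := by
      rw [← pow_add]
      congr 1
      omega
    calc _ = K (j₀ + 1) * K (m + 1 - j₀) * ((N : ℝ) ^ ((j₀ : ℕ) + 1) * (N : ℝ) ^ (m + 1 - (j₀ : ℕ))
          * B ^ (((j₀ : ℕ) + 1 + 1) / 2 + (m + 1 - j₀ + 1) / 2)) := by
          rw [pow_add B]; ring
      _ ≤ _ := by
          rw [hN]
          refine mul_le_mul_of_nonneg_left ?_ (hKnn j₀)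
          refine mul_le_mul_of_nonneg_left ?_ (by positivity)
          exact pow_le_pow_of_le_one hB hB1 hexp

lemma abs_integral_sum_pow_le_absMoment [IsFiniteMeasure μ] (p : ℕ)
    (hint : ∀ i : Fin p → Fin N, Integrable (fun ω => ∏ j, Z (i j) ω) μ) :
    |∫ ω, (∑ i ∈ Finset.range N, Z i ω) ^ p ∂μ| ≤ absMoment μ Z N (Fin p) := by
  have h : ∀ ω, (∑ i ∈ Finset.range N, Z i ω) ^ p = ∑ i : Fin p → Fin N, ∏ j, Z (i j) ω := by
    intro ω
    rw [← Fin.sum_univ_eq_sum_range (fun i => Z i ω), Fintype.sum_pow]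
  simp only [h]
  rw [integral_finsetSum _ fun i _ => hint i]
  exact Finset.abs_sum_le_sum_abs _ _

end MomentInequality

/-! ### Smoothed indicators of block maxima as Lipschitz functionals. -/

section BlockFunctionals

lemma ramp_nonneg (x : ℝ) : 0 ≤ ramp x := le_max_left _ _

lemma ramp_le_one (x : ℝ) : ramp x ≤ 1 := max_le zero_le_one (min_le_left _ _)

lemma ramp_antitone : Antitone ramp := fun x y h => by
  unfold ramp
  gcongr

lemma ramp_of_nonpos {x : ℝ} (hx : x ≤ 0) : ramp x = 1 := by
  rw [ramp, min_eq_left (by linarith), max_eq_right zero_le_one]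

lemma ramp_of_one_le {x : ℝ} (hx : 1 ≤ x) : ramp x = 0 := by
  rw [ramp, min_eq_right (by linarith), max_eq_left (by linarith)]

lemma continuous_ramp : Continuous ramp := by
  unfold ramp
  fun_prop

lemma abs_ramp_sub_le (x y : ℝ) : |ramp x - ramp y| ≤ |x - y| := by
  unfold ramp
  refine (abs_max_sub_max_le_max _ _ _ _).trans ?_
  rw [sub_self, abs_zero, max_eq_right (abs_nonneg _)]
  refine (abs_min_sub_min_le_max _ _ _ _).trans ?_
  rw [sub_self, abs_zero, max_eq_right (abs_nonneg _), sub_sub_sub_cancel_left, abs_sub_comm]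

/-- The maximum of `x_{s+1}, …, x_{s+m}`. -/
def pathMax (x : ℤ → ℝ) (s : ℤ) (m : ℕ) : ℝ := ⨆ k : Fin m, x (s + 1 + (k : ℕ))

lemma pathMax_le_iff {x : ℤ → ℝ} {s : ℤ} {m : ℕ} (hm : 0 < m) {w : ℝ} :
    pathMax x s m ≤ w ↔ ∀ t, s < t → t ≤ s + m → x t ≤ w := by
  have : Nonempty (Fin m) := ⟨⟨0, hm⟩⟩
  rw [pathMax, ciSup_le_iff (Set.finite_range _).bddAbove]
  constructor
  · intro h t h1 h2
    have := h ⟨(t - s - 1).toNat, by omega⟩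
    have e : s + 1 + (((t - s - 1).toNat : ℕ) : ℤ) = t := by omega
    rwa [e] at this
  · intro h k
    exact h _ (by omega) (by have := k.2; omega)

lemma pathMax_sub_le {x y : ℤ → ℝ} {s : ℤ} {m : ℕ} :
    pathMax x s m - pathMax y s m ≤ ∑ t ∈ Finset.Ioc s (s + m), |x t - y t| := by
  rcases Nat.eq_zero_or_pos m with rfl | hm
  · simp [pathMax]
  · rw [sub_le_iff_le_add, pathMax_le_iff hm]
    intro t h1 h2
    have h3 : |x t - y t| ≤ ∑ t ∈ Finset.Ioc s (s + m), |x t - y t| :=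
      Finset.single_le_sum (f := fun t => |x t - y t|) (fun _ _ => abs_nonneg _)
        (Finset.mem_Ioc.2 ⟨h1, h2⟩)
    have h4 := (pathMax_le_iff (x := y) hm).1 le_rfl t h1 h2
    linarith [le_abs_self (x t - y t)]

lemma abs_pathMax_sub_le (x y : ℤ → ℝ) (s : ℤ) (m : ℕ) :
    |pathMax x s m - pathMax y s m| ≤ ∑ t ∈ Finset.Ioc s (s + m), |x t - y t| := by
  refine abs_sub_le_iff.2 ⟨pathMax_sub_le, ?_⟩
  simp only [abs_sub_comm (x _)]
  exact pathMax_sub_le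

lemma abs_ramp_pathMax_sub_le (x y : ℤ → ℝ) (s : ℤ) (m : ℕ) (w : ℝ) {e : ℝ} (he : 0 < e) :
    |ramp ((pathMax x s m - w) / e) - ramp ((pathMax y s m - w) / e)| ≤
      1 / e * ∑ t ∈ Finset.Ioc s (s + m), |x t - y t| := by
  refine (abs_ramp_sub_le _ _).trans ?_
  rw [← sub_div, sub_sub_sub_cancel_right, abs_div, abs_of_pos he, div_eq_inv_mul, one_div]
  exact mul_le_mul_of_nonneg_left (abs_pathMax_sub_le x y s m) (by positivity)

lemma abs_prod_le_one {ι : Type*} {s : Finset ι} {f : ι → ℝ} (hf : ∀ i, |f i| ≤ 1) :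
    |∏ i ∈ s, f i| ≤ 1 := by
  rw [Finset.abs_prod]
  exact Finset.prod_le_one (fun _ _ => abs_nonneg _) fun i _ => hf i

/-- The factors are exchanged one at a time, all the others being bounded by one. -/
lemma abs_prod_sub_prod_le {ι : Type*} (s : Finset ι) {f g : ι → ℝ}
    (hf : ∀ i, |f i| ≤ 1) (hg : ∀ i, |g i| ≤ 1) :
    |∏ i ∈ s, f i - ∏ i ∈ s, g i| ≤ ∑ i ∈ s, |f i - g i| := by
  classical
  induction s using Finset.induction_on with
  | empty => simp
  | insert a s ha ih =>
    rw [Finset.prod_insert ha, Finset.prod_insert ha, Finset.sum_insert ha]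
    have e : f a * ∏ i ∈ s, f i - g a * ∏ i ∈ s, g i =
        (f a - g a) * ∏ i ∈ s, f i + g a * (∏ i ∈ s, f i - ∏ i ∈ s, g i) := by ring
    rw [e]
    refine (abs_add_le _ _).trans (add_le_add ?_ ?_)
    · rw [abs_mul]
      exact mul_le_of_le_one_right (abs_nonneg _) (abs_prod_le_one hf)
    · rw [abs_mul]
      exact (mul_le_of_le_one_left (abs_nonneg _) (hg a)).trans ih

lemma blockMax_le_iff {Ω : Type*} {X : ℤ → Ω → ℝ} {s : ℤ} {m : ℕ} (hm : 0 < m) {w : ℝ} {ω : Ω} :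
    blockMax X s m ω ≤ w ↔ ∀ t, s < t → t ≤ s + m → X t ω ≤ w :=
  pathMax_le_iff (x := fun t => X t ω) hm

variable {Ω : Type*} [MeasurableSpace Ω] {μ : Measure Ω} {X : ℤ → Ω → ℝ}

lemma measurable_blockMax (hX : ∀ t, Measurable (X t)) (s : ℤ) (m : ℕ) :
    Measurable (blockMax X s m) := by
  unfold blockMax
  exact Measurable.iSup fun k => hX _

lemma measurable_rampBlock (hX : ∀ t, Measurable (X t)) (s : ℤ) (m : ℕ) (w e : ℝ) :
    Measurable fun ω => ramp ((blockMax X s m ω - w) / e) :=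
  continuous_ramp.measurable.comp (((measurable_blockMax hX s m).sub_const w).div_const e)

lemma integrable_of_abs_le [IsFiniteMeasure μ] {f : Ω → ℝ} {c : ℝ} (hf : Measurable f)
    (h : ∀ ω, |f ω| ≤ c) : Integrable f μ :=
  Integrable.of_bound hf.aestronglyMeasurable c (ae_of_all _ h)

lemma abs_integral_le_of_abs_le [IsProbabilityMeasure μ] {f : Ω → ℝ} {c : ℝ}
    (h : ∀ ω, |f ω| ≤ c) : |∫ ω, f ω ∂μ| ≤ c := by
  have := norm_integral_le_of_norm_le_const (μ := μ) (f := f) (C := c) (ae_of_all _ h)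
  simpa using this

lemma covariance_eq_integral_sub [IsProbabilityMeasure μ] {f g : Ω → ℝ} (hf : Measurable f)
    (hg : Measurable g) (hf1 : ∀ ω, |f ω| ≤ 1) (hg1 : ∀ ω, |g ω| ≤ 1) :
    cov[f, g; μ] = ∫ ω, f ω * g ω ∂μ - (∫ ω, f ω ∂μ) * ∫ ω, g ω ∂μ := by
  rw [covariance_eq_sub]
  · rfl
  · exact MemLp.of_bound hf.aestronglyMeasurable 1 (ae_of_all _ hf1)
  · exact MemLp.of_bound hg.aestronglyMeasurable 1 (ae_of_all _ hg1)

lemma abs_integral_mul_sub_le_two [IsProbabilityMeasure μ] {f g : Ω → ℝ}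
    (hf1 : ∀ ω, |f ω| ≤ 1) (hg1 : ∀ ω, |g ω| ≤ 1) :
    |∫ ω, f ω * g ω ∂μ - (∫ ω, f ω ∂μ) * ∫ ω, g ω ∂μ| ≤ 2 := by
  have h1 : |∫ ω, f ω * g ω ∂μ| ≤ 1 := abs_integral_le_of_abs_le fun ω => by
    rw [abs_mul]
    exact mul_le_one₀ (hf1 ω) (abs_nonneg _) (hg1 ω)
  have h2 : |(∫ ω, f ω ∂μ) * ∫ ω, g ω ∂μ| ≤ 1 := by
    rw [abs_mul]
    exact mul_le_one₀ (abs_integral_le_of_abs_le hf1) (abs_nonneg _) (abs_integral_le_of_abs_le hg1)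
  exact (abs_sub _ _).trans (by linarith)

/-- The product of centered smoothed block indicators, as a functional of the path. -/
def blockProd {ι : Type} [Fintype ι] (s : ι → ℤ) (m : ℕ) (w e : ℝ) (c : ι → ℝ) (x : ℤ → ℝ) : ℝ :=
  ∏ a, (ramp ((pathMax x (s a) m - w) / e) - c a)

lemma abs_ramp_sub_le_one (x : ℝ) {c : ℝ} (hc : c ∈ Set.Icc (0 : ℝ) 1) : |ramp x - c| ≤ 1 := by
  rw [abs_le]
  constructor <;> linarith [ramp_nonneg x, ramp_le_one x, hc.1, hc.2]

lemma abs_blockProd_sub_le {ι : Type} [Fintype ι] (s : ι → ℤ) (m : ℕ) (w : ℝ) {e : ℝ}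
    (he : 0 < e) {c : ι → ℝ} (hc : ∀ a, c a ∈ Set.Icc (0 : ℝ) 1) (x y : ℤ → ℝ) :
    |blockProd s m w e c x - blockProd s m w e c y| ≤ Fintype.card ι * (1 / e) *
      ∑ t ∈ Finset.univ.biUnion (fun a => Finset.Ioc (s a) (s a + m)), |x t - y t| := by
  refine (abs_prod_sub_prod_le _ (fun a => abs_ramp_sub_le_one _ (hc a))
    (fun a => abs_ramp_sub_le_one _ (hc a))).trans ?_
  have : ∀ a ∈ (Finset.univ : Finset ι), |ramp ((pathMax x (s a) m - w) / e) - c a -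
      (ramp ((pathMax y (s a) m - w) / e) - c a)| ≤ 1 / e *
      ∑ t ∈ Finset.univ.biUnion (fun a => Finset.Ioc (s a) (s a + m)), |x t - y t| := by
    intro a _
    rw [sub_sub_sub_cancel_right]
    refine (abs_ramp_pathMax_sub_le x y (s a) m w he).trans ?_
    refine mul_le_mul_of_nonneg_left ?_ (by positivity)
    exact Finset.sum_le_sum_of_subset_of_nonneg
      (Finset.subset_biUnion_of_mem (fun a => Finset.Ioc (s a) (s a + (m : ℤ))) (Finset.mem_univ a))
      fun _ _ _ => abs_nonneg _
  refine (Finset.sum_le_sum this).trans (le_of_eq ?_)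
  rw [Finset.sum_const, Finset.card_univ, nsmul_eq_mul, mul_assoc]

/-- A product of `k ≤ p` ramps has Lipschitz constant `k / e` and depends on at most `k m` indices.
Each linear term of the weight is thus at most `p ^ 2 * (m / e)` and the product term at most `p ^ 4
* (m / e) ^ 2`. In `hs`, the last index of a block is `s₁ a + m` and the first one is `s₂ b + 1`. -/
lemma abs_integral_blockProd_le [IsProbabilityMeasure μ] (hX : ∀ t, Measurable (X t)) {κ c : ℝ}
    {r m p : ℕ} (hcov : CovBound X μ κ r c) (hκ : 0 ≤ κ) (hc : 0 ≤ c) (hm : 0 < m)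
    {e : ℝ} (he : 0 < e) (w : ℝ) {ι₁ ι₂ : Type} [Fintype ι₁] [Fintype ι₂] [Nonempty ι₁]
    [Nonempty ι₂] {s₁ : ι₁ → ℤ} {s₂ : ι₂ → ℤ} {c₁ : ι₁ → ℝ} {c₂ : ι₂ → ℝ}
    (hc₁ : ∀ a, c₁ a ∈ Set.Icc (0 : ℝ) 1) (hc₂ : ∀ a, c₂ a ∈ Set.Icc (0 : ℝ) 1)
    (hcard : Fintype.card ι₁ + Fintype.card ι₂ ≤ p)
    (hs : ∀ a b, s₁ a + m + r ≤ s₂ b + 1) :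
    |∫ ω, (∏ a, (ramp ((blockMax X (s₁ a) m ω - w) / e) - c₁ a)) *
        ∏ a, (ramp ((blockMax X (s₂ a) m ω - w) / e) - c₂ a) ∂μ -
      (∫ ω, ∏ a, (ramp ((blockMax X (s₁ a) m ω - w) / e) - c₁ a) ∂μ) *
        ∫ ω, ∏ a, (ramp ((blockMax X (s₂ a) m ω - w) / e) - c₂ a) ∂μ| ≤
      2 * p ^ 4 * (m / e + κ * (m / e) ^ 2) * c := by
  have hmeas : ∀ {ι : Type} [Fintype ι] (s : ι → ℤ) (c : ι → ℝ),
      Measurable fun ω => ∏ a, (ramp ((blockMax X (s a) m ω - w) / e) - c a) := fun s c =>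
    Finset.measurable_fun_prod _ fun a _ => (measurable_rampBlock hX (s a) m w e).sub_const _
  rw [← covariance_eq_integral_sub (hmeas s₁ c₁) (hmeas s₂ c₂)
    (fun ω => abs_prod_le_one fun a => abs_ramp_sub_le_one _ (hc₁ a))
    (fun ω => abs_prod_le_one fun a => abs_ramp_sub_le_one _ (hc₂ a))]
  have hcardU : ∀ {ι : Type} [Fintype ι] (s : ι → ℤ),
      (Finset.univ.biUnion fun a => Finset.Ioc (s a) (s a + (m : ℤ))).card ≤
        Fintype.card ι * m := by
    intro ι _ s
    refine Finset.card_biUnion_le.trans ?_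
    simp
  have hne : ∀ {ι : Type} [Fintype ι] [Nonempty ι] (s : ι → ℤ),
      (Finset.univ.biUnion fun a => Finset.Ioc (s a) (s a + (m : ℤ))).Nonempty := by
    intro ι _ _ s
    obtain ⟨a⟩ := ‹Nonempty ι›
    exact ⟨s a + 1, Finset.mem_biUnion.2 ⟨a, Finset.mem_univ _, Finset.mem_Ioc.2 (by omega)⟩⟩
  have key := hcov _ _ (blockProd s₁ m w e c₁) (blockProd s₂ m w e c₂) _ _ (hne s₁) (hne s₂)
    (by
      intro a ha b hb
      obtain ⟨i, -, hi⟩ := Finset.mem_biUnion.1 ha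
      obtain ⟨j, -, hj⟩ := Finset.mem_biUnion.1 hb
      rw [Finset.mem_Ioc] at hi hj
      have := hs i j
      omega)
    (by positivity) (by positivity)
    (fun x => abs_prod_le_one fun a => abs_ramp_sub_le_one _ (hc₁ a))
    (fun x => abs_prod_le_one fun a => abs_ramp_sub_le_one _ (hc₂ a))
    (abs_blockProd_sub_le s₁ m w he hc₁) (abs_blockProd_sub_le s₂ m w he hc₂)
  refine key.trans ?_
  set k₁ := Fintype.card ι₁
  set k₂ := Fintype.card ι₂
  have hp1 : (1 : ℝ) ≤ p := by
    have : 0 < k₁ := Fintype.card_pos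
    exact_mod_cast (by omega : 1 ≤ p)
  have hk₁ : (k₁ : ℝ) ≤ p := by exact_mod_cast (by omega : k₁ ≤ p)
  have hk₂ : (k₂ : ℝ) ≤ p := by exact_mod_cast (by omega : k₂ ≤ p)
  have hU₁ : ((Finset.univ.biUnion fun a => Finset.Ioc (s₁ a) (s₁ a + (m : ℤ))).card : ℝ) ≤
      k₁ * m := by exact_mod_cast hcardU s₁
  have hU₂ : ((Finset.univ.biUnion fun a => Finset.Ioc (s₂ a) (s₂ a + (m : ℤ))).card : ℝ) ≤
      k₂ * m := by exact_mod_cast hcardU s₂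
  set U₁ := (Finset.univ.biUnion fun a => Finset.Ioc (s₁ a) (s₁ a + (m : ℤ))).card
  set U₂ := (Finset.univ.biUnion fun a => Finset.Ioc (s₂ a) (s₂ a + (m : ℤ))).card
  have b₁ : (U₁ : ℝ) * (k₁ * (1 / e)) ≤ p ^ 2 * (m / e) := by
    calc (U₁ : ℝ) * (k₁ * (1 / e)) ≤ (p * m) * (p * (1 / e)) := by
          gcongr; exact hU₁.trans (by gcongr)
      _ = _ := by ring
  have b₂ : (U₂ : ℝ) * (k₂ * (1 / e)) ≤ p ^ 2 * (m / e) := by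
    calc (U₂ : ℝ) * (k₂ * (1 / e)) ≤ (p * m) * (p * (1 / e)) := by
          gcongr; exact hU₂.trans (by gcongr)
      _ = _ := by ring
  have b₃ : (U₁ : ℝ) * U₂ * (k₁ * (1 / e)) * (k₂ * (1 / e)) ≤ p ^ 4 * (m / e) ^ 2 := by
    calc (U₁ : ℝ) * U₂ * (k₁ * (1 / e)) * (k₂ * (1 / e))
        = (U₁ * (k₁ * (1 / e))) * (U₂ * (k₂ * (1 / e))) := by ring
      _ ≤ (p ^ 2 * (m / e)) * (p ^ 2 * (m / e)) := by gcongr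
      _ = _ := by ring
  have b₄ : (p : ℝ) ^ 2 * (m / e) ≤ p ^ 4 * (m / e) := by
    gcongr ?_ * _
    exact pow_le_pow_right₀ hp1 (by norm_num)
  have b₅ : 0 ≤ κ * (p ^ 4 * ((m : ℝ) / e) ^ 2) := by positivity
  rw [mul_comm _ c]
  refine mul_le_mul_of_nonneg_left ?_ hc
  have := mul_le_mul_of_nonneg_left b₃ hκ
  nlinarith

end BlockFunctionals

/-! ### Correlation bounds for the two subsampling schemes and their weighted sums. -/

section SubsamplerMoments

/-- Correlation bound between blocks at distance `r` in the overlapping scheme. -/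
def overlapBound (b : ℕ) (W : ℝ) (c : ℕ → ℝ) (r : ℕ) : ℝ :=
  if r < b then 2 else W * c (r - b)

/-- Correlation bound between blocks at distance `r` in the non-overlapping scheme. -/
def disjointBound (b : ℕ) (W : ℝ) (c : ℕ → ℝ) (r : ℕ) : ℝ :=
  if r < 3 then 2 else W * ((∑ t ∈ Finset.Ico ((r - 2) * b) ((r - 1) * b), c t) / b)

lemma overlapBound_nonneg {b : ℕ} {W : ℝ} {c : ℕ → ℝ} (hW : 0 ≤ W) (hc : ∀ t, 0 ≤ c t) (r : ℕ) :
    0 ≤ overlapBound b W c r := by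
  unfold overlapBound
  split_ifs
  · norm_num
  · exact mul_nonneg hW (hc _)

lemma disjointBound_nonneg {b : ℕ} {W : ℝ} {c : ℕ → ℝ} (hW : 0 ≤ W) (hc : ∀ t, 0 ≤ c t) (r : ℕ) :
    0 ≤ disjointBound b W c r := by
  unfold disjointBound
  split_ifs
  · norm_num
  · exact mul_nonneg hW (div_nonneg (Finset.sum_nonneg fun t _ => hc t) (Nat.cast_nonneg _))

/-- The `b` lags with overlapping blocks contribute at most `2 * b * b ^ (q - 2)`, and `b ≤ D`. For
the others, with `t = r - b`, the inequality `r + 1 ≤ 2 * D * (t + 1)` extracts `D ^ (q - 2)` and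
leaves the summable weight; the last factor `D` comes from the covariance bound. -/
lemma sum_overlapBound_le {b p q N : ℕ} {D E T : ℝ} {c : ℕ → ℝ} (hc : ∀ t, 0 ≤ c t)
    (hE : 0 ≤ E) (hb : 1 ≤ b) (hbD : (b : ℝ) ≤ D) (hq : 2 ≤ q) (hqp : q ≤ p)
    (hsum : ∑ t ∈ Finset.range N, ((t : ℝ) + 1) ^ (p - 2) * c t ≤ T) :
    ∑ r ∈ Finset.range N, overlapBound b (E * D) c r * ((r : ℝ) + 1) ^ (q - 2) ≤
      (2 + 2 ^ p * E * T) * D ^ (q - 1) := by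
  have hb0 : (1 : ℝ) ≤ b := by exact_mod_cast hb
  have hD1 : 1 ≤ D := hb0.trans hbD
  have hT : 0 ≤ T := le_trans (Finset.sum_nonneg fun t _ => mul_nonneg (by positivity) (hc t)) hsum
  have h1 : ∀ r ∈ Finset.range N, overlapBound b (E * D) c r * ((r : ℝ) + 1) ^ (q - 2) ≤
      (if r < b then 2 * D ^ (q - 2) else 0) +
      (if b ≤ r then 2 ^ p * E * D ^ (q - 1) *
        (((r - b : ℕ) : ℝ) + 1) ^ (p - 2) * c (r - b) else 0) := by
    intro r _
    unfold overlapBound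
    by_cases hr : r < b
    · rw [if_pos hr, if_pos hr, if_neg (not_le.2 hr), add_zero]
      gcongr
      have : (r : ℝ) + 1 ≤ b := by exact_mod_cast hr
      linarith
    · rw [if_neg hr, if_neg hr, if_pos (not_lt.1 hr), zero_add]
      obtain ⟨t, rfl⟩ : ∃ t, r = t + b := ⟨r - b, by omega⟩
      rw [Nat.add_sub_cancel]
      push_cast
      have e1 : (t : ℝ) + b + 1 ≤ 2 * D * (t + 1) := by
        have : (0 : ℝ) ≤ t := Nat.cast_nonneg t
        nlinarith
      have e2 : ((t : ℝ) + b + 1) ^ (q - 2) ≤ 2 ^ p * D ^ (q - 2) * ((t : ℝ) + 1) ^ (p - 2) := by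
        calc ((t : ℝ) + b + 1) ^ (q - 2) ≤ (2 * D * (t + 1)) ^ (q - 2) := by gcongr
          _ = 2 ^ (q - 2) * D ^ (q - 2) * ((t : ℝ) + 1) ^ (q - 2) := by rw [mul_pow, mul_pow]
          _ ≤ 2 ^ p * D ^ (q - 2) * ((t : ℝ) + 1) ^ (p - 2) := by
              gcongr
              · norm_num
              · omega
              · linarith [(Nat.cast_nonneg t : (0 : ℝ) ≤ t)]
      calc E * D * c t * ((t : ℝ) + b + 1) ^ (q - 2)
          ≤ E * D * c t * (2 ^ p * D ^ (q - 2) * ((t : ℝ) + 1) ^ (p - 2)) := by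
            have := hc t
            gcongr
        _ = 2 ^ p * E * (D ^ (q - 2) * D) * ((t : ℝ) + 1) ^ (p - 2) * c t := by ring
        _ = _ := by rw [← pow_succ, show q - 2 + 1 = q - 1 by omega]
  refine (Finset.sum_le_sum h1).trans ?_
  rw [Finset.sum_add_distrib, add_mul]
  refine add_le_add ?_ ?_
  · rw [← Finset.sum_filter, Finset.sum_const, nsmul_eq_mul]
    have hcard : (((Finset.range N).filter fun r => r < b).card : ℝ) ≤ D := by
      refine le_trans ?_ hbD
      have : ((Finset.range N).filter fun r => r < b).card ≤ (Finset.range b).card :=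
        Finset.card_le_card fun r hr => by simp at hr ⊢; exact hr.2
      rw [Finset.card_range] at this
      exact_mod_cast this
    calc _ ≤ D * (2 * D ^ (q - 2)) := by gcongr
      _ = 2 * (D ^ (q - 2) * D) := by ring
      _ = _ := by rw [← pow_succ, show q - 2 + 1 = q - 1 by omega]
  · rw [← Finset.sum_filter]
    have hinj : ∑ r ∈ (Finset.range N).filter (fun r => b ≤ r), 2 ^ p * E * D ^ (q - 1) *
        (((r - b : ℕ) : ℝ) + 1) ^ (p - 2) * c (r - b) ≤
        ∑ t ∈ Finset.range N, 2 ^ p * E * D ^ (q - 1) * ((t : ℝ) + 1) ^ (p - 2) * c t := by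
      rw [← Finset.sum_image (s := (Finset.range N).filter (fun r => b ≤ r)) (g := fun r => r - b)
        (f := fun t : ℕ => 2 ^ p * E * D ^ (q - 1) * ((t : ℝ) + 1) ^ (p - 2) * c t)]
      · refine Finset.sum_le_sum_of_subset_of_nonneg ?_ fun t _ _ => by
          have := hc t
          positivity
        intro t ht
        simp only [Finset.mem_image, Finset.mem_filter, Finset.mem_range] at ht ⊢
        omega
      · intro r hr r' hr' h
        simp only [Finset.coe_filter, Finset.mem_range, Set.mem_ofPred_eq] at hr hr' h
        omega
    refine hinj.trans ?_
    simp only [mul_assoc]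
    rw [← Finset.mul_sum, ← Finset.mul_sum, ← Finset.mul_sum]
    calc _ ≤ 2 ^ p * (E * (D ^ (q - 1) * T)) := by gcongr
      _ = _ := by ring

/-- The windows belonging to different `r` are disjoint and lie in `[0, N * b)`. -/
lemma sum_Ico_blocks_le {b N n : ℕ} {f : ℕ → ℝ} (hf : ∀ t, 0 ≤ f t) (hNb : N * b ≤ n) :
    ∑ r ∈ (Finset.range N).filter (fun r => 3 ≤ r),
      ∑ t ∈ Finset.Ico ((r - 2) * b) ((r - 1) * b), f t ≤ ∑ t ∈ Finset.range n, f t := by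
  classical
  rw [← Finset.sum_biUnion]
  · refine Finset.sum_le_sum_of_subset_of_nonneg ?_ fun t _ _ => hf t
    intro t ht
    simp only [Finset.mem_biUnion, Finset.mem_filter, Finset.mem_range, Finset.mem_Ico] at ht ⊢
    obtain ⟨r, ⟨hr, -⟩, -, h⟩ := ht
    have : (r - 1) * b ≤ N * b := Nat.mul_le_mul_right b (by omega)
    omega
  · intro r hr r' hr' hne
    simp only [Finset.coe_filter, Finset.mem_range, Set.mem_ofPred_eq] at hr hr'
    rw [Function.onFun, Finset.disjoint_left]
    intro t ht ht'
    rw [Finset.mem_Ico] at ht ht'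
    rcases lt_or_gt_of_ne hne with h | h
    · have : (r - 1) * b ≤ (r' - 2) * b := Nat.mul_le_mul_right b (by omega)
      omega
    · have : (r' - 1) * b ≤ (r - 2) * b := Nat.mul_le_mul_right b (by omega)
      omega

/-- The three trivial lags give at most `6 * 3 ^ p`, and `1 ≤ D / b`. For `r ≥ 3`, every `t` in the
window of `r` satisfies `r + 1 ≤ 4 / b * (t + 1)`. The resulting factor `b ^ (-(p - 2))` cancels the
growth allowed by `hsum`, and the averaging in `disjointBound` provides the remaining `1 / b`. -/
lemma sum_disjointBound_le {b p q N n : ℕ} {D E T : ℝ} {c : ℕ → ℝ} (hc : ∀ t, 0 ≤ c t)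
    (hE : 0 ≤ E) (hT : 0 ≤ T) (hb : 1 ≤ b) (hbD : (b : ℝ) ≤ D) (hqp : q ≤ p)
    (hNb : N * b ≤ n)
    (hsum : ∑ t ∈ Finset.range n, ((t : ℝ) + 1) ^ (p - 2) * c t ≤ T * b ^ (p - 2)) :
    ∑ r ∈ Finset.range N, disjointBound b (E * D) c r * ((r : ℝ) + 1) ^ (q - 2) ≤
      (6 * 3 ^ p + 4 ^ p * E * T) * (D / b) := by
  have hb0 : (1 : ℝ) ≤ b := by exact_mod_cast hb
  have hD1 : 1 ≤ D := hb0.trans hbD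
  have hDb : 1 ≤ D / b := by rwa [le_div_iff₀ (by linarith), one_mul]
  have h1 : ∀ r ∈ Finset.range N, disjointBound b (E * D) c r * ((r : ℝ) + 1) ^ (q - 2) ≤
      (if r < 3 then 2 * 3 ^ p else 0) +
      (if 3 ≤ r then E * (D / b) * (4 / b) ^ (p - 2) *
        ∑ t ∈ Finset.Ico ((r - 2) * b) ((r - 1) * b), ((t : ℝ) + 1) ^ (p - 2) * c t else 0) := by
    intro r _
    unfold disjointBound
    by_cases hr : r < 3
    · rw [if_pos hr, if_pos hr, if_neg (not_le.2 hr), add_zero]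
      have h3 : (r : ℝ) + 1 ≤ 3 := by exact_mod_cast hr
      calc (2 : ℝ) * ((r : ℝ) + 1) ^ (q - 2) ≤ 2 * 3 ^ (q - 2) := by gcongr
        _ ≤ 2 * 3 ^ p := by
          gcongr
          · norm_num
          · omega
    · rw [if_neg hr, if_neg hr, if_pos (not_lt.1 hr), zero_add]
      have hterm : ∀ t ∈ Finset.Ico ((r - 2) * b) ((r - 1) * b), c t * ((r : ℝ) + 1) ^ (q - 2) ≤
          (4 / b) ^ (p - 2) * (((t : ℝ) + 1) ^ (p - 2) * c t) := by
        intro t ht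
        rw [Finset.mem_Ico] at ht
        -- `r + 1 ≤ 4 * (r - 2)` needs `r ≥ 3`; this fixes the threshold in `disjointBound`.
        have e0 : (r + 1) * b ≤ 4 * (t + 1) := by
          have h2 : (r + 1) * b ≤ 4 * (r - 2) * b := Nat.mul_le_mul_right b (by omega)
          have : 4 * (r - 2) * b = 4 * ((r - 2) * b) := by ring
          omega
        have e1 : (r : ℝ) + 1 ≤ 4 / b * (t + 1) := by
          rw [div_mul_eq_mul_div, le_div_iff₀ (by linarith)]
          exact_mod_cast e0
        calc c t * ((r : ℝ) + 1) ^ (q - 2) ≤ c t * ((r : ℝ) + 1) ^ (p - 2) := by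
              have := hc t
              gcongr
              linarith [(Nat.cast_nonneg r : (0 : ℝ) ≤ r)]
          _ ≤ c t * (4 / b * (t + 1)) ^ (p - 2) := by
              have := hc t
              gcongr
          _ = _ := by rw [mul_pow]; ring
      calc E * D * ((∑ t ∈ Finset.Ico ((r - 2) * b) ((r - 1) * b), c t) / b) *
            ((r : ℝ) + 1) ^ (q - 2)
          = E * (D / b) * ∑ t ∈ Finset.Ico ((r - 2) * b) ((r - 1) * b),
            c t * ((r : ℝ) + 1) ^ (q - 2) := by rw [← Finset.sum_mul]; ring
        _ ≤ E * (D / b) * ∑ t ∈ Finset.Ico ((r - 2) * b) ((r - 1) * b),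
            (4 / b) ^ (p - 2) * (((t : ℝ) + 1) ^ (p - 2) * c t) := by
            exact mul_le_mul_of_nonneg_left (Finset.sum_le_sum hterm) (by positivity)
        _ = _ := by rw [← Finset.mul_sum]; ring
  refine (Finset.sum_le_sum h1).trans ?_
  rw [Finset.sum_add_distrib, add_mul]
  refine add_le_add ?_ ?_
  · rw [← Finset.sum_filter, Finset.sum_const, nsmul_eq_mul]
    have hcard : (((Finset.range N).filter fun r => r < 3).card : ℝ) ≤ 3 := by
      have : ((Finset.range N).filter fun r => r < 3).card ≤ (Finset.range 3).card :=
        Finset.card_le_card fun r hr => by simp at hr ⊢; exact hr.2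
      rw [Finset.card_range] at this
      exact_mod_cast this
    calc _ ≤ 3 * (2 * (3 : ℝ) ^ p) := by gcongr
      _ = 6 * 3 ^ p * 1 := by ring
      _ ≤ _ := by gcongr
  · rw [← Finset.sum_filter, ← Finset.mul_sum]
    calc _ ≤ E * (D / b) * (4 / b) ^ (p - 2) *
          ∑ t ∈ Finset.range n, ((t : ℝ) + 1) ^ (p - 2) * c t := by
          gcongr
          exact sum_Ico_blocks_le (fun t => mul_nonneg (by positivity) (hc t)) hNb
      _ ≤ E * (D / b) * (4 / b) ^ (p - 2) * (T * b ^ (p - 2)) := by gcongr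
      _ = 4 ^ (p - 2) * E * T * (D / b) := by
          rw [div_pow]
          field_simp
      _ ≤ _ := by
          gcongr
          · norm_num
          · omega

variable {Ω : Type*} [MeasurableSpace Ω] {μ : Measure Ω} {X : ℤ → Ω → ℝ}

/-- The smoothed indicator of the `i`-th block of a scheme, centered at its mean. -/
def centeredBlock (S : Scheme) (X : ℤ → Ω → ℝ) (μ : Measure Ω) (b : ℕ) (e w : ℝ) (i : ℕ) (ω : Ω) :
    ℝ :=
  ramp ((blockMax X (blockStart S b i) b ω - w) / e) -
    ∫ ω', ramp ((blockMax X (blockStart S b i) b ω' - w) / e) ∂μ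

lemma integral_ramp_mem [IsProbabilityMeasure μ] (f : Ω → ℝ) :
    ∫ ω, ramp (f ω) ∂μ ∈ Set.Icc (0 : ℝ) 1 := by
  refine ⟨integral_nonneg fun ω => ramp_nonneg _, ?_⟩
  refine (le_abs_self _).trans (abs_integral_le_of_abs_le fun ω => ?_)
  rw [abs_of_nonneg (ramp_nonneg _)]
  exact ramp_le_one _

lemma abs_centeredBlock_le [IsProbabilityMeasure μ] (S : Scheme) (b : ℕ) (e w : ℝ) (i : ℕ) (ω : Ω) :
    |centeredBlock S X μ b e w i ω| ≤ 1 :=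
  abs_ramp_sub_le_one _ (integral_ramp_mem _)

lemma measurable_centeredBlock (hX : ∀ t, Measurable (X t)) (S : Scheme) (b : ℕ) (e w : ℝ)
    (i : ℕ) : Measurable (centeredBlock S X μ b e w i) :=
  (measurable_rampBlock hX _ _ _ _).sub_const _

lemma integral_centeredBlock [IsProbabilityMeasure μ] (hX : ∀ t, Measurable (X t)) (S : Scheme)
    (b : ℕ) (e w : ℝ) (i : ℕ) : ∫ ω, centeredBlock S X μ b e w i ω ∂μ = 0 := by
  unfold centeredBlock
  rw [integral_sub, integral_const, probReal_univ, one_smul, sub_self]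
  · exact integrable_of_abs_le (measurable_rampBlock hX _ _ _ _) (c := 1) fun ω => by
      rw [abs_of_nonneg (ramp_nonneg _)]
      exact ramp_le_one _
  · exact integrable_const _

lemma gapDecorrelation_overlapping [IsProbabilityMeasure μ] (hX : ∀ t, Measurable (X t)) {κ : ℝ}
    {c : ℕ → ℝ} (hcov : ∀ t, CovBound X μ κ t (c t)) (hκ : 0 ≤ κ) (hc : ∀ t, 0 ≤ c t) {b : ℕ}
    (hb : 0 < b) {e : ℝ} (he : 0 < e) (w : ℝ) (N p : ℕ) :
    GapDecorrelation μ (centeredBlock .overlapping X μ b e w) N p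
      (overlapBound b (2 * p ^ 4 * (b / e + κ * (b / e) ^ 2)) c) := by
  intro ι₁ ι₂ _ _ _ _ i₁ i₂ r hcard hr
  unfold overlapBound
  split_ifs with h
  · exact abs_integral_mul_sub_le_two
      (fun ω => abs_prod_le_one fun a => abs_centeredBlock_le _ _ _ _ _ _)
      (fun ω => abs_prod_le_one fun a => abs_centeredBlock_le _ _ _ _ _ _)
  · refine abs_integral_blockProd_le hX (hcov _) hκ (hc _) hb he w
      (fun a => integral_ramp_mem _) (fun a => integral_ramp_mem _) hcard fun a a' => ?_
    have := hr a a'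
    simp only [blockStart]
    omega

/-- Blocks whose numbers differ by at least `r` are more than `(r - 1) * b` time units apart, so the
covariance bound holds with `c t` for every `t` in the window `[(r - 2) b, (r - 1) b)`. Averaging
over the `b` elements of the window makes the sum over block lags comparable with the sum over all
time lags, without any monotonicity of `c`. -/
lemma gapDecorrelation_nonOverlapping [IsProbabilityMeasure μ] (hX : ∀ t, Measurable (X t)) {κ : ℝ}
    {c : ℕ → ℝ} (hcov : ∀ t, CovBound X μ κ t (c t)) (hκ : 0 ≤ κ) (hc : ∀ t, 0 ≤ c t) {b : ℕ}
    (hb : 0 < b) {e : ℝ} (he : 0 < e) (w : ℝ) (N p : ℕ) :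
    GapDecorrelation μ (centeredBlock .nonOverlapping X μ b e w) N p
      (disjointBound b (2 * p ^ 4 * (b / e + κ * (b / e) ^ 2)) c) := by
  intro ι₁ ι₂ _ _ _ _ i₁ i₂ r hcard hr
  unfold disjointBound
  split_ifs with h
  · exact abs_integral_mul_sub_le_two
      (fun ω => abs_prod_le_one fun a => abs_centeredBlock_le _ _ _ _ _ _)
      (fun ω => abs_prod_le_one fun a => abs_centeredBlock_le _ _ _ _ _ _)
  · have key : ∀ t ∈ Finset.Ico ((r - 2) * b) ((r - 1) * b),
        |∫ ω, (∏ a, centeredBlock .nonOverlapping X μ b e w (i₁ a) ω) *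
            ∏ a, centeredBlock .nonOverlapping X μ b e w (i₂ a) ω ∂μ
          - (∫ ω, ∏ a, centeredBlock .nonOverlapping X μ b e w (i₁ a) ω ∂μ) *
            ∫ ω, ∏ a, centeredBlock .nonOverlapping X μ b e w (i₂ a) ω ∂μ| ≤
          2 * p ^ 4 * (b / e + κ * (b / e) ^ 2) * c t := by
      intro t ht
      refine abs_integral_blockProd_le hX (hcov _) hκ (hc _) hb he w
        (fun a => integral_ramp_mem _) (fun a => integral_ramp_mem _) hcard fun a a' => ?_
      have h1 := hr a a'
      rw [Finset.mem_Ico] at ht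
      have h2 : ((i₁ a : ℕ) + 1 + (r - 1)) * b ≤ (i₂ a' : ℕ) * b :=
        Nat.mul_le_mul_right b (by omega)
      rw [add_mul, add_mul] at h2
      simp only [blockStart]
      have h3 : ((i₁ a : ℕ) : ℤ) * b + b + t ≤ ((i₂ a' : ℕ) : ℤ) * b := by
        exact_mod_cast (by omega : (i₁ a : ℕ) * b + b + t ≤ (i₂ a' : ℕ) * b)
      omega
    have hsum := Finset.sum_le_sum key
    have hcardI : (r - 1) * b - (r - 2) * b = b := by
      rw [← Nat.sub_mul, show r - 1 - (r - 2) = 1 by omega, one_mul]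
    rw [Finset.sum_const, Nat.card_Ico, hcardI, nsmul_eq_mul, ← Finset.mul_sum] at hsum
    rw [← mul_div_assoc, le_div_iff₀ (by exact_mod_cast hb), mul_comm]
    exact hsum

end SubsamplerMoments

/-! ### The moment bound for the smooth subsampler. -/

section SubsamplerMomentBound

lemma smoothSubsampler_nonneg {Ω : Type*} (S : Scheme) (X : ℤ → Ω → ℝ) (n b : ℕ) (e : ℝ) (ω : Ω) (x : ℝ) :
    0 ≤ smoothSubsampler S X n b e ω x :=
  mul_nonneg (by positivity) (Finset.sum_nonneg fun _ _ => ramp_nonneg _)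

lemma smoothSubsampler_le_one {Ω : Type*} (S : Scheme) (X : ℤ → Ω → ℝ) (n b : ℕ) (e : ℝ) (ω : Ω) (x : ℝ) :
    smoothSubsampler S X n b e ω x ≤ 1 := by
  unfold smoothSubsampler
  rw [one_div_mul_eq_div]
  refine div_le_one_of_le₀ ?_ (Nat.cast_nonneg _)
  refine (Finset.sum_le_card_nsmul _ _ 1 fun i _ => ramp_le_one _).trans ?_
  simp

lemma smoothSubsampler_monotone {Ω : Type*} (S : Scheme) (X : ℤ → Ω → ℝ) (n b : ℕ) {e : ℝ} (he : 0 < e)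
    (ω : Ω) : Monotone (smoothSubsampler S X n b e ω) := by
  intro x y hxy
  unfold smoothSubsampler
  refine mul_le_mul_of_nonneg_left (Finset.sum_le_sum fun i _ => ramp_antitone ?_) (by positivity)
  gcongr

variable {Ω : Type*} [MeasurableSpace Ω] {μ : Measure Ω} {X : ℤ → Ω → ℝ}

lemma measurable_smoothSubsampler (hX : ∀ t, Measurable (X t)) (S : Scheme) (n b : ℕ) (e x : ℝ) :
    Measurable fun ω => smoothSubsampler S X n b e ω x := by
  unfold smoothSubsampler
  exact (Finset.measurable_fun_sum _ fun i _ => measurable_rampBlock hX _ _ _ _).const_mul _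

lemma integrable_rampBlock [IsFiniteMeasure μ] (hX : ∀ t, Measurable (X t)) (s : ℤ) (m : ℕ)
    (w e : ℝ) : Integrable (fun ω => ramp ((blockMax X s m ω - w) / e)) μ :=
  integrable_of_abs_le (measurable_rampBlock hX _ _ _ _) (c := 1) fun ω => by
    rw [abs_of_nonneg (ramp_nonneg _)]
    exact ramp_le_one _

lemma integral_smoothSubsampler [IsFiniteMeasure μ] (hX : ∀ t, Measurable (X t)) (S : Scheme)
    (n b : ℕ) (e x : ℝ) : ∫ ω, smoothSubsampler S X n b e ω x ∂μ =
      (1 / (numBlocks S n b : ℝ)) * ∑ i ∈ Finset.range (numBlocks S n b),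
        ∫ ω, ramp ((blockMax X (blockStart S b i) b ω - x) / e) ∂μ := by
  unfold smoothSubsampler
  rw [integral_const_mul, integral_finsetSum _ fun i _ => integrable_rampBlock hX _ _ _ _]

lemma smoothSubsampler_sub_integral [IsFiniteMeasure μ] (hX : ∀ t, Measurable (X t)) (S : Scheme)
    (n b : ℕ) (e x : ℝ) (ω : Ω) :
    smoothSubsampler S X n b e ω x - ∫ ω', smoothSubsampler S X n b e ω' x ∂μ =
      (1 / (numBlocks S n b : ℝ)) * ∑ i ∈ Finset.range (numBlocks S n b),
        centeredBlock S X μ b e x i ω := by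
  rw [integral_smoothSubsampler hX, smoothSubsampler, ← mul_sub, ← Finset.sum_sub_distrib]
  rfl

lemma abs_integral_subsampler_pow_le [IsProbabilityMeasure μ] (hX : ∀ t, Measurable (X t))
    (S : Scheme) (n b p : ℕ) (e x : ℝ) :
    |∫ ω, (smoothSubsampler S X n b e ω x - ∫ ω', smoothSubsampler S X n b e ω' x ∂μ) ^ p ∂μ| ≤
      (1 / (numBlocks S n b : ℝ)) ^ p *
        absMoment μ (centeredBlock S X μ b e x) (numBlocks S n b) (Fin p) := by
  simp only [smoothSubsampler_sub_integral hX, mul_pow]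
  rw [integral_const_mul, abs_mul, abs_of_nonneg (by positivity)]
  refine mul_le_mul_of_nonneg_left ?_ (by positivity)
  refine abs_integral_sum_pow_le_absMoment p fun i => ?_
  exact integrable_of_abs_le (c := 1)
    (Finset.measurable_fun_prod _ fun j _ => measurable_centeredBlock hX S b e x _)
    fun ω => abs_prod_le_one fun j => abs_centeredBlock_le _ _ _ _ _ _

/-- Bounds on the sums of the dependence coefficients for sample size `n` and block length `b`. -/
def SumBound : Scheme → (ℕ → ℝ) → ℕ → ℝ → ℕ → ℕ → Prop
  | .overlapping, c, p, T, _, _ =>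
      ∀ N : ℕ, ∑ t ∈ Finset.range N, ((t : ℝ) + 1) ^ (p - 2) * c t ≤ T
  | .nonOverlapping, c, p, T, n, b =>
      ∑ t ∈ Finset.range n, ((t : ℝ) + 1) ^ (p - 2) * c t ≤ T * (b : ℝ) ^ (p - 2)

/-- Everything is measured by `D = b / e + κ (b / e) ^ 2`, which dominates `b` because `e ≤ 1`. In
the overlapping scheme `n ≤ 2 N` gives `D ≤ 2 K₀ N B`; in the other one `n ≤ 2 N b` gives `D / b ≤ 2
K₀ N B`. With the weighted sums of the correlation bounds this is the input of
`exists_absMoment_le`, and the averaging factor cancels `N ^ p`. -/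
lemma exists_moment_le_of_sumBound [IsProbabilityMeasure μ] (hX : ∀ t, Measurable (X t)) (S : Scheme)
    {κ : ℝ} {c : ℕ → ℝ} (hcov : ∀ t, CovBound X μ κ t (c t)) (hκ : 0 ≤ κ) (hc : ∀ t, 0 ≤ c t)
    {p : ℕ} (hp : 2 ≤ p) {T K₀ : ℝ} (hT : 0 ≤ T) (hK₀ : 1 ≤ K₀) :
    ∃ K : ℝ, 0 ≤ K ∧ ∀ (n b : ℕ) (e B x : ℝ), 1 ≤ b → 2 * b ≤ n → 0 < e → e ≤ 1 → 0 ≤ B → B ≤ 1 →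
      b / e + κ * (b / e) ^ 2 ≤ K₀ * (n * B) → SumBound S c p T n b →
      |∫ ω, (smoothSubsampler S X n b e ω x - ∫ ω', smoothSubsampler S X n b e ω' x ∂μ) ^ p ∂μ| ≤
        K * B ^ ((p + 1) / 2) := by
  set E : ℝ := 2 * (p : ℝ) ^ 4 with hE
  have hE0 : 0 ≤ E := by positivity
  obtain ⟨K, hK0, hK⟩ := exists_absMoment_le (μ := μ)
    -- The constants of the two schemes are added so that one choice serves both.
    (((2 + 2 ^ p * E * T) + (6 * 3 ^ p + 4 ^ p * E * T)) * (2 * K₀) ^ p) p p (by omega) le_rfl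
  refine ⟨K, hK0, fun n b e B x hb hbn he he1 hB hB1 hD hsum => ?_⟩
  set D : ℝ := b / e + κ * (b / e) ^ 2 with hDdef
  set N := numBlocks S n b with hN
  have hb0 : (1 : ℝ) ≤ b := by exact_mod_cast hb
  have hbD : (b : ℝ) ≤ D := by
    have h1 : (b : ℝ) ≤ b / e := by
      rw [le_div_iff₀ he]
      nlinarith
    have : 0 ≤ κ * ((b : ℝ) / e) ^ 2 := by positivity
    linarith
  have hNpos : 0 < N := by
    rcases S with _ | _
    · simp only [hN, numBlocks]; omega
    · simp only [hN, numBlocks]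
      exact Nat.div_pos (by omega) hb
  have hNr : (1 : ℝ) ≤ N := by exact_mod_cast hNpos
  have hD0 : 0 ≤ D := by linarith
  have hpowle : ∀ {Q : ℝ} {q : ℕ}, 2 ≤ q → q ≤ p → 0 ≤ Q →
      N * (Q * (2 * K₀ * (N * B)) ^ (q - 1)) ≤ Q * (2 * K₀) ^ p * (N ^ q * B ^ (q - 1)) := by
    intro Q q hq hqp hQ
    calc N * (Q * (2 * K₀ * (N * B)) ^ (q - 1))
        = Q * (2 * K₀) ^ (q - 1) * ((N ^ (q - 1) * N) * B ^ (q - 1)) := by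
          rw [mul_pow, mul_pow (N : ℝ)]; ring
      _ = Q * (2 * K₀) ^ (q - 1) * (N ^ q * B ^ (q - 1)) := by
          rw [← pow_succ, show q - 1 + 1 = q by omega]
      _ ≤ _ := by
          gcongr
          · linarith
          · omega
  have hA : absMoment μ (centeredBlock S X μ b e x) N (Fin p) ≤
      K * (N ^ p * B ^ ((p + 1) / 2)) := by
    rcases S with _ | _
    · refine hK _ N (overlapBound b (E * D) c) B
        (overlapBound_nonneg (mul_nonneg hE0 hD0) hc) hB hB1
        (fun i _ => integral_centeredBlock hX _ _ _ _ _)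
        (gapDecorrelation_overlapping hX hcov hκ hc hb he x N p) ?_ (Fin p) (Fintype.card_fin p)
      intro q hq hqp
      have h1 := sum_overlapBound_le hc hE0 hb hbD hq hqp (hsum N)
      have hnN : (n : ℝ) ≤ 2 * N := by
        have : n ≤ 2 * N := by simp only [hN, numBlocks]; omega
        exact_mod_cast this
      have h2 : D ≤ 2 * K₀ * (N * B) := by
        calc D ≤ K₀ * (n * B) := hD
          _ ≤ K₀ * (2 * N * B) := by gcongr
          _ = _ := by ring
      calc _ ≤ N * ((2 + 2 ^ p * E * T) * (2 * K₀ * (N * B)) ^ (q - 1)) := by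
            gcongr
            exact h1.trans (by gcongr)
        _ ≤ (2 + 2 ^ p * E * T) * (2 * K₀) ^ p * (N ^ q * B ^ (q - 1)) :=
            hpowle hq hqp (by positivity)
        _ ≤ _ := mul_le_mul_of_nonneg_right (mul_le_mul_of_nonneg_right
            (le_add_of_nonneg_right (by positivity)) (by positivity)) (by positivity)
    · refine hK _ N (disjointBound b (E * D) c) B
        (disjointBound_nonneg (mul_nonneg hE0 hD0) hc) hB hB1
        (fun i _ => integral_centeredBlock hX _ _ _ _ _)
        (gapDecorrelation_nonOverlapping hX hcov hκ hc hb he x N p) ?_ (Fin p) (Fintype.card_fin p)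
      intro q hq hqp
      have h1 := sum_disjointBound_le (N := N) hc hE0 hT hb hbD hqp (Nat.div_mul_le_self n b) hsum
      have hnN : (n : ℝ) ≤ 2 * N * b := by
        have h3 := Nat.lt_div_mul_add (a := n) (b := b) hb
        have h4 : 1 * b ≤ N * b := Nat.mul_le_mul_right b hNpos
        have : n ≤ 2 * N * b := by
          simp only [hN, numBlocks] at h4 ⊢
          rw [mul_assoc]
          omega
        exact_mod_cast this
      have h2 : D / b ≤ 2 * K₀ * (N * B) := by
        rw [div_le_iff₀ (by linarith)]
        calc D ≤ K₀ * (n * B) := hD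
          _ ≤ K₀ * (2 * N * b * B) := by gcongr
          _ = _ := by ring
      -- Here the correlation sum is only linear in `D / b`; since `D / b ≥ 1`, its bound exceeds
      -- one and may be raised to the power `q - 1 ≥ 1`.
      have h3 : 1 ≤ 2 * K₀ * (N * B) := le_trans (by rwa [le_div_iff₀ (by linarith), one_mul]) h2
      have h4 : D / b ≤ (2 * K₀ * (N * B)) ^ (q - 1) :=
        h2.trans (le_self_pow₀ h3 (by omega))
      calc _ ≤ N * ((6 * 3 ^ p + 4 ^ p * E * T) * (2 * K₀ * (N * B)) ^ (q - 1)) := by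
            gcongr
            exact h1.trans (by gcongr)
        _ ≤ (6 * 3 ^ p + 4 ^ p * E * T) * (2 * K₀) ^ p * (N ^ q * B ^ (q - 1)) :=
            hpowle hq hqp (by positivity)
        _ ≤ _ := mul_le_mul_of_nonneg_right (mul_le_mul_of_nonneg_right
            (le_add_of_nonneg_left (by positivity)) (by positivity)) (by positivity)
  refine (abs_integral_subsampler_pow_le hX S n b p e x).trans ?_
  calc _ ≤ (1 / (N : ℝ)) ^ p * (K * (N ^ p * B ^ ((p + 1) / 2))) := by gcongr
    _ = _ := by
      rw [div_pow, one_pow]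
      field_simp

lemma abs_smoothSubsampler_sub_integral_le [IsProbabilityMeasure μ] (S : Scheme) (n b : ℕ)
    (e x : ℝ) (ω : Ω) :
    |smoothSubsampler S X n b e ω x - ∫ ω', smoothSubsampler S X n b e ω' x ∂μ| ≤ 1 := by
  have h0 : 0 ≤ ∫ ω', smoothSubsampler S X n b e ω' x ∂μ :=
    integral_nonneg fun ω => smoothSubsampler_nonneg S X n b e ω x
  have h1 : ∫ ω', smoothSubsampler S X n b e ω' x ∂μ ≤ 1 :=
    (le_abs_self _).trans (abs_integral_le_of_abs_le fun ω => by
      rw [abs_of_nonneg (smoothSubsampler_nonneg S X n b e ω x)]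
      exact smoothSubsampler_le_one S X n b e ω x)
  rw [abs_le]
  constructor <;>
    linarith [smoothSubsampler_nonneg S X n b e ω x, smoothSubsampler_le_one S X n b e ω x]

lemma abs_integral_subsampler_pow_le_one [IsProbabilityMeasure μ] (S : Scheme) (n b p : ℕ)
    (e x : ℝ) :
    |∫ ω, (smoothSubsampler S X n b e ω x - ∫ ω', smoothSubsampler S X n b e ω' x ∂μ) ^ p ∂μ| ≤
      1 := by
  refine abs_integral_le_of_abs_le fun ω => ?_
  rw [abs_pow]
  exact pow_le_one₀ (abs_nonneg _) (abs_smoothSubsampler_sub_integral_le S n b e x ω)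

/-- The weights are positive, also for the negative exponent at `p = 1`, so a finite weighted sum
forces finite coefficients. -/
lemma coeff_ne_top_of_coeffSumCondition {S : Scheme} {c : ℕ → ℝ≥0∞} {p : ℕ} {b : ℕ → ℕ}
    (h : CoeffSumCondition S c p b) (t : ℕ) : c t ≠ ⊤ := by
  have hpos : ENNReal.ofReal (((t : ℝ) + 1) ^ ((p : ℤ) - 2)) ≠ 0 := by
    rw [Ne, ENNReal.ofReal_eq_zero, not_le]
    positivity
  have hfin : ENNReal.ofReal (((t : ℝ) + 1) ^ ((p : ℤ) - 2)) * c t < ⊤ := by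
    rcases S with _ | _
    · exact lt_of_le_of_lt (ENNReal.le_tsum t) h
    · obtain ⟨K, hK⟩ := h
      obtain ⟨n, hn, hnt⟩ := (hK.and (eventually_gt_atTop t)).exists
      refine lt_of_le_of_lt ?_ (lt_of_le_of_lt hn ENNReal.ofReal_lt_top)
      exact Finset.single_le_sum
        (f := fun t : ℕ => ENNReal.ofReal (((t : ℝ) + 1) ^ ((p : ℤ) - 2)) * c t)
        (fun _ _ => zero_le) (Finset.mem_range.2 hnt)
  intro htop
  rw [htop, ENNReal.mul_top hpos] at hfin
  exact lt_irrefl _ hfin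

lemma eventually_sumBound_of_coeffSumCondition {S : Scheme} {c : ℕ → ℝ≥0∞} {p : ℕ} (hp : 2 ≤ p)
    {b : ℕ → ℕ} (h : CoeffSumCondition S c p b) :
    ∃ T : ℝ, 0 ≤ T ∧ ∀ᶠ n in atTop, SumBound S (fun t => 4 * (c t).toReal) p T n (b n) := by
  have htop := coeff_ne_top_of_coeffSumCondition h
  have hz : ((p : ℤ) - 2) = ((p - 2 : ℕ) : ℤ) := by omega
  have hsum : ∀ N, ∑ t ∈ Finset.range N, ((t : ℝ) + 1) ^ (p - 2) * (4 * (c t).toReal) =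
      4 * (∑ t ∈ Finset.range N, ENNReal.ofReal (((t : ℝ) + 1) ^ ((p : ℤ) - 2)) * c t).toReal := by
    intro N
    rw [ENNReal.toReal_sum fun t _ => ENNReal.mul_ne_top ENNReal.ofReal_ne_top (htop t),
      Finset.mul_sum]
    refine Finset.sum_congr rfl fun t _ => ?_
    rw [ENNReal.toReal_mul, ENNReal.toReal_ofReal (by positivity), hz, zpow_natCast]
    ring
  rcases S with _ | _
  · refine ⟨4 * (∑' t : ℕ, ENNReal.ofReal (((t : ℝ) + 1) ^ ((p : ℤ) - 2)) * c t).toReal,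
      by positivity, Eventually.of_forall fun n N => ?_⟩
    rw [hsum]
    gcongr
    · exact h.ne
    · exact ENNReal.sum_le_tsum _
  · obtain ⟨K, hK⟩ := h
    refine ⟨4 * |K|, by positivity, hK.mono fun n hn => ?_⟩
    simp only [SumBound]
    rw [hsum]
    have h1 := ENNReal.toReal_mono ENNReal.ofReal_ne_top hn
    have h2 : (ENNReal.ofReal (K * (b n : ℝ) ^ ((p : ℤ) - 2))).toReal ≤
        |K| * (b n : ℝ) ^ (p - 2) := by
      rw [hz, zpow_natCast, ENNReal.toReal_ofReal']
      refine max_le ?_ (by positivity)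
      gcongr
      exact le_abs_self K
    linarith

/-- The preceding bound is applied with `B = n ^ (-δ)`. It yields the exponent `⌈p/2⌉`, which is
weakened to `⌊p/2⌋`. -/
lemma exists_moment_le_of_eventually [IsProbabilityMeasure μ] (hX : ∀ t, Measurable (X t))
    (S : Scheme) {κ : ℝ} {c : ℕ → ℝ} (hcov : ∀ t, CovBound X μ κ t (c t)) (hκ : 0 ≤ κ)
    (hc : ∀ t, 0 ≤ c t) {p : ℕ} (hp : 2 ≤ p) {δ : ℝ} (hδ : 0 < δ) {b : ℕ → ℕ} {ε : ℕ → ℝ}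
    (hb : Tendsto b atTop atTop) (hnb : Tendsto (fun n : ℕ => (n : ℝ) / (b n : ℝ)) atTop atTop)
    (hε : ∀ n, 0 < ε n) (hε0 : Tendsto ε atTop (𝓝 0)) {T K₀ : ℝ} (hT : 0 ≤ T)
    (hD : ∀ᶠ n : ℕ in atTop, (b n : ℝ) / ε n + κ * (b n / ε n) ^ 2 ≤ K₀ * (n : ℝ) ^ (1 - δ))
    (hsum : ∀ᶠ n in atTop, SumBound S c p T n (b n)) :
    ∃ K : ℝ, ∀ n : ℕ, 1 ≤ n → ∀ x : ℝ,
      |∫ ω, (smoothSubsampler S X n (b n) (ε n) ω x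
        - ∫ ω', smoothSubsampler S X n (b n) (ε n) ω' x ∂μ) ^ p ∂μ|
        ≤ K * (n : ℝ) ^ (-(((p / 2 : ℕ) : ℝ) * δ)) := by
  obtain ⟨K, hK0, hK⟩ := exists_moment_le_of_sumBound hX S hcov hκ hc hp hT (le_max_right K₀ 1)
  have hev : ∀ᶠ n : ℕ in atTop, ∀ x : ℝ,
      |∫ ω, (smoothSubsampler S X n (b n) (ε n) ω x
        - ∫ ω', smoothSubsampler S X n (b n) (ε n) ω' x ∂μ) ^ p ∂μ|
        ≤ K * (n : ℝ) ^ (-(((p / 2 : ℕ) : ℝ) * δ)) := by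
    filter_upwards [hD, hsum, hb.eventually_ge_atTop 1, hnb.eventually_ge_atTop 2,
      hε0.eventually_le_const one_pos, eventually_ge_atTop 1] with n h1 h2 h3 h4 h5 h6 x
    have hn1 : (1 : ℝ) ≤ n := by exact_mod_cast h6
    have hn0 : (0 : ℝ) < n := by linarith
    have hbn : 2 * b n ≤ n := by
      rw [le_div_iff₀ (by exact_mod_cast h3)] at h4
      exact_mod_cast h4
    have hB0 : (0 : ℝ) ≤ (n : ℝ) ^ (-δ) := Real.rpow_nonneg hn0.le _
    have hB1 : (n : ℝ) ^ (-δ) ≤ 1 := Real.rpow_le_one_of_one_le_of_nonpos hn1 (by linarith)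
    refine (hK n (b n) (ε n) ((n : ℝ) ^ (-δ)) x h3 hbn (hε n) h5 hB0 hB1 ?_ h2).trans ?_
    · rw [sub_eq_add_neg, Real.rpow_add hn0, Real.rpow_one] at h1
      refine h1.trans ?_
      gcongr
      exact le_max_left _ _
    · refine mul_le_mul_of_nonneg_left ?_ hK0
      refine (pow_le_pow_of_le_one hB0 hB1 (by omega : p / 2 ≤ (p + 1) / 2)).trans (le_of_eq ?_)
      rw [← Real.rpow_natCast, ← Real.rpow_mul hn0.le]
      congr 1
      ring
  obtain ⟨n₀, hn₀⟩ := eventually_atTop.1 hev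
  -- The second entry absorbs the finitely many small `n`, where the moment is merely at most one.
  refine ⟨max K (((n₀ : ℝ) + 1) ^ (((p / 2 : ℕ) : ℝ) * δ)), fun n hn x => ?_⟩
  have hn0 : (0 : ℝ) < n := by exact_mod_cast hn
  rcases le_or_gt n₀ n with h | h
  · refine (hn₀ n h x).trans ?_
    gcongr
    exact le_max_left _ _
  · refine (abs_integral_subsampler_pow_le_one S n (b n) p (ε n) x).trans ?_
    have hs : 0 ≤ ((p / 2 : ℕ) : ℝ) * δ := by positivity
    have h1 : (n : ℝ) ^ (((p / 2 : ℕ) : ℝ) * δ) ≤ ((n₀ : ℝ) + 1) ^ (((p / 2 : ℕ) : ℝ) * δ) := by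
      have : (n : ℝ) ≤ n₀ := by exact_mod_cast h.le
      exact Real.rpow_le_rpow hn0.le (by linarith) hs
    rw [Real.rpow_neg hn0.le, ← div_eq_mul_inv, le_div_iff₀ (by positivity), one_mul]
    exact h1.trans (le_max_right _ _)

lemma le_of_div_rpow_isBigO {f g : ℕ → ℝ} {δ : ℝ}
    (h : (fun n : ℕ => f n / ((n : ℝ) ^ (1 - δ) * g n)) =O[atTop] (fun _ => (1 : ℝ))) :
    ∃ K : ℝ, 0 ≤ K ∧ ∀ᶠ n : ℕ in atTop, f n / g n ≤ K * (n : ℝ) ^ (1 - δ) := by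
  obtain ⟨K, hK0, hK⟩ := h.exists_nonneg
  refine ⟨K, hK0, ?_⟩
  filter_upwards [hK.bound, eventually_ge_atTop 1] with n hn h1
  have hn0 : (0 : ℝ) < n := by exact_mod_cast h1
  have hr : (0 : ℝ) < (n : ℝ) ^ (1 - δ) := Real.rpow_pos_of_pos hn0 _
  rw [norm_one, mul_one] at hn
  have h2 := (le_abs_self _).trans hn
  rw [mul_comm ((n : ℝ) ^ (1 - δ)), ← div_div, div_le_iff₀ hr] at h2
  exact h2

/-- The moment bound for the smooth subsampler. -/
lemma exists_moment_le [IsProbabilityMeasure μ] (hX : ∀ t, Measurable (X t))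
    {b : ℕ → ℕ} (hb : Tendsto b atTop atTop)
    (hnb : Tendsto (fun n : ℕ => (n : ℝ) / (b n : ℝ)) atTop atTop)
    {ε : ℕ → ℝ} (hε : ∀ n, 0 < ε n) (hε0 : Tendsto ε atTop (𝓝 0))
    (S : Scheme) {p : ℕ} (hp : 1 ≤ p) {δ : ℝ} (hδ : 0 < δ)
    (hsub : SubsamplingCondition S X μ p δ b ε) :
    ∃ K : ℝ, ∀ n : ℕ, 1 ≤ n → ∀ x : ℝ,
      |∫ ω, (smoothSubsampler S X n (b n) (ε n) ω x
        - ∫ ω', smoothSubsampler S X n (b n) (ε n) ω' x ∂μ) ^ p ∂μ|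
        ≤ K * (n : ℝ) ^ (-(((p / 2 : ℕ) : ℝ) * δ)) := by
  obtain rfl | hp2 : p = 1 ∨ 2 ≤ p := by omega
  · refine ⟨0, fun n _ x => ?_⟩
    have hint : Integrable (fun ω => smoothSubsampler S X n (b n) (ε n) ω x) μ :=
      integrable_of_abs_le (c := 1) (measurable_smoothSubsampler hX S n (b n) (ε n) x) fun ω => by
        rw [abs_of_nonneg (smoothSubsampler_nonneg S X n (b n) (ε n) ω x)]
        exact smoothSubsampler_le_one S X n (b n) (ε n) ω x
    simp only [pow_one, zero_mul]
    rw [integral_sub hint (integrable_const _), integral_const, probReal_univ, one_smul, sub_self,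
      abs_zero]
  rcases hsub with ⟨-, hsum, hband⟩ | ⟨-, hsum, hband⟩
  · obtain ⟨T, hT, hTsum⟩ := eventually_sumBound_of_coeffSumCondition hp2 hsum
    have hD : ∃ K : ℝ, ∀ᶠ n : ℕ in atTop,
        (b n : ℝ) / ε n + 0 * (b n / ε n) ^ 2 ≤ K * (n : ℝ) ^ (1 - δ) := by
      rcases S with _ | _
      · obtain ⟨K, -, hK⟩ := le_of_div_rpow_isBigO hband
        exact ⟨K, hK.mono fun n hn => by linarith⟩
      · obtain ⟨K, -, hK⟩ := le_of_div_rpow_isBigO hband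
        refine ⟨K, (hK.and (hb.eventually_ge_atTop 1)).mono fun n hn => ?_⟩
        have h1 : (1 : ℝ) ≤ b n := by exact_mod_cast hn.2
        have h2 : (b n : ℝ) / ε n ≤ (b n : ℝ) ^ 2 / ε n := by
          have := hε n
          gcongr
          exact le_self_pow₀ h1 (by norm_num)
        linarith [hn.1]
    obtain ⟨K, hK⟩ := hD
    exact exists_moment_le_of_eventually hX S
      (fun t => covBound_eta (coeff_ne_top_of_coeffSumCondition hsum t)) le_rfl
      (fun t => by positivity) hp2 hδ hb hnb hε hε0 hT hK hTsum
  · obtain ⟨T, hT, hTsum⟩ := eventually_sumBound_of_coeffSumCondition hp2 hsum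
    obtain ⟨K, -, hK⟩ := le_of_div_rpow_isBigO hband
    have hD : ∀ᶠ n : ℕ in atTop,
        (b n : ℝ) / ε n + 1 * (b n / ε n) ^ 2 ≤ (2 * K) * (n : ℝ) ^ (1 - δ) := by
      filter_upwards [hK, hb.eventually_ge_atTop 1, hε0.eventually_le_const one_pos]
        with n h1 h2 h3
      have h4 : (1 : ℝ) ≤ b n := by exact_mod_cast h2
      have h5 : (1 : ℝ) ≤ b n / ε n := by
        rw [le_div_iff₀ (hε n)]
        linarith
      have h6 : (b n : ℝ) / ε n ≤ (b n / ε n) ^ 2 := le_self_pow₀ h5 (by norm_num)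
      rw [← div_pow] at h1
      linarith
    exact exists_moment_le_of_eventually hX S
      (fun t => covBound_lambda (coeff_ne_top_of_coeffSumCondition hsum t)) zero_le_one
      (fun t => by positivity) hp2 hδ hb hnb hε hε0 hT hD hTsum

end SubsamplerMomentBound

/-! ### Extreme value distributions, quantiles and Pólya's theorem. -/

section LimitDistribution

/-- A continuous distribution function, strictly increasing between the values `0` and `1`. -/
structure IsRegularCdf (H : ℝ → ℝ) : Prop where
  continuous : Continuous H
  monotone : Monotone H
  lt_of_lt : ∀ {x y}, x < y → 0 < H y → H x < 1 → H x < H y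
  nonneg : ∀ x, 0 ≤ H x
  le_one : ∀ x, H x ≤ 1
  tendsto_atBot : Tendsto H atBot (𝓝 0)
  tendsto_atTop : Tendsto H atTop (𝓝 1)

lemma gev_zero (x : ℝ) : gev 0 x = Real.exp (-Real.exp (-x)) := by simp [gev]

/-- Since `exp (-y ^ (-1/γ)) = exp (-(y ^ (1/γ))⁻¹)`, the function is a composition with
`expNegInvGlue`, whose known continuity and monotonicity settle the behaviour at the finite left
endpoint. -/
lemma gev_of_pos {γ : ℝ} (hγ : 0 < γ) (x : ℝ) :
    gev γ x = expNegInvGlue (max (1 + γ * x) 0 ^ (1 / γ)) := by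
  rw [gev, if_neg hγ.ne']
  split_ifs with h1 h2
  · rw [max_eq_left h1.le, expNegInvGlue, if_neg (not_le.2 (by positivity)), neg_div,
      Real.rpow_neg h1.le]
  · linarith
  · rw [max_eq_right (not_lt.1 h1), Real.zero_rpow (by positivity), expNegInvGlue.zero]

lemma gev_of_neg {γ : ℝ} (hγ : γ < 0) (x : ℝ) :
    gev γ x = Real.exp (-(max (1 + γ * x) 0 ^ (-1 / γ))) := by
  rw [gev, if_neg hγ.ne]
  split_ifs with h1
  · rw [max_eq_left h1.le]
  · rw [max_eq_right (not_lt.1 h1), Real.zero_rpow (div_pos_of_neg_of_neg (by norm_num) hγ).ne',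
      neg_zero, Real.exp_zero]

lemma exists_gev_eq_exp_neg {γ x : ℝ} (h : 0 < 1 + γ * x) :
    ∃ τ : ℝ, 0 < τ ∧ gev γ x = Real.exp (-τ) := by
  by_cases h0 : γ = 0
  · exact ⟨Real.exp (-x), Real.exp_pos _, by rw [h0, gev_zero]⟩
  · exact ⟨(1 + γ * x) ^ (-1 / γ), Real.rpow_pos_of_pos h _, by rw [gev, if_neg h0, if_pos h]⟩

lemma expNegInvGlue_le_one (x : ℝ) : expNegInvGlue x ≤ 1 := by
  unfold expNegInvGlue
  split_ifs with h
  · exact zero_le_one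
  · rw [Real.exp_le_one_iff, neg_nonpos, inv_nonneg]
    linarith

lemma isRegularCdf_gev (γ : ℝ) : IsRegularCdf (gev γ) := by
  rcases lt_trichotomy γ 0 with hγ | rfl | hγ
  · have hc : 0 < -1 / γ := div_pos_of_neg_of_neg (by norm_num) hγ
    have heq : gev γ = fun x => Real.exp (-(max (1 + γ * x) 0 ^ (-1 / γ))) :=
      funext (gev_of_neg hγ)
    rw [heq]
    constructor
    · have : Continuous fun x : ℝ => max (1 + γ * x) 0 ^ (-1 / γ) :=
        Continuous.rpow_const (by fun_prop) fun _ => Or.inr hc.le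
      fun_prop
    · intro x y hxy
      rw [Real.exp_le_exp, neg_le_neg_iff]
      exact Real.rpow_le_rpow (le_max_right _ _)
        (max_le_max_right _ (by nlinarith)) hc.le
    · intro x y hxy _ h
      rw [Real.exp_lt_one_iff, neg_lt_zero] at h
      have hx : 0 < 1 + γ * x := by
        by_contra hx
        rw [max_eq_right (not_lt.1 hx), Real.zero_rpow hc.ne'] at h
        exact lt_irrefl _ h
      rw [Real.exp_lt_exp, neg_lt_neg_iff]
      refine Real.rpow_lt_rpow (le_max_right _ _) ?_ hc
      rw [max_eq_left hx.le]
      exact max_lt (by nlinarith) hx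
    · exact fun x => (Real.exp_pos _).le
    · intro x
      rw [Real.exp_le_one_iff, neg_nonpos]
      positivity
    · refine Real.tendsto_exp_neg_atTop_nhds_zero.comp ((tendsto_rpow_atTop hc).comp ?_)
      refine tendsto_atTop_mono (fun x => le_max_left _ _) ?_
      exact tendsto_atTop_add_const_left _ _ (tendsto_id.const_mul_atBot_of_neg hγ)
    · refine tendsto_const_nhds.congr' ?_
      have h1 : Tendsto (fun x : ℝ => 1 + γ * x) atTop atBot :=
        tendsto_atBot_add_const_left _ _ (tendsto_id.const_mul_atTop_of_neg hγ)
      filter_upwards [h1.eventually_le_atBot 0] with x hx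
      rw [max_eq_right hx, Real.zero_rpow hc.ne', neg_zero, Real.exp_zero]
  · have heq : gev 0 = fun x => Real.exp (-Real.exp (-x)) := funext gev_zero
    rw [heq]
    constructor
    · fun_prop
    · intro x y hxy
      simpa using hxy
    · intro x y hxy _ _
      simpa using hxy
    · exact fun x => (Real.exp_pos _).le
    · intro x
      rw [Real.exp_le_one_iff, neg_nonpos]
      positivity
    · exact Real.tendsto_exp_neg_atTop_nhds_zero.comp
        (Real.tendsto_exp_atTop.comp tendsto_neg_atBot_atTop)
    · have h1 : Tendsto (fun x : ℝ => Real.exp (-x)) atTop (𝓝 0) :=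
        Real.tendsto_exp_neg_atTop_nhds_zero
      have h2 := (Real.continuous_exp.tendsto _).comp h1.neg
      rw [neg_zero, Real.exp_zero] at h2
      exact h2
  · have hc : 0 < 1 / γ := by positivity
    have heq : gev γ = fun x => expNegInvGlue (max (1 + γ * x) 0 ^ (1 / γ)) :=
      funext (gev_of_pos hγ)
    have hpos : ∀ {x : ℝ}, 0 < x → expNegInvGlue x = Real.exp (-x⁻¹) := fun h => by
      rw [expNegInvGlue, if_neg (not_le.2 h)]
    have hlt : ∀ {x y : ℝ}, x < y → 0 < expNegInvGlue (max (1 + γ * y) 0 ^ (1 / γ)) →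
        expNegInvGlue (max (1 + γ * x) 0 ^ (1 / γ)) <
          expNegInvGlue (max (1 + γ * y) 0 ^ (1 / γ)) := by
      intro x y hxy h
      have hy : 0 < 1 + γ * y := by
        by_contra hy
        rw [max_eq_right (not_lt.1 hy), Real.zero_rpow hc.ne', expNegInvGlue.zero] at h
        exact lt_irrefl _ h
      have hxy' : 1 + γ * x < 1 + γ * y := by nlinarith
      rcases le_or_gt (1 + γ * x) 0 with hx | hx
      · rwa [max_eq_right hx, Real.zero_rpow hc.ne', expNegInvGlue.zero]
      · rw [max_eq_left hx.le, max_eq_left hy.le, hpos (Real.rpow_pos_of_pos hx _),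
          hpos (Real.rpow_pos_of_pos hy _), Real.exp_lt_exp, neg_lt_neg_iff]
        exact inv_strictAnti₀ (Real.rpow_pos_of_pos hx _) (Real.rpow_lt_rpow hx.le hxy' hc)
    rw [heq]
    constructor
    · have : Continuous fun x : ℝ => max (1 + γ * x) 0 ^ (1 / γ) :=
        Continuous.rpow_const (by fun_prop) fun _ => Or.inr hc.le
      exact (expNegInvGlue.contDiff (n := 0)).continuous.comp this
    · exact expNegInvGlue.monotone.comp fun x y hxy =>
        Real.rpow_le_rpow (le_max_right _ _) (max_le_max_right _ (by nlinarith)) hc.le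
    · exact fun hxy h _ => hlt hxy h
    · exact fun x => expNegInvGlue.nonneg _
    · exact fun x => expNegInvGlue_le_one _
    · refine tendsto_const_nhds.congr' ?_
      have h1 : Tendsto (fun x : ℝ => 1 + γ * x) atBot atBot :=
        tendsto_atBot_add_const_left _ _ (tendsto_id.const_mul_atBot hγ)
      filter_upwards [h1.eventually_le_atBot 0] with x hx
      rw [max_eq_right hx, Real.zero_rpow hc.ne', expNegInvGlue.zero]
    · have h0 : Tendsto (fun x : ℝ => max (1 + γ * x) 0 ^ (1 / γ)) atTop atTop := by
        refine (tendsto_rpow_atTop hc).comp (tendsto_atTop_mono (fun x => le_max_left _ _) ?_)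
        exact tendsto_atTop_add_const_left _ _ (tendsto_id.const_mul_atTop hγ)
      have h1 := (Real.continuous_exp.tendsto _).comp (tendsto_inv_atTop_zero.comp h0).neg
      rw [neg_zero, Real.exp_zero] at h1
      refine h1.congr' ?_
      filter_upwards [h0.eventually_gt_atTop 0] with x hx
      rw [hpos hx]
      rfl

lemma IsRegularCdf.rpow {G : ℝ → ℝ} (hG : IsRegularCdf G) {θ : ℝ} (hθ : 0 < θ) :
    IsRegularCdf fun x => G x ^ θ where
  continuous := hG.continuous.rpow_const fun _ => Or.inr hθ.le
  monotone := fun x y hxy => Real.rpow_le_rpow (hG.nonneg x) (hG.monotone hxy) hθ.le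
  lt_of_lt := by
    intro x y hxy hy hx
    refine Real.rpow_lt_rpow (hG.nonneg x) (hG.lt_of_lt hxy ?_ ?_) hθ
    · refine (hG.nonneg y).lt_of_ne fun h => ?_
      rw [← h, Real.zero_rpow hθ.ne'] at hy
      exact lt_irrefl _ hy
    · refine (hG.le_one x).lt_of_ne fun h => ?_
      rw [h, Real.one_rpow] at hx
      exact lt_irrefl _ hx
  nonneg := fun x => Real.rpow_nonneg (hG.nonneg x) _
  le_one := fun x => Real.rpow_le_one (hG.nonneg x) (hG.le_one x) hθ.le
  tendsto_atBot := by
    have := hG.tendsto_atBot.rpow_const (p := θ) (Or.inr hθ.le)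
    rwa [Real.zero_rpow hθ.ne'] at this
  tendsto_atTop := by
    have := hG.tendsto_atTop.rpow_const (p := θ) (Or.inr hθ.le)
    rwa [Real.one_rpow] at this

lemma isRegularCdf_limitCdf (γ : ℝ) {θ : ℝ} (hθ : 0 < θ) : IsRegularCdf (limitCdf γ θ) :=
  (isRegularCdf_gev γ).rpow hθ

variable {H : ℝ → ℝ}

lemma IsRegularCdf.nonempty_superlevel (hH : IsRegularCdf H) {t : ℝ} (ht : t < 1) :
    {x | t ≤ H x}.Nonempty :=
  (hH.tendsto_atTop.eventually_const_le ht).exists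

lemma IsRegularCdf.bddBelow_superlevel (hH : IsRegularCdf H) {t : ℝ} (ht : 0 < t) :
    BddBelow {x | t ≤ H x} := by
  obtain ⟨y, hy⟩ := (hH.tendsto_atBot.eventually_lt_const ht).exists
  refine ⟨y, fun x hx => ?_⟩
  by_contra! h
  exact absurd (hx.trans (hH.monotone h.le)) (not_le.2 hy)

lemma IsRegularCdf.lt_of_lt_genInv (hH : IsRegularCdf H) {t x : ℝ} (ht : 0 < t)
    (hx : x < genInv H t) : H x < t := by
  by_contra! h
  exact absurd (csInf_le (hH.bddBelow_superlevel ht) h) (not_le.2 hx)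

/-- Strict increase between the values `0` and `1` rules out a flat piece at the level `t`; this
makes the quantile a stable quantity. -/
lemma IsRegularCdf.lt_of_genInv_lt (hH : IsRegularCdf H) {t x : ℝ} (ht : 0 < t) (ht1 : t < 1)
    (hx : genInv H t < x) : t < H x := by
  obtain ⟨y, hy, hyx⟩ := exists_lt_of_csInf_lt (hH.nonempty_superlevel ht1) hx
  have hy' : t ≤ H y := hy
  rcases (hH.le_one y).lt_or_eq with h | h
  · exact hy'.trans_lt (hH.lt_of_lt hyx ((ht.trans_le hy').trans_le (hH.monotone hyx.le)) h)
  · exact (ht1.trans_eq h.symm).trans_le (hH.monotone hyx.le)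

lemma IsRegularCdf.apply_genInv (hH : IsRegularCdf H) {t : ℝ} (ht : 0 < t) (ht1 : t < 1) :
    H (genInv H t) = t := by
  apply le_antisymm
  · refine le_of_tendsto (f := H) (x := 𝓝[<] genInv H t)
      (hH.continuous.continuousAt.tendsto.mono_left nhdsWithin_le_nhds) ?_
    filter_upwards [self_mem_nhdsWithin] with x hx
    exact (hH.lt_of_lt_genInv ht hx).le
  · refine ge_of_tendsto (f := H) (x := 𝓝[>] genInv H t)
      (hH.continuous.continuousAt.tendsto.mono_left nhdsWithin_le_nhds) ?_
    filter_upwards [self_mem_nhdsWithin] with x hx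
    exact (hH.lt_of_genInv_lt ht ht1 hx).le

lemma IsRegularCdf.genInv_lt_genInv (hH : IsRegularCdf H) {s t : ℝ} (hs : 0 < s) (hst : s < t)
    (ht : t < 1) : genInv H s < genInv H t := by
  by_contra! h
  have := hH.monotone h
  rw [hH.apply_genInv hs (hst.trans ht), hH.apply_genInv (hs.trans hst) ht] at this
  linarith

/-- Monotone functions converging pointwise to a continuous function converge locally uniformly. -/
lemma tendstoLocallyUniformly_of_monotone {f : ℕ → ℝ → ℝ} {g : ℝ → ℝ} (hf : ∀ n, Monotone (f n))
    (hg : Continuous g) (h : ∀ x, Tendsto (fun n => f n x) atTop (𝓝 (g x))) :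
    TendstoLocallyUniformly f g atTop := by
  rw [Metric.tendstoLocallyUniformly_iff]
  intro e he x
  obtain ⟨d, hd, hdx⟩ := Metric.continuousAt_iff.1 (hg.continuousAt (x := x)) (e / 4) (by linarith)
  have hnear : ∀ y, |y - x| < d → |g y - g x| < e / 4 := fun y hy => hdx hy
  have h1 := Metric.tendsto_nhds.1 (h (x - d / 2)) (e / 4) (by linarith)
  have h2 := Metric.tendsto_nhds.1 (h (x + d / 2)) (e / 4) (by linarith)
  refine ⟨Metric.ball x (d / 2), Metric.ball_mem_nhds x (by linarith), ?_⟩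
  filter_upwards [h1, h2] with n h1 h2 y hy
  rw [Metric.mem_ball, Real.dist_eq, abs_lt] at hy
  rw [Real.dist_eq, abs_lt] at h1 h2 ⊢
  have h3 := abs_lt.1 (hnear (x - d / 2) (by rw [abs_lt]; constructor <;> linarith))
  have h4 := abs_lt.1 (hnear (x + d / 2) (by rw [abs_lt]; constructor <;> linarith))
  have h5 := abs_lt.1 (hnear y (by rw [abs_lt]; constructor <;> linarith))
  have h6 := hf n (show x - d / 2 ≤ y by linarith)
  have h7 := hf n (show y ≤ x + d / 2 by linarith)
  constructor <;> linarith

/-- Pólya's theorem. -/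
lemma tendstoUniformly_of_monotone {f : ℕ → ℝ → ℝ} {g : ℝ → ℝ} (hf : ∀ n, Monotone (f n))
    (hf0 : ∀ n x, 0 ≤ f n x) (hf1 : ∀ n x, f n x ≤ 1) (hg : Continuous g) (hgm : Monotone g)
    (hg0 : Tendsto g atBot (𝓝 0)) (hg1 : Tendsto g atTop (𝓝 1))
    (h : ∀ x, Tendsto (fun n => f n x) atTop (𝓝 (g x))) :
    TendstoUniformly f g atTop := by
  rw [Metric.tendstoUniformly_iff]
  intro e he
  obtain ⟨A, hA⟩ := (hg0.eventually_lt_const (show (0 : ℝ) < e / 2 by linarith)).exists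
  obtain ⟨B, hB⟩ := (hg1.eventually_const_lt (show 1 - e / 2 < (1 : ℝ) by linarith)).exists
  have hK := (tendstoLocallyUniformlyOn_iff_tendstoUniformlyOn_of_compact
    (isCompact_Icc (a := A) (b := B))).1
    (tendstoLocallyUniformly_of_monotone hf hg h).tendstoLocallyUniformlyOn
  have hgn : ∀ x, 0 ≤ g x := fun x => ge_of_tendsto' (h x) fun n => hf0 n x
  have hgl : ∀ x, g x ≤ 1 := fun x => le_of_tendsto' (h x) fun n => hf1 n x
  filter_upwards [Metric.tendstoUniformlyOn_iff.1 hK e he, (h A).eventually_lt_const hA,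
    (h B).eventually_const_lt hB] with n hn hnA hnB x
  rcases lt_or_ge x A with hx | hx
  · rw [Real.dist_eq, abs_lt]
    have := hf n hx.le
    have := hgm hx.le
    constructor <;> linarith [hf0 n x, hgn x]
  rcases lt_or_ge B x with hx' | hx'
  · rw [Real.dist_eq, abs_lt]
    have := hf n hx'.le
    have := hgm hx'.le
    constructor <;> linarith [hf1 n x, hgl x]
  · exact hn x ⟨hx, hx'⟩

/-- For `x` and `y` on either side of the limiting quantile, `H x < t < H y` strictly. Eventually
the same holds for the normalized `K n`, which traps its quantile between the images of `x` and `y`.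
-/
lemma tendsto_genInv {K : ℕ → ℝ → ℝ} {U V : ℕ → ℝ} (hU : ∀ n, 0 < U n)
    (hK : ∀ n, Monotone (K n)) (hH : IsRegularCdf H)
    (h : ∀ x, Tendsto (fun n => K n (x / U n + V n)) atTop (𝓝 (H x))) {t : ℝ} (ht : 0 < t)
    (ht1 : t < 1) :
    Tendsto (fun n => U n * (genInv (K n) t - V n)) atTop (𝓝 (genInv H t)) := by
  have hmain : ∀ x y, x < genInv H t → genInv H t < y →
      ∀ᶠ n in atTop, x ≤ U n * (genInv (K n) t - V n) ∧ U n * (genInv (K n) t - V n) ≤ y := by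
    intro x y hx hy
    filter_upwards [(h x).eventually_lt_const (hH.lt_of_lt_genInv ht hx),
      (h y).eventually_const_lt (hH.lt_of_genInv_lt ht ht1 hy)] with n h1 h2
    have hlow : ∀ z ∈ {z | t ≤ K n z}, x / U n + V n ≤ z := by
      intro z hz
      by_contra! hlt
      exact absurd (le_trans (show t ≤ K n z from hz) (hK n hlt.le)) (not_le.2 h1)
    have hmem : y / U n + V n ∈ {z | t ≤ K n z} := h2.le
    have e1 : x / U n + V n ≤ genInv (K n) t := le_csInf ⟨_, hmem⟩ hlow
    have e2 : genInv (K n) t ≤ y / U n + V n := csInf_le ⟨_, hlow⟩ hmem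
    constructor
    · rw [mul_comm, ← div_le_iff₀ (hU n)]
      linarith
    · rw [mul_comm, ← le_div_iff₀ (hU n)]
      linarith
  refine tendsto_order.2 ⟨fun a ha => ?_, fun a ha => ?_⟩
  · obtain ⟨x, hax, hx⟩ := exists_between ha
    filter_upwards [hmain x _ hx (lt_add_one _)] with n hn
    exact hax.trans_le hn.1
  · obtain ⟨y, hy, hya⟩ := exists_between ha
    filter_upwards [hmain _ y (sub_one_lt _) hy] with n hn
    exact hn.2.trans_lt hya

/-- If monotone functions converge to `H` after an affine normalization, they do so after
normalization with their own quantiles. -/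
lemma tendstoUniformly_estimated_normalization {K : ℕ → ℝ → ℝ} {U V : ℕ → ℝ} (hU : ∀ n, 0 < U n)
    (hK : ∀ n, Monotone (K n)) (hK0 : ∀ n x, 0 ≤ K n x) (hK1 : ∀ n x, K n x ≤ 1)
    (hH : IsRegularCdf H) (h : ∀ x, Tendsto (fun n => K n (x / U n + V n)) atTop (𝓝 (H x)))
    {t₁ t₂ : ℝ} (ht₁ : 0 < t₁) (ht : t₁ < t₂) (ht₂ : t₂ < 1) :
    TendstoUniformly (fun n x => K n (estCenter (K n) + x / estScale (K n) t₁ t₂))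
      (fun x => H (genInv H (1 / 2) + (genInv H t₂ - genInv H t₁) * x)) atTop := by
  have hmono : ∀ n, Monotone fun x => K n (x / U n + V n) := by
    intro n x y hxy
    have := hU n
    exact hK n (by gcongr)
  have hunif : TendstoUniformly (fun n x => K n (x / U n + V n)) H atTop :=
    tendstoUniformly_of_monotone hmono (fun n x => hK0 n _) (fun n x => hK1 n _) hH.continuous
      hH.monotone hH.tendsto_atBot hH.tendsto_atTop h
  have hq := fun {t : ℝ} => tendsto_genInv (t := t) hU hK hH h
  have hC : 0 < genInv H t₂ - genInv H t₁ := sub_pos.2 (hH.genInv_lt_genInv ht₁ ht ht₂)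
  refine tendstoUniformly_of_monotone ?_ (fun n x => hK0 n _) (fun n x => hK1 n _) ?_ ?_ ?_ ?_ ?_
  · intro n x y hxy
    refine hK n ?_
    have : 0 ≤ estScale (K n) t₁ t₂ := inv_nonneg.2 (abs_nonneg _)
    gcongr
  · exact hH.continuous.comp (by fun_prop)
  · intro x y hxy
    exact hH.monotone (by gcongr)
  · exact hH.tendsto_atBot.comp (tendsto_atBot_add_const_left _ _ (tendsto_id.const_mul_atBot hC))
  · exact hH.tendsto_atTop.comp (tendsto_atTop_add_const_left _ _ (tendsto_id.const_mul_atTop hC))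
  · intro x
    set α : ℝ → ℕ → ℝ := fun t n => U n * (genInv (K n) t - V n) with hα
    -- In the coordinates of `U`, `V` the estimated normalization has coefficients converging to
    -- those of the limit. The identity also holds when the two quantiles coincide, since then
    -- `|0|⁻¹ = 0` and `x / 0 = 0`.
    have harg : ∀ n, estCenter (K n) + x / estScale (K n) t₁ t₂ =
        (α (1 / 2) n + |α t₂ n - α t₁ n| * x) / U n + V n := by
      intro n
      have hUn := hU n
      have h1 : α t₂ n - α t₁ n = U n * (genInv (K n) t₂ - genInv (K n) t₁) := by
        simp only [hα]; ring
      rw [h1, abs_mul, abs_of_pos hUn, estScale, div_inv_eq_mul, estCenter]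
      simp only [hα]
      field_simp
      ring
    simp only [harg]
    have hlim : Tendsto (fun n => α (1 / 2) n + |α t₂ n - α t₁ n| * x) atTop
        (𝓝 (genInv H (1 / 2) + (genInv H t₂ - genInv H t₁) * x)) := by
      have h2 := ((hq (ht₁.trans ht) ht₂).sub (hq ht₁ (ht.trans ht₂))).abs
      rw [abs_of_pos hC] at h2
      exact (hq (by norm_num) (by norm_num)).add (h2.mul_const x)
    exact hunif.tendsto_comp hH.continuous.continuousAt hlim

end LimitDistribution

/-! ### Consequences of stationarity for block maxima and marginals. -/

section Stationarity

variable {Ω : Type*} [MeasurableSpace Ω] {μ : Measure Ω} {X : ℤ → Ω → ℝ}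

lemma map_blockMax (hX : ∀ t, Measurable (X t)) (hstat : StrictlyStationary X μ) (s : ℤ) (m : ℕ) :
    μ.map (blockMax X s m) = μ.map (blockMax X 0 m) := by
  have h := hstat m (fun i => 0 + 1 + (i : ℕ)) s
  have hg : Measurable fun v : Fin m → ℝ => ⨆ i, v i := Measurable.iSup fun i => measurable_pi_apply i
  have h1 : ∀ t : Fin m → ℤ, Measurable fun ω i => X (t i) ω := fun t =>
    measurable_pi_lambda _ fun i => hX _
  have h2 := congrArg (Measure.map fun v : Fin m → ℝ => ⨆ i, v i) h
  rw [Measure.map_map hg (h1 fun i => 0 + 1 + (i : ℕ) + s), Measure.map_map hg (h1 _)] at h2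
  have e : blockMax X s m =
      (fun v : Fin m → ℝ => ⨆ i, v i) ∘ fun ω i => X (0 + 1 + (i : ℕ) + s) ω := by
    funext ω
    simp only [blockMax, Function.comp]
    congr 1
    funext k
    congr 1
    ring
  rw [e, h2]
  rfl

lemma map_apply_eq (hX : ∀ t, Measurable (X t)) (hstat : StrictlyStationary X μ) (t : ℤ) :
    μ.map (X t) = μ.map (X 0) := by
  have h := congrArg (Measure.map fun v : Fin 1 → ℝ => v 0) (hstat 1 (fun _ => 0) t)
  rw [Measure.map_map (measurable_pi_apply 0) (measurable_pi_lambda _ fun i => hX _),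
    Measure.map_map (measurable_pi_apply 0) (measurable_pi_lambda _ fun i => hX _)] at h
  have e : (fun v : Fin 1 → ℝ => v 0) ∘ (fun ω (_ : Fin 1) => X (0 + t) ω) = X t := by
    rw [zero_add]; rfl
  rw [e] at h
  exact h

lemma marginalCdf_le_one (w : ℝ) : marginalCdf X μ w ≤ 1 := cdf_le_one _ _

lemma marginalCdf_nonneg (w : ℝ) : 0 ≤ marginalCdf X μ w := cdf_nonneg _ _

lemma marginalCdf_mono : Monotone (marginalCdf X μ) := monotone_cdf _

variable [IsProbabilityMeasure μ]

lemma measureReal_le_eq_marginalCdf (hX : ∀ t, Measurable (X t)) (hstat : StrictlyStationary X μ)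
    (t : ℤ) (w : ℝ) : μ.real {ω | X t ω ≤ w} = marginalCdf X μ w := by
  have : IsProbabilityMeasure (μ.map (X 0)) := Measure.isProbabilityMeasure_map (hX 0).aemeasurable
  rw [marginalCdf, cdf_eq_real, ← map_apply_eq hX hstat t,
    map_measureReal_apply (hX t) measurableSet_Iic]
  rfl

lemma measureReal_gt_eq (hX : ∀ t, Measurable (X t)) (hstat : StrictlyStationary X μ)
    (t : ℤ) (w : ℝ) : μ.real {ω | w < X t ω} = 1 - marginalCdf X μ w := by
  rw [← measureReal_le_eq_marginalCdf hX hstat t w,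
    ← probReal_compl_eq_one_sub (measurableSet_le (hX t) measurable_const)]
  congr 1
  ext ω
  simp

lemma measureReal_Ioc_eq (hX : ∀ t, Measurable (X t)) (hstat : StrictlyStationary X μ)
    (t : ℤ) {w w' : ℝ} (hw : w ≤ w') :
    μ.real {ω | w < X t ω ∧ X t ω ≤ w'} = marginalCdf X μ w' - marginalCdf X μ w := by
  rw [← measureReal_le_eq_marginalCdf hX hstat t w, ← measureReal_le_eq_marginalCdf hX hstat t w',
    ← measureReal_sdiff (s₁ := {ω | X t ω ≤ w'}) (s₂ := {ω | X t ω ≤ w})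
      (fun ω (h : X t ω ≤ w) => h.trans hw) (measurableSet_le (hX t) measurable_const)]
  congr 1
  ext ω
  simp [and_comm]

end Stationarity

/-! ### Approximate independence of non-exceedance over separated blocks. -/

section NonExceedance

variable {Ω : Type*} [MeasurableSpace Ω] {μ : Measure Ω} {X : ℤ → Ω → ℝ}

/-- The probability that no observation with index in `A` exceeds the level `w`. -/
def nonExceed (X : ℤ → Ω → ℝ) (μ : Measure Ω) (A : Finset ℤ) (w : ℝ) : ℝ :=
  μ.real {ω | ∀ t ∈ A, X t ω ≤ w}

lemma measurableSet_nonExceed (hX : ∀ t, Measurable (X t)) (A : Finset ℤ) (w : ℝ) :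
    MeasurableSet {ω | ∀ t ∈ A, X t ω ≤ w} := by
  have : {ω | ∀ t ∈ A, X t ω ≤ w} = ⋂ t ∈ A, {ω | X t ω ≤ w} := by
    ext ω
    simp
  rw [this]
  exact Finset.measurableSet_biInter _ fun t _ => measurableSet_le (hX t) measurable_const

lemma nonExceed_Ioc (s : ℤ) {m : ℕ} (hm : 0 < m) (w : ℝ) :
    nonExceed X μ (Finset.Ioc s (s + m)) w = μ.real {ω | blockMax X s m ω ≤ w} := by
  unfold nonExceed
  congr 1
  ext ω
  simp only [Set.mem_ofPred_eq, blockMax_le_iff hm, Finset.mem_Ioc, and_imp]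

lemma nonExceed_Ioc_shift (hX : ∀ t, Measurable (X t)) (hstat : StrictlyStationary X μ) (s : ℤ)
    {m : ℕ} (hm : 0 < m) (w : ℝ) :
    nonExceed X μ (Finset.Ioc s (s + m)) w = μ.real {ω | blockMax X 0 m ω ≤ w} := by
  rw [nonExceed_Ioc s hm]
  have h := congrArg (fun ν : Measure ℝ => ν.real (Set.Iic w)) (map_blockMax hX hstat s m)
  rw [map_measureReal_apply (measurable_blockMax hX s m) measurableSet_Iic,
    map_measureReal_apply (measurable_blockMax hX 0 m) measurableSet_Iic] at h
  exact h

lemma nonExceed_nonneg (A : Finset ℤ) (w : ℝ) : 0 ≤ nonExceed X μ A w := measureReal_nonneg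

variable [IsProbabilityMeasure μ]

lemma nonExceed_le_one (A : Finset ℤ) (w : ℝ) : nonExceed X μ A w ≤ 1 := measureReal_le_one

lemma nonExceed_empty (w : ℝ) : nonExceed X μ ∅ w = 1 := by
  simp [nonExceed]

lemma nonExceed_anti {A B : Finset ℤ} (h : A ⊆ B) (w : ℝ) :
    nonExceed X μ B w ≤ nonExceed X μ A w :=
  measureReal_mono fun _ hω t ht => hω t (h ht)

/-- Union bound: if the level is respected on `A` but not on `B`, it is exceeded at some index of `B
\ A`. -/
lemma nonExceed_le_add_card_sdiff (hX : ∀ t, Measurable (X t)) (hstat : StrictlyStationary X μ)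
    (A B : Finset ℤ) (w : ℝ) :
    nonExceed X μ A w ≤ nonExceed X μ B w + (B \ A).card * (1 - marginalCdf X μ w) := by
  have hsub : {ω | ∀ t ∈ A, X t ω ≤ w} ⊆
      {ω | ∀ t ∈ B, X t ω ≤ w} ∪ ⋃ t ∈ B \ A, {ω | w < X t ω} := by
    intro ω hω
    by_cases h : ∀ t ∈ B, X t ω ≤ w
    · exact Or.inl h
    · push Not at h
      obtain ⟨t, ht, hlt⟩ := h
      refine Or.inr (Set.mem_iUnion₂.2 ⟨t, Finset.mem_sdiff.2 ⟨ht, fun hA => ?_⟩, hlt⟩)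
      exact absurd (hω t hA) (not_le.2 hlt)
  refine (measureReal_mono hsub).trans ((measureReal_union_le _ _).trans ?_)
  refine add_le_add le_rfl ((measureReal_biUnion_finset_le _ _).trans (le_of_eq ?_))
  simp only [measureReal_gt_eq hX hstat, Finset.sum_const, nsmul_eq_mul]

lemma nonExceed_level_sub_le (hX : ∀ t, Measurable (X t)) (hstat : StrictlyStationary X μ)
    (A : Finset ℤ) {w w' : ℝ} (hw : w ≤ w') :
    nonExceed X μ A w' ≤
      nonExceed X μ A w + A.card * (marginalCdf X μ w' - marginalCdf X μ w) := by
  have hsub : {ω | ∀ t ∈ A, X t ω ≤ w'} ⊆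
      {ω | ∀ t ∈ A, X t ω ≤ w} ∪ ⋃ t ∈ A, {ω | w < X t ω ∧ X t ω ≤ w'} := by
    intro ω hω
    by_cases h : ∀ t ∈ A, X t ω ≤ w
    · exact Or.inl h
    · push Not at h
      obtain ⟨t, ht, hlt⟩ := h
      exact Or.inr (Set.mem_iUnion₂.2 ⟨t, ht, hlt, hω t ht⟩)
  refine (measureReal_mono hsub).trans ((measureReal_union_le _ _).trans ?_)
  refine add_le_add le_rfl ((measureReal_biUnion_finset_le _ _).trans (le_of_eq ?_))
  simp only [measureReal_Ioc_eq hX hstat _ hw, Finset.sum_const, nsmul_eq_mul]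

/-- The smoothed indicator that the path does not exceed `w` on `A`. -/
def smoothNonExceed (A : Finset ℤ) (hA : A.Nonempty) (w h : ℝ) (x : ℤ → ℝ) : ℝ :=
  ramp ((A.sup' hA x - w) / h)

lemma sup'_sub_le {A : Finset ℤ} (hA : A.Nonempty) (x y : ℤ → ℝ) :
    A.sup' hA x - A.sup' hA y ≤ ∑ t ∈ A, |x t - y t| := by
  rw [sub_le_iff_le_add]
  refine Finset.sup'_le hA _ fun t ht => ?_
  have h1 := Finset.le_sup' y ht
  have h2 : |x t - y t| ≤ ∑ t ∈ A, |x t - y t| :=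
    Finset.single_le_sum (f := fun t => |x t - y t|) (fun _ _ => abs_nonneg _) ht
  linarith [le_abs_self (x t - y t)]

lemma abs_smoothNonExceed_sub_le {A : Finset ℤ} (hA : A.Nonempty) (w : ℝ) {h : ℝ} (hh : 0 < h)
    (x y : ℤ → ℝ) : |smoothNonExceed A hA w h x - smoothNonExceed A hA w h y| ≤
      1 / h * ∑ t ∈ A, |x t - y t| := by
  refine (abs_ramp_sub_le _ _).trans ?_
  rw [← sub_div, sub_sub_sub_cancel_right, abs_div, abs_of_pos hh, div_eq_inv_mul, one_div]
  refine mul_le_mul_of_nonneg_left (abs_sub_le_iff.2 ⟨sup'_sub_le hA x y, ?_⟩) (by positivity)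
  simp only [abs_sub_comm (x _)]
  exact sup'_sub_le hA y x

lemma measurable_smoothNonExceed (hX : ∀ t, Measurable (X t)) {A : Finset ℤ} (hA : A.Nonempty)
    (w h : ℝ) : Measurable fun ω => smoothNonExceed A hA w h fun t => X t ω := by
  unfold smoothNonExceed
  refine continuous_ramp.measurable.comp ((Measurable.sub_const ?_ w).div_const h)
  have e : (fun ω => A.sup' hA fun t => X t ω) = A.sup' hA X := by
    funext ω
    rw [Finset.sup'_apply]
  rw [e]
  exact Finset.measurable_sup' hA fun t _ => hX t

lemma measureReal_le_integral_le {f : Ω → ℝ} {E E' : Set Ω} (hf : Measurable f)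
    (hE : MeasurableSet E) (hE' : MeasurableSet E') (h0 : ∀ ω, 0 ≤ f ω) (h1 : ∀ ω, f ω ≤ 1)
    (hfE : ∀ ω ∈ E, f ω = 1) (hfE' : ∀ ω, ω ∉ E' → f ω = 0) :
    μ.real E ≤ ∫ ω, f ω ∂μ ∧ ∫ ω, f ω ∂μ ≤ μ.real E' := by
  have hint : Integrable f μ := integrable_of_abs_le hf (c := 1) fun ω => by
    rw [abs_of_nonneg (h0 ω)]
    exact h1 ω
  rw [← integral_indicator_one hE, ← integral_indicator_one hE']
  constructor
  · refine integral_mono ((integrable_const (1 : ℝ)).indicator hE) hint fun ω => ?_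
    by_cases h : ω ∈ E
    · simp [h, hfE ω h]
    · simpa [h] using h0 ω
  · refine integral_mono hint ((integrable_const (1 : ℝ)).indicator hE') fun ω => ?_
    by_cases h : ω ∈ E'
    · simpa [h] using h1 ω
    · simp [h, hfE' ω h]

lemma smoothNonExceed_of_le {A : Finset ℤ} (hA : A.Nonempty) {w h : ℝ} (hh : 0 < h) {x : ℤ → ℝ}
    (hx : ∀ t ∈ A, x t ≤ w) : smoothNonExceed A hA w h x = 1 :=
  ramp_of_nonpos (div_nonpos_of_nonpos_of_nonneg
    (sub_nonpos.2 (Finset.sup'_le hA x hx)) hh.le)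

lemma smoothNonExceed_of_not_le {A : Finset ℤ} (hA : A.Nonempty) {w h : ℝ} (hh : 0 < h)
    {x : ℤ → ℝ} (hx : ¬ ∀ t ∈ A, x t ≤ w + h) : smoothNonExceed A hA w h x = 0 := by
  push Not at hx
  obtain ⟨t, ht, hlt⟩ := hx
  refine ramp_of_one_le ?_
  rw [le_div_iff₀ hh]
  linarith [Finset.le_sup' x ht]

/-- Approximate independence of non-exceedance events over separated index sets. -/
lemma abs_nonExceed_union_sub_mul_le (hX : ∀ t, Measurable (X t)) (hstat : StrictlyStationary X μ)
    {κ c : ℝ} {l : ℕ} (hcov : CovBound X μ κ l c) {A B : Finset ℤ} (hA : A.Nonempty)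
    (hB : B.Nonempty) (hAB : ∀ a ∈ A, ∀ b ∈ B, a + l ≤ b) (w : ℝ) {h : ℝ} (hh : 0 < h) :
    |nonExceed X μ (A ∪ B) w - nonExceed X μ A w * nonExceed X μ B w| ≤
      c * (A.card * (1 / h) + B.card * (1 / h) + κ * (A.card * B.card * (1 / h) * (1 / h))) +
        (A.card + B.card) * (marginalCdf X μ (w + h) - marginalCdf X μ w) := by
  set f : Ω → ℝ := fun ω => smoothNonExceed A hA w h fun t => X t ω with hf
  set g : Ω → ℝ := fun ω => smoothNonExceed B hB w h fun t => X t ω with hg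
  have hfm : Measurable f := measurable_smoothNonExceed hX hA w h
  have hgm : Measurable g := measurable_smoothNonExceed hX hB w h
  have hf0 : ∀ ω, 0 ≤ f ω := fun ω => ramp_nonneg _
  have hg0 : ∀ ω, 0 ≤ g ω := fun ω => ramp_nonneg _
  have hf1 : ∀ ω, f ω ≤ 1 := fun ω => ramp_le_one _
  have hg1 : ∀ ω, g ω ≤ 1 := fun ω => ramp_le_one _
  have habs : ∀ x : ℝ, |ramp x| ≤ 1 := fun x => by
    rw [abs_of_nonneg (ramp_nonneg x)]
    exact ramp_le_one x
  have hV := hcov A B (smoothNonExceed A hA w h) (smoothNonExceed B hB w h) (1 / h) (1 / h) hA hB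
    hAB (by positivity) (by positivity) (fun x => habs _) (fun x => habs _)
    (abs_smoothNonExceed_sub_le hA w hh) (abs_smoothNonExceed_sub_le hB w hh)
  rw [covariance_eq_integral_sub hfm hgm (fun ω => habs _) (fun ω => habs _)] at hV
  -- The ramp lies between the indicators of non-exceedance of `w` and of `w + h`, so each
  -- replacement costs at most the cardinality times `F (w + h) - F w`.
  obtain ⟨a1, a2⟩ := measureReal_le_integral_le (μ := μ) hfm (measurableSet_nonExceed hX A w)
    (measurableSet_nonExceed hX A (w + h)) hf0 hf1
    (fun ω hω => smoothNonExceed_of_le hA hh hω) (fun ω hω => smoothNonExceed_of_not_le hA hh hω)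
  obtain ⟨b1, b2⟩ := measureReal_le_integral_le (μ := μ) hgm (measurableSet_nonExceed hX B w)
    (measurableSet_nonExceed hX B (w + h)) hg0 hg1
    (fun ω hω => smoothNonExceed_of_le hB hh hω) (fun ω hω => smoothNonExceed_of_not_le hB hh hω)
  obtain ⟨c1, c2⟩ := measureReal_le_integral_le (μ := μ) (f := fun ω => f ω * g ω) (hfm.mul hgm)
    (measurableSet_nonExceed hX (A ∪ B) w) (measurableSet_nonExceed hX (A ∪ B) (w + h))
    (fun ω => mul_nonneg (hf0 ω) (hg0 ω)) (fun ω => mul_le_one₀ (hf1 ω) (hg0 ω) (hg1 ω))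
    (fun ω hω => by
      have e1 : f ω = 1 := smoothNonExceed_of_le hA hh fun t ht =>
        hω t (Finset.mem_union_left _ ht)
      have e2 : g ω = 1 := smoothNonExceed_of_le hB hh fun t ht =>
        hω t (Finset.mem_union_right _ ht)
      rw [e1, e2, one_mul])
    (fun ω hω => by
      by_cases h1 : ∀ t ∈ A, X t ω ≤ w + h
      · have e2 : g ω = 0 := smoothNonExceed_of_not_le hB hh fun h2 => hω fun t ht =>
          (Finset.mem_union.1 ht).elim (h1 t) (h2 t)
        rw [e2, mul_zero]
      · have e1 : f ω = 0 := smoothNonExceed_of_not_le hA hh h1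
        rw [e1, zero_mul])
  have hle : w ≤ w + h := by linarith
  have a3 := nonExceed_level_sub_le hX hstat A hle (μ := μ)
  have b3 := nonExceed_level_sub_le hX hstat B hle (μ := μ)
  have c3 := nonExceed_level_sub_le hX hstat (A ∪ B) hle (μ := μ)
  set Q := marginalCdf X μ (w + h) - marginalCdf X μ w with hQ
  have hQ0 : 0 ≤ Q := sub_nonneg.2 (marginalCdf_mono hle)
  have hcardU : ((A ∪ B).card : ℝ) * Q ≤ (A.card + B.card) * Q := by
    gcongr
    exact_mod_cast Finset.card_union_le A B
  have pA0 := nonExceed_nonneg (X := X) (μ := μ) A w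
  have pA1 := nonExceed_le_one (X := X) (μ := μ) A w
  have pB0 := nonExceed_nonneg (X := X) (μ := μ) B w
  have ig1 : ∫ ω, g ω ∂μ ≤ 1 := b2.trans measureReal_le_one
  have ig0 : 0 ≤ ∫ ω, g ω ∂μ := integral_nonneg hg0
  change nonExceed X μ A w ≤ _ at a1
  change _ ≤ nonExceed X μ A (w + h) at a2
  change nonExceed X μ B w ≤ _ at b1
  change _ ≤ nonExceed X μ B (w + h) at b2
  change nonExceed X μ (A ∪ B) w ≤ _ at c1
  change _ ≤ nonExceed X μ (A ∪ B) (w + h) at c2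
  have hprod : (∫ ω, f ω ∂μ) * ∫ ω, g ω ∂μ ≤
      nonExceed X μ A w * nonExceed X μ B w + (A.card + B.card) * Q := by
    have e1 : (∫ ω, f ω ∂μ - nonExceed X μ A w) * ∫ ω, g ω ∂μ ≤ A.card * Q :=
      (mul_le_of_le_one_right (sub_nonneg.2 a1) ig1).trans (by linarith)
    have e2 : nonExceed X μ A w * (∫ ω, g ω ∂μ - nonExceed X μ B w) ≤ B.card * Q :=
      (mul_le_of_le_one_left (sub_nonneg.2 b1) pA1).trans (by linarith)
    linarith
  have hprod' : nonExceed X μ A w * nonExceed X μ B w ≤ (∫ ω, f ω ∂μ) * ∫ ω, g ω ∂μ :=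
    mul_le_mul a1 b1 pB0 (pA0.trans a1)
  rw [abs_le] at hV ⊢
  constructor <;> linarith [hV.1, hV.2]

/-- The union of the first `j` blocks of length `m` starting at multiples of `a`. -/
def blockUnion (a m j : ℕ) : Finset ℤ :=
  (Finset.range j).biUnion fun i => Finset.Ioc ((i * a : ℕ) : ℤ) ((i * a : ℕ) + m)

lemma blockUnion_succ (a m j : ℕ) :
    blockUnion a m (j + 1) = blockUnion a m j ∪ Finset.Ioc ((j * a : ℕ) : ℤ) ((j * a : ℕ) + m) := by
  rw [blockUnion, Finset.range_add_one, Finset.biUnion_insert, Finset.union_comm]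
  rfl

lemma card_blockUnion {a m : ℕ} (hm : m ≤ a) (j : ℕ) : (blockUnion a m j).card = j * m := by
  rw [blockUnion, Finset.card_biUnion]
  · simp
  · intro i _ i' _ hne
    rw [Function.onFun, Finset.disjoint_left]
    intro t ht ht'
    rw [Finset.mem_Ioc] at ht ht'
    rcases lt_or_gt_of_ne hne with h | h
    · have : (i + 1) * a ≤ i' * a := Nat.mul_le_mul_right a h
      rw [add_mul, one_mul] at this
      omega
    · have : (i' + 1) * a ≤ i * a := Nat.mul_le_mul_right a h
      rw [add_mul, one_mul] at this
      omega

lemma blockUnion_subset {a m j : ℕ} (hm : m ≤ a) :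
    blockUnion a m j ⊆ Finset.Ioc 0 ((j * a : ℕ) : ℤ) := by
  intro t ht
  obtain ⟨i, hi, ht⟩ := Finset.mem_biUnion.1 ht
  rw [Finset.mem_Ioc] at ht ⊢
  have : (i + 1) * a ≤ j * a := Nat.mul_le_mul_right a (Finset.mem_range.1 hi)
  rw [add_mul, one_mul] at this
  omega

/-- The blocks are split off one at a time. Each step adds one independence error, and earlier
errors are multiplied by a probability and so do not grow. -/
lemma abs_nonExceed_blockUnion_sub_pow_le (hX : ∀ t, Measurable (X t))
    (hstat : StrictlyStationary X μ) {κ c : ℝ} {l : ℕ} (hcov : CovBound X μ κ l c) (hκ : 0 ≤ κ)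
    (hc : 0 ≤ c) {a m n k : ℕ} (hm : 0 < m) (hma : m + l ≤ a) (hk : k * a ≤ n) (w : ℝ) {h : ℝ}
    (hh : 0 < h) (j : ℕ) (hj : j ≤ k) :
    |nonExceed X μ (blockUnion a m j) w - μ.real {ω | blockMax X 0 m ω ≤ w} ^ j| ≤
      j * (c * (n * (1 / h) + κ * (n * a * (1 / h) * (1 / h))) +
        n * (marginalCdf X μ (w + h) - marginalCdf X μ w)) := by
  set err := c * (n * (1 / h) + κ * (n * a * (1 / h) * (1 / h))) +
        n * (marginalCdf X μ (w + h) - marginalCdf X μ w) with herr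
  set β := μ.real {ω | blockMax X 0 m ω ≤ w} with hβ
  have hQ0 : 0 ≤ marginalCdf X μ (w + h) - marginalCdf X μ w :=
    sub_nonneg.2 (marginalCdf_mono (by linarith))
  have herr0 : 0 ≤ err := by positivity
  have hβ0 : 0 ≤ β := measureReal_nonneg
  have hβ1 : β ≤ 1 := measureReal_le_one
  induction j with
  | zero => simp [blockUnion, nonExceed_empty]
  | succ j ih =>
    have ih := ih (by omega)
    have hstep : |nonExceed X μ (blockUnion a m (j + 1)) w -
        nonExceed X μ (blockUnion a m j) w * β| ≤ err := by
      have hB : nonExceed X μ (Finset.Ioc ((j * a : ℕ) : ℤ) ((j * a : ℕ) + m)) w = β :=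
        nonExceed_Ioc_shift hX hstat _ hm w
      rw [blockUnion_succ]
      -- The first block has no predecessor: `CovBound` does not apply to an empty set, but the
      -- difference is exactly zero.
      rcases Nat.eq_zero_or_pos j with rfl | hj0
      · rw [hB.symm]
        simpa [blockUnion, nonExceed_empty] using herr0
      · have hcA := card_blockUnion (show m ≤ a by omega) j
        have hcB : (Finset.Ioc ((j * a : ℕ) : ℤ) ((j * a : ℕ) + m)).card = m := by simp
        have key := abs_nonExceed_union_sub_mul_le hX hstat hcov (A := blockUnion a m j)
          (B := Finset.Ioc ((j * a : ℕ) : ℤ) ((j * a : ℕ) + m))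
          (Finset.card_pos.1 (by rw [hcA]; positivity)) (Finset.card_pos.1 (by rwa [hcB]))
          (by
            intro s hs t ht
            obtain ⟨i, hi, hs⟩ := Finset.mem_biUnion.1 hs
            rw [Finset.mem_Ioc] at hs ht
            have : (i + 1) * a ≤ j * a := Nat.mul_le_mul_right a (Finset.mem_range.1 hi)
            rw [add_mul, one_mul] at this
            omega) w hh
        rw [hB, hcA, hcB] at key
        refine key.trans ?_
        have hn : (j + 1) * m ≤ n :=
          (Nat.mul_le_mul hj (by omega : m ≤ a)).trans hk
        have hn' : ((j * m : ℕ) : ℝ) + m ≤ n := by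
          rw [add_mul, one_mul] at hn
          exact_mod_cast hn
        have hm0 : (0 : ℝ) ≤ m := Nat.cast_nonneg m
        have hjm : ((j * m : ℕ) : ℝ) ≤ n := by linarith
        have hma' : (m : ℝ) ≤ a := by exact_mod_cast (by omega : m ≤ a)
        rw [herr, ← add_mul]
        gcongr
    have e : nonExceed X μ (blockUnion a m (j + 1)) w - β ^ (j + 1) =
        (nonExceed X μ (blockUnion a m (j + 1)) w - nonExceed X μ (blockUnion a m j) w * β) +
          (nonExceed X μ (blockUnion a m j) w - β ^ j) * β := by ring
    rw [e]
    refine (abs_add_le _ _).trans ?_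
    rw [abs_mul, abs_of_nonneg hβ0]
    have := mul_le_of_le_one_right (abs_nonneg (nonExceed X μ (blockUnion a m j) w - β ^ j)) hβ1
    push_cast
    linarith

lemma abs_pow_sub_pow_le {x y : ℝ} (hx : |x| ≤ 1) (hy : |y| ≤ 1) (k : ℕ) :
    |x ^ k - y ^ k| ≤ k * |x - y| := by
  have := abs_prod_sub_prod_le (Finset.range k) (f := fun _ => x) (g := fun _ => y)
    (fun _ => hx) (fun _ => hy)
  simpa using this

/-- Comparison of the maximum over a sample with independent maxima over blocks of length `a`. -/
lemma nonExceed_sample_bounds (hX : ∀ t, Measurable (X t)) (hstat : StrictlyStationary X μ)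
    {κ c : ℝ} {l : ℕ} (hcov : CovBound X μ κ l c) (hκ : 0 ≤ κ) (hc : 0 ≤ c) {a n k : ℕ}
    (hla : l < a) (hk : k * a ≤ n) (hn : 0 < n) (w : ℝ) {h : ℝ} (hh : 0 < h) :
    |μ.real {ω | blockMax X 0 n ω ≤ w} - μ.real {ω | blockMax X 0 a ω ≤ w} ^ k| ≤
      k * (c * (n * (1 / h) + κ * (n * a * (1 / h) * (1 / h))) +
        n * (marginalCdf X μ (w + h) - marginalCdf X μ w)) +
      (n - k * a + 2 * (k * l)) * (1 - marginalCdf X μ w) := by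
  -- Shortening the blocks to `m` leaves gaps of length `l`. The `k * l` deleted indices are paid
  -- for twice: once in passing from the sample to the short blocks, once in lengthening the blocks
  -- back to `a` inside the `k`-th power. The term `n - k * a` is the incomplete last block.
  set m := a - l with hm
  have hm0 : 0 < m := by omega
  have hma : m ≤ a := by omega
  have hF : 0 ≤ 1 - marginalCdf X μ w := sub_nonneg.2 (marginalCdf_le_one w)
  have hmid := abs_nonExceed_blockUnion_sub_pow_le hX hstat hcov hκ hc hm0 (by omega : m + l ≤ a)
    hk w hh k le_rfl
  have hsample : μ.real {ω | blockMax X 0 n ω ≤ w} = nonExceed X μ (Finset.Ioc 0 (n : ℤ)) w := by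
    rw [← nonExceed_Ioc 0 hn w, zero_add]
  have hblock : μ.real {ω | blockMax X 0 a ω ≤ w} = nonExceed X μ (Finset.Ioc 0 (a : ℤ)) w := by
    rw [← nonExceed_Ioc 0 (by omega : 0 < a) w, zero_add]
  have hsmall : μ.real {ω | blockMax X 0 m ω ≤ w} = nonExceed X μ (Finset.Ioc 0 (m : ℤ)) w := by
    rw [← nonExceed_Ioc 0 hm0 w, zero_add]
  have hsub : blockUnion a m k ⊆ Finset.Ioc 0 (n : ℤ) :=
    (blockUnion_subset hma).trans (Finset.Ioc_subset_Ioc_right (by exact_mod_cast hk))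
  have hmr : (m : ℝ) = a - l := by rw [hm, Nat.cast_sub hla.le]
  have s1 := nonExceed_anti (X := X) (μ := μ) hsub w
  have s2 := nonExceed_le_add_card_sdiff hX hstat (μ := μ) (blockUnion a m k)
    (Finset.Ioc 0 (n : ℤ)) w
  have hcard1 : ((Finset.Ioc 0 (n : ℤ) \ blockUnion a m k).card : ℝ) = n - k * a + k * l := by
    rw [Finset.card_sdiff_of_subset hsub, Nat.cast_sub (Finset.card_le_card hsub),
      card_blockUnion hma]
    push_cast
    simp only [Int.card_Ioc, sub_zero, Int.toNat_natCast, hmr]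
    ring
  have hsub' : Finset.Ioc 0 (m : ℤ) ⊆ Finset.Ioc 0 (a : ℤ) :=
    Finset.Ioc_subset_Ioc_right (by exact_mod_cast hma)
  have t1 := nonExceed_anti (X := X) (μ := μ) hsub' w
  have t2 := nonExceed_le_add_card_sdiff hX hstat (μ := μ) (Finset.Ioc 0 (m : ℤ))
    (Finset.Ioc 0 (a : ℤ)) w
  have hcard2 : ((Finset.Ioc 0 (a : ℤ) \ Finset.Ioc 0 (m : ℤ)).card : ℝ) = l := by
    rw [Finset.card_sdiff_of_subset hsub', Nat.cast_sub (Finset.card_le_card hsub')]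
    simp [hmr]
  rw [hcard1] at s2
  rw [hcard2] at t2
  rw [hsample, hblock]
  rw [hsmall] at hmid
  have habs : ∀ A : Finset ℤ, |nonExceed X μ A w| ≤ 1 := fun A => by
    rw [abs_of_nonneg (nonExceed_nonneg A w)]
    exact nonExceed_le_one A w
  have hpow := abs_pow_sub_pow_le (habs (Finset.Ioc 0 (m : ℤ))) (habs (Finset.Ioc 0 (a : ℤ))) k
  have hdiff : |nonExceed X μ (Finset.Ioc 0 (m : ℤ)) w - nonExceed X μ (Finset.Ioc 0 (a : ℤ)) w| ≤
      l * (1 - marginalCdf X μ w) := by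
    rw [abs_of_nonneg (sub_nonneg.2 t1)]
    linarith
  have hpow' := hpow.trans (mul_le_mul_of_nonneg_left hdiff (Nat.cast_nonneg k))
  rw [abs_le] at hmid hpow' ⊢
  constructor <;> linarith [hmid.1, hmid.2, hpow'.1, hpow'.2]

end NonExceedance

/-! ### Exponential limits, small increments and the choice of smoothing width. -/

section ExtremalIndex

lemma tendsto_one_sub_pow_exp {k : ℕ → ℕ} {z : ℕ → ℝ} {L : ℝ} (hk : Tendsto k atTop atTop)
    (hz : Tendsto (fun n => (k n : ℝ) * z n) atTop (𝓝 L)) :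
    Tendsto (fun n => (1 - z n) ^ k n) atTop (𝓝 (Real.exp (-L))) := by
  have hk' : Tendsto (fun n => (k n : ℝ)) atTop atTop := tendsto_natCast_atTop_atTop.comp hk
  have hz0 : Tendsto z atTop (𝓝 0) := by
    have h := hz.mul (tendsto_inv_atTop_zero.comp hk')
    rw [mul_zero] at h
    refine h.congr' ?_
    filter_upwards [hk'.eventually_gt_atTop 0] with n hn
    simp only [Function.comp]
    field_simp
  have hlog : Tendsto (fun n => (k n : ℝ) * Real.log (1 - z n)) atTop (𝓝 (-L)) := by
    have hlow : Tendsto (fun n => -(k n * z n) * (1 - z n)⁻¹) atTop (𝓝 (-L)) := by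
      have h := hz.neg.mul ((tendsto_const_nhds (x := (1 : ℝ)).sub hz0).inv₀ (by norm_num))
      simpa using h
    refine tendsto_of_tendsto_of_tendsto_of_le_of_le' hlow hz.neg ?_ ?_
    · filter_upwards [hz0.eventually_lt_const one_pos] with n hn
      have h1 : 0 < 1 - z n := by linarith
      have h2 := Real.one_sub_inv_le_log_of_pos h1
      calc -(k n * z n) * (1 - z n)⁻¹ = k n * (1 - (1 - z n)⁻¹) := by
            field_simp
            ring
        _ ≤ _ := by gcongr
    · filter_upwards [hz0.eventually_lt_const one_pos] with n hn
      have h1 : 0 < 1 - z n := by linarith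
      have h2 := Real.log_le_sub_one_of_pos h1
      calc (k n : ℝ) * Real.log (1 - z n) ≤ k n * (1 - z n - 1) := by gcongr
        _ = _ := by ring
  refine ((Real.continuous_exp.tendsto _).comp hlog).congr' ?_
  filter_upwards [hz0.eventually_lt_const one_pos] with n hn
  have h1 : 0 < 1 - z n := by linarith
  simp only [Function.comp]
  rw [mul_comm, Real.exp_mul, Real.exp_log h1, Real.rpow_natCast]

lemma tendsto_mul_one_sub_of_pow {q : ℕ → ℝ} {τ : ℝ} (hq0 : ∀ n, 0 ≤ q n)
    (h : Tendsto (fun n => q n ^ n) atTop (𝓝 (Real.exp (-τ)))) :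
    Tendsto (fun n : ℕ => (n : ℝ) * (1 - q n)) atTop (𝓝 τ) := by
  have hpos : ∀ᶠ n in atTop, 0 < q n := by
    filter_upwards [h.eventually_const_lt (Real.exp_pos _), eventually_ge_atTop 1] with n hn h1
    refine (hq0 n).lt_of_ne fun h0 => ?_
    rw [← h0, zero_pow (by omega)] at hn
    exact lt_irrefl _ hn
  have hlog : Tendsto (fun n : ℕ => (n : ℝ) * Real.log (q n)) atTop (𝓝 (-τ)) := by
    have h1 := h.log (Real.exp_pos _).ne'
    rw [Real.log_exp] at h1
    simpa only [Real.log_pow] using h1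
  have hq1 : Tendsto q atTop (𝓝 1) := by
    have h1 := hlog.mul tendsto_inv_atTop_nhds_zero_nat
    rw [mul_zero] at h1
    have h2 := (Real.continuous_exp.tendsto _).comp h1
    rw [Real.exp_zero] at h2
    refine h2.congr' ?_
    filter_upwards [hpos, eventually_ge_atTop 1] with n hn h1
    have hn0 : (n : ℝ) ≠ 0 := by positivity
    simp only [Function.comp]
    rw [mul_comm, inv_mul_cancel_left₀ hn0, Real.exp_log hn]
  have hup : Tendsto (fun n : ℕ => -((n : ℝ) * Real.log (q n))) atTop (𝓝 τ) := by
    simpa using hlog.neg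
  have hlow : Tendsto (fun n : ℕ => q n * -((n : ℝ) * Real.log (q n))) atTop (𝓝 τ) := by
    simpa using hq1.mul hup
  refine tendsto_of_tendsto_of_tendsto_of_le_of_le' hlow hup ?_ ?_
  · filter_upwards [hpos] with n hn
    have h2 := Real.one_sub_inv_le_log_of_pos hn
    calc q n * -((n : ℝ) * Real.log (q n)) = n * (q n * -Real.log (q n)) := by ring
      _ ≤ n * (q n * -(1 - (q n)⁻¹)) := by gcongr
      _ = n * (1 - q n) := by
        field_simp
        ring
  · filter_upwards [hpos] with n hn
    have h2 := Real.log_le_sub_one_of_pos hn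
    calc (n : ℝ) * (1 - q n) ≤ n * -Real.log (q n) := by gcongr; linarith
      _ = _ := by ring

/-- A monotone function has a small increment somewhere on an interval. -/
lemma exists_small_increment {T : ℝ → ℝ} (hT : Monotone T) (y : ℝ) {s ρ : ℝ} (hs : 0 < s)
    (hsρ : s ≤ ρ) :
    ∃ z ∈ Set.Icc y (y + ρ), T (z + s) - T z ≤ 2 * (s / ρ) * (T (y + ρ) - T y) := by
  have hρ : 0 < ρ := hs.trans_le hsρ
  -- `J` adjacent intervals of length `s` fit into `[y, y + ρ]`, and one of them carries at most the
  -- average increment. The constant `2` comes from `J ≥ ρ / (2 s)`.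
  set J := ⌊ρ / s⌋₊ with hJ
  have hJ1 : 1 ≤ J := (Nat.one_le_floor_iff _).2 (by rwa [le_div_iff₀ hs, one_mul])
  have hJ1' : (1 : ℝ) ≤ J := by exact_mod_cast hJ1
  have hJle : (J : ℝ) * s ≤ ρ := by
    rw [← le_div_iff₀ hs]
    exact Nat.floor_le (by positivity)
  have hJge : ρ ≤ 2 * J * s := by
    have h1 := (Nat.lt_floor_add_one (ρ / s)).le
    rw [div_le_iff₀ hs] at h1
    nlinarith
  have hsum : ∑ i ∈ Finset.range J, (T (y + (i : ℕ) * s + s) - T (y + (i : ℕ) * s)) ≤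
      ∑ i ∈ Finset.range J, (T (y + ρ) - T y) / J := by
    have e : ∀ i : ℕ, T (y + (i : ℕ) * s + s) = T (y + ((i + 1 : ℕ) : ℝ) * s) := fun i => by
      congr 1
      push_cast
      ring
    simp only [e]
    rw [Finset.sum_range_sub fun i : ℕ => T (y + (i : ℝ) * s), Finset.sum_const, Finset.card_range,
      nsmul_eq_mul, mul_div_cancel₀ _ (by positivity)]
    have : T (y + J * s) ≤ T (y + ρ) := hT (by linarith)
    simpa using this
  obtain ⟨i, hi, hle⟩ := Finset.exists_le_of_sum_le (Finset.nonempty_range_iff.2 (by omega)) hsum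
  rw [Finset.mem_range] at hi
  have hi' : (i : ℝ) ≤ J := by exact_mod_cast hi.le
  refine ⟨y + i * s, ⟨by nlinarith [(Nat.cast_nonneg i : (0 : ℝ) ≤ i)], by nlinarith⟩,
    hle.trans ?_⟩
  have h0 : 0 ≤ T (y + ρ) - T y := sub_nonneg.2 (hT (by linarith))
  rw [div_eq_inv_mul]
  refine mul_le_mul_of_nonneg_right ?_ h0
  rw [← mul_div_assoc, inv_le_iff_one_le_mul₀ (by positivity), div_mul_eq_mul_div, le_div_iff₀ hρ]
  linarith

variable {Ω : Type*} [MeasurableSpace Ω] {μ : Measure Ω} {X : ℤ → Ω → ℝ}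

lemma tendsto_div_mul_tiny {a : ℕ → ℕ} (ha : ∀ n, 0 < a n) :
    Tendsto (fun n : ℕ => (n : ℝ) / a n * (1 / ((n : ℝ) + 1) ^ 2)) atTop (𝓝 0) := by
  refine squeeze_zero (fun n => by positivity) (fun n => ?_)
    (tendsto_one_div_add_atTop_nhds_zero_nat (𝕜 := ℝ))
  have h1 : (n : ℝ) / a n ≤ n := div_le_self (Nat.cast_nonneg n) (by exact_mod_cast ha n)
  calc (n : ℝ) / a n * (1 / ((n : ℝ) + 1) ^ 2) ≤ ((n : ℝ) + 1) * (1 / ((n : ℝ) + 1) ^ 2) := by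
        gcongr
        linarith
    _ = 1 / ((n : ℝ) + 1) := by
        field_simp

/-- An infinite coefficient would make the mixing expression infinite, so its convergence to zero
forces the coefficients to be eventually finite. -/
lemma eventually_ne_top_of_tendsto {f g : ℕ → ℝ≥0∞} (h : Tendsto f atTop (𝓝 0))
    (hg : ∀ᶠ n in atTop, g n = ⊤ → f n = ⊤) : ∀ᶠ n in atTop, g n ≠ ⊤ := by
  filter_upwards [hg, h.eventually_lt_const ENNReal.zero_lt_top] with n h1 h2 h3
  exact h2.ne (h1 h3)

/-- The mixing condition provides smoothing widths for which all errors vanish. -/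
lemma ExtremalMixing.exists_width [IsProbabilityMeasure μ] {u : ℕ → ℝ} (hu : ∀ n, 0 < u n)
    {a l : ℕ → ℕ} (ha : ∀ n, 0 < a n) (hmix : ExtremalMixing X μ u a l) :
    ∃ (κ : ℝ) (s c : ℕ → ℝ), 0 ≤ κ ∧ (∀ n, 0 < s n) ∧ (∀ n, 0 ≤ c n) ∧
      (∀ᶠ n in atTop, CovBound X μ κ (l n) (c n)) ∧
      Tendsto (fun n : ℕ => (n : ℝ) / a n * s n) atTop (𝓝 0) ∧
      Tendsto (fun n : ℕ => (n : ℝ) / a n * (c n * (n * (1 / (s n / u n)) +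
        κ * (n * a n * (1 / (s n / u n)) * (1 / (s n / u n)))))) atTop (𝓝 0) := by
  have hpos : ∀ᶠ n : ℕ in atTop, 0 < n := eventually_gt_atTop 0
  have htiny : ∀ n : ℕ, (0 : ℝ) < 1 / ((n : ℝ) + 1) ^ 2 := fun n => by positivity
  rcases hmix with ⟨-, h⟩ | ⟨-, h⟩
  · set q : ℕ → ℝ := fun n => (etaCoeff X μ (l n)).toReal with hq
    have hq0 : ∀ n, 0 ≤ q n := fun n => ENNReal.toReal_nonneg
    set r : ℕ → ℝ := fun n => ((n : ℝ) * q n * u n) ^ (1 / 2 : ℝ) with hr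
    have hr0 : ∀ n, 0 ≤ r n := fun n => by have := hq0 n; have := hu n; positivity
    have hrsq : ∀ n, r n ^ 2 = n * q n * u n := fun n => by
      rw [hr, ← Real.rpow_natCast, ← Real.rpow_mul (by have := hq0 n; have := hu n; positivity)]
      norm_num
    have hrlim : Tendsto (fun n : ℕ => (n : ℝ) / a n * r n) atTop (𝓝 0) := by
      have h1 := (ENNReal.tendsto_toReal ENNReal.zero_ne_top).comp h
      refine h1.congr fun n => ?_
      have := (hu n).le
      simp only [Function.comp, ENNReal.toReal_mul, ← ENNReal.toReal_rpow, ENNReal.toReal_natCast,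
        ENNReal.toReal_ofReal this]
      rw [ENNReal.toReal_ofReal (by positivity)]
    have hfin : ∀ᶠ n in atTop, etaCoeff X μ (l n) ≠ ⊤ := by
      refine eventually_ne_top_of_tendsto h (hpos.mono fun n hn htop => ?_)
      have h1 : ENNReal.ofReal ((n : ℝ) / a n) ≠ 0 := by
        rw [Ne, ENNReal.ofReal_eq_zero, not_le]
        have := ha n
        positivity
      have h2 : ENNReal.ofReal (u n) ≠ 0 := by
        rw [Ne, ENNReal.ofReal_eq_zero, not_le]
        exact hu n
      rw [htop, ENNReal.mul_top (by exact_mod_cast hn.ne'), ENNReal.top_mul h2,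
        ENNReal.top_rpow_of_pos (by norm_num), ENNReal.mul_top h1]
    -- The independence error is of order `r ^ 2 / s` and the smoothing error of order `s`, so `s =
    -- r` balances them. The added `1 / (n + 1) ^ 2` keeps the width positive when `r n = 0` and is
    -- negligible even after multiplication by `n / a n`.
    refine ⟨0, fun n => r n + 1 / ((n : ℝ) + 1) ^ 2, fun n => 4 * q n, le_rfl,
      fun n => add_pos_of_nonneg_of_pos (hr0 n) (htiny n), fun n => by have := hq0 n; positivity,
      hfin.mono fun n hn => covBound_eta hn, ?_, ?_⟩
    · simp only [mul_add]
      simpa using hrlim.add (tendsto_div_mul_tiny ha)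
    · refine squeeze_zero (fun n => ?_) (fun n => ?_) (by simpa using hrlim.const_mul 4)
      · have := hq0 n; have := hr0 n; have := hu n
        positivity
      · have hs : 0 < r n + 1 / ((n : ℝ) + 1) ^ 2 := add_pos_of_nonneg_of_pos (hr0 n) (htiny n)
        have key : 4 * q n * (n * (1 / ((r n + 1 / ((n : ℝ) + 1) ^ 2) / u n)) + 0 * (n * a n *
            (1 / ((r n + 1 / ((n : ℝ) + 1) ^ 2) / u n)) *
            (1 / ((r n + 1 / ((n : ℝ) + 1) ^ 2) / u n)))) ≤ 4 * r n := by
          have e : 4 * q n * (n * (1 / ((r n + 1 / ((n : ℝ) + 1) ^ 2) / u n)) + 0 * (n * a n *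
            (1 / ((r n + 1 / ((n : ℝ) + 1) ^ 2) / u n)) *
            (1 / ((r n + 1 / ((n : ℝ) + 1) ^ 2) / u n)))) =
            4 * r n ^ 2 / (r n + 1 / ((n : ℝ) + 1) ^ 2) := by
            rw [hrsq, one_div_div]
            ring
          rw [e, div_le_iff₀ hs]
          nlinarith [hr0 n, mul_nonneg (hr0 n) (htiny n).le]
        calc _ ≤ (n : ℝ) / a n * (4 * r n) := mul_le_mul_of_nonneg_left key (by positivity)
          _ = _ := by ring
  · set q : ℕ → ℝ := fun n => (lambdaCoeff X μ (l n)).toReal with hq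
    have hq0 : ∀ n, 0 ≤ q n := fun n => ENNReal.toReal_nonneg
    set r₁ : ℕ → ℝ := fun n => ((n : ℝ) * q n * u n) ^ (1 / 2 : ℝ) with hr₁
    set r₂ : ℕ → ℝ := fun n => ((n : ℝ) * a n * q n * u n ^ 2) ^ (1 / 3 : ℝ) with hr₂
    have hr₁0 : ∀ n, 0 ≤ r₁ n := fun n => by have := hq0 n; have := hu n; positivity
    have hr₂0 : ∀ n, 0 ≤ r₂ n := fun n => by have := hq0 n; have := hu n; positivity
    have hrsq : ∀ n, r₁ n ^ 2 = n * q n * u n := fun n => by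
      rw [hr₁, ← Real.rpow_natCast, ← Real.rpow_mul (by have := hq0 n; have := hu n; positivity)]
      norm_num
    have hrcube : ∀ n, r₂ n ^ 3 = n * a n * q n * u n ^ 2 := fun n => by
      rw [hr₂, ← Real.rpow_natCast, ← Real.rpow_mul (by have := hq0 n; have := hu n; positivity)]
      norm_num
    have h₁ : Tendsto (fun n : ℕ => ENNReal.ofReal ((n : ℝ) / a n) *
        ((n : ℝ≥0∞) * lambdaCoeff X μ (l n) * ENNReal.ofReal (u n)) ^ (1 / 2 : ℝ)) atTop (𝓝 0) :=
      tendsto_of_tendsto_of_tendsto_of_le_of_le tendsto_const_nhds h (fun _ => zero_le)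
        fun n => by dsimp only; gcongr; exact le_max_left _ _
    have h₂ : Tendsto (fun n : ℕ => ENNReal.ofReal ((n : ℝ) / a n) *
        ((n : ℝ≥0∞) * (a n : ℝ≥0∞) * lambdaCoeff X μ (l n) * ENNReal.ofReal (u n ^ 2))
          ^ (1 / 3 : ℝ)) atTop (𝓝 0) :=
      tendsto_of_tendsto_of_tendsto_of_le_of_le tendsto_const_nhds h (fun _ => zero_le)
        fun n => by dsimp only; gcongr; exact le_max_right _ _
    have hrlim₁ : Tendsto (fun n : ℕ => (n : ℝ) / a n * r₁ n) atTop (𝓝 0) := by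
      have h1 := (ENNReal.tendsto_toReal ENNReal.zero_ne_top).comp h₁
      refine h1.congr fun n => ?_
      have := (hu n).le
      simp only [Function.comp, ENNReal.toReal_mul, ← ENNReal.toReal_rpow, ENNReal.toReal_natCast,
        ENNReal.toReal_ofReal this]
      rw [ENNReal.toReal_ofReal (by positivity)]
    have hrlim₂ : Tendsto (fun n : ℕ => (n : ℝ) / a n * r₂ n) atTop (𝓝 0) := by
      have h1 := (ENNReal.tendsto_toReal ENNReal.zero_ne_top).comp h₂
      refine h1.congr fun n => ?_
      have := (hu n).le
      simp only [Function.comp, ENNReal.toReal_mul, ← ENNReal.toReal_rpow, ENNReal.toReal_natCast,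
        ENNReal.toReal_ofReal (pow_nonneg this 2)]
      rw [ENNReal.toReal_ofReal (by positivity)]
    have hfin : ∀ᶠ n in atTop, lambdaCoeff X μ (l n) ≠ ⊤ := by
      refine eventually_ne_top_of_tendsto h₁ (hpos.mono fun n hn htop => ?_)
      have h1 : ENNReal.ofReal ((n : ℝ) / a n) ≠ 0 := by
        rw [Ne, ENNReal.ofReal_eq_zero, not_le]
        have := ha n
        positivity
      have h2 : ENNReal.ofReal (u n) ≠ 0 := by
        rw [Ne, ENNReal.ofReal_eq_zero, not_le]
        exact hu n
      rw [htop, ENNReal.mul_top (by exact_mod_cast hn.ne'), ENNReal.top_mul h2,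
        ENNReal.top_rpow_of_pos (by norm_num), ENNReal.mul_top h1]
    have hs : ∀ n : ℕ, 0 < r₁ n + r₂ n + 1 / ((n : ℝ) + 1) ^ 2 := fun n =>
      add_pos_of_nonneg_of_pos (add_nonneg (hr₁0 n) (hr₂0 n)) (htiny n)
    -- Now there are two independence errors, `r₁ ^ 2 / s` and `r₂ ^ 3 / s ^ 2`; they are at most
    -- `r₁` and `r₂` because `s` dominates both.
    refine ⟨1, fun n => r₁ n + r₂ n + 1 / ((n : ℝ) + 1) ^ 2, fun n => 4 * q n, zero_le_one,
      hs, fun n => by have := hq0 n; positivity,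
      hfin.mono fun n hn => covBound_lambda hn, ?_, ?_⟩
    · simp only [mul_add]
      simpa using (hrlim₁.add hrlim₂).add (tendsto_div_mul_tiny ha)
    · refine squeeze_zero (fun n => ?_) (fun n => ?_)
        (by simpa using (hrlim₁.add hrlim₂).const_mul 4)
      · have := hq0 n; have := hr₁0 n; have := hr₂0 n; have := hu n
        positivity
      · set s := r₁ n + r₂ n + 1 / ((n : ℝ) + 1) ^ 2 with hsdef
        have hs0 : 0 < s := hs n
        have hs1 : r₁ n ≤ s := by linarith [hr₂0 n, htiny n]
        have hs2 : r₂ n ≤ s := by linarith [hr₁0 n, htiny n]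
        have key : 4 * q n * (n * (1 / (s / u n)) + 1 * (n * a n *
            (1 / (s / u n)) * (1 / (s / u n)))) ≤ 4 * (r₁ n + r₂ n) := by
          have e : 4 * q n * (n * (1 / (s / u n)) + 1 * (n * a n *
            (1 / (s / u n)) * (1 / (s / u n)))) =
            4 * (r₁ n ^ 2 / s + r₂ n ^ 3 / s ^ 2) := by
            rw [hrsq, hrcube, one_div_div]
            ring_nf
          have e1 : r₁ n ^ 2 / s ≤ r₁ n := by
            rw [div_le_iff₀ hs0, sq]
            exact mul_le_mul_of_nonneg_left hs1 (hr₁0 n)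
          have e2 : r₂ n ^ 3 / s ^ 2 ≤ r₂ n := by
            rw [div_le_iff₀ (by positivity), pow_succ']
            exact mul_le_mul_of_nonneg_left (pow_le_pow_left₀ (hr₂0 n) hs2 2) (hr₂0 n)
          rw [e]
          linarith
        calc _ ≤ (n : ℝ) / a n * (4 * (r₁ n + r₂ n)) :=
              mul_le_mul_of_nonneg_left key (by positivity)
          _ = _ := by ring

end ExtremalIndex

/-! ### Limit law of the maximum with extremal index `θ`. -/

section MaximaLimit

variable {Ω : Type*} [MeasurableSpace Ω] {μ : Measure Ω} {X : ℤ → Ω → ℝ}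

/-- The distribution function of the maximum of the first `n` observations. -/
def maxCdf (X : ℤ → Ω → ℝ) (μ : Measure Ω) (n : ℕ) (w : ℝ) : ℝ := μ.real {ω | blockMax X 0 n ω ≤ w}

lemma maxCdf_nonneg (n : ℕ) (w : ℝ) : 0 ≤ maxCdf X μ n w := measureReal_nonneg

lemma normLevel_mono {u : ℕ → ℝ} (hu : ∀ n, 0 < u n) (v : ℕ → ℝ) (n : ℕ) :
    Monotone (normLevel u v n) := by
  intro x y hxy
  have := hu n
  unfold normLevel
  gcongr

lemma tendsto_div_atTop_of_isLittleO {a : ℕ → ℕ} (ha : ∀ n, 0 < a n)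
    (han : (fun n => (a n : ℝ)) =o[atTop] (fun n : ℕ => (n : ℝ))) :
    Tendsto (fun n => n / a n) atTop atTop := by
  have h1 : Tendsto (fun n : ℕ => (a n : ℝ) / n) atTop (𝓝[>] 0) := by
    refine tendsto_nhdsWithin_iff.2 ⟨han.tendsto_div_nhds_zero, ?_⟩
    filter_upwards [eventually_gt_atTop 0] with n hn
    have := ha n
    exact Set.mem_Ioi.2 (by positivity)
  have h2 := tendsto_inv_nhdsGT_zero.comp h1
  refine ((tendsto_nat_floor_atTop (α := ℝ)).comp h2).congr fun n => ?_
  simp only [Function.comp, inv_div]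
  exact Nat.floor_div_eq_div n (a n)

variable [IsProbabilityMeasure μ]

lemma maxCdf_le_one (n : ℕ) (w : ℝ) : maxCdf X μ n w ≤ 1 := measureReal_le_one

lemma maxCdf_mono (n : ℕ) : Monotone (maxCdf X μ n) := fun _ _ hw =>
  measureReal_mono fun _ hω => le_trans hω hw

/-- With `k = n / a`, the number `k P(M_a > w)` is the product of `k a / n → 1`, of the ratio
defining `θ`, and of `n (1 - F(w)) → τ`. -/
lemma tendsto_maxCdf_pow (hX : ∀ t, Measurable (X t)) {u v : ℕ → ℝ} {a : ℕ → ℕ}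
    (ha : ∀ n, 0 < a n) (han : (fun n => (a n : ℝ)) =o[atTop] (fun n : ℕ => (n : ℝ)))
    {θ τ y : ℝ} (hτ : 0 < τ)
    (htail : Tendsto (fun n : ℕ => (n : ℝ) * (1 - marginalCdf X μ (normLevel u v n y))) atTop (𝓝 τ))
    (hindex : Tendsto (fun n : ℕ => μ.real {ω | normLevel u v n y < blockMax X 0 (a n) ω}
      / ((a n : ℝ) * (1 - marginalCdf X μ (normLevel u v n y)))) atTop (𝓝 θ)) :
    Tendsto (fun n => maxCdf X μ (a n) (normLevel u v n y) ^ (n / a n)) atTop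
      (𝓝 (Real.exp (-(θ * τ)))) := by
  have hk := tendsto_div_atTop_of_isLittleO ha han
  have hcompl : ∀ n, maxCdf X μ (a n) (normLevel u v n y) =
      1 - μ.real {ω | normLevel u v n y < blockMax X 0 (a n) ω} := by
    intro n
    rw [maxCdf, ← probReal_compl_eq_one_sub
      (measurableSet_lt measurable_const (measurable_blockMax hX _ _))]
    congr 1
    ext ω
    simp
  simp only [hcompl]
  refine tendsto_one_sub_pow_exp hk ?_
  have hratio : Tendsto (fun n : ℕ => ((n / a n : ℕ) : ℝ) * a n / n) atTop (𝓝 1) := by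
    have h0 : Tendsto (fun n : ℕ => 1 - (a n : ℝ) / n) atTop (𝓝 1) := by
      simpa using (tendsto_const_nhds (x := (1 : ℝ))).sub han.tendsto_div_nhds_zero
    refine tendsto_of_tendsto_of_tendsto_of_le_of_le' h0 tendsto_const_nhds ?_ ?_
    · filter_upwards [eventually_gt_atTop 0] with n hn
      have hn' : (0 : ℝ) < n := by exact_mod_cast hn
      rw [one_sub_div hn'.ne']
      gcongr
      have := (Nat.lt_div_mul_add (a := n) (ha n)).le
      have h2 : (n : ℝ) ≤ ((n / a n : ℕ) : ℝ) * a n + a n := by exact_mod_cast this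
      linarith
    · filter_upwards with n
      refine div_le_one_of_le₀ ?_ (Nat.cast_nonneg n)
      exact_mod_cast Nat.div_mul_le_self n (a n)
  have hprod := (hratio.mul hindex).mul htail
  rw [one_mul] at hprod
  refine hprod.congr' ?_
  filter_upwards [eventually_gt_atTop 0, htail.eventually_const_lt hτ] with n hn hpos
  have hn' : (n : ℝ) ≠ 0 := by positivity
  have ha' : (a n : ℝ) ≠ 0 := by have := ha n; positivity
  have hF : 1 - marginalCdf X μ (normLevel u v n y) ≠ 0 := right_ne_zero_of_mul hpos.ne'
  field_simp

/-- The block approximation is proved only at some level `z` in `[y, y + ρ]`, chosen so that `F`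
hardly increases over the smoothing width there. All errors are controlled by the tail at `y`, so
`R` does not depend on `z`. -/
lemma exists_level_maxCdf_close (hX : ∀ t, Measurable (X t)) (hstat : StrictlyStationary X μ)
    {u v : ℕ → ℝ} (hu : ∀ n, 0 < u n) {a l : ℕ → ℕ} (ha : ∀ n, 0 < a n)
    (han : (fun n => (a n : ℝ)) =o[atTop] (fun n : ℕ => (n : ℝ)))
    (hla : (fun n => (l n : ℝ)) =o[atTop] (fun n => (a n : ℝ)))
    (hmix : ExtremalMixing X μ u a l) {y τ : ℝ}
    (htail : Tendsto (fun n : ℕ => (n : ℝ) * (1 - marginalCdf X μ (normLevel u v n y))) atTop (𝓝 τ))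
    {ρ : ℝ} (hρ : 0 < ρ) :
    ∃ R : ℕ → ℝ, Tendsto R atTop (𝓝 0) ∧ ∀ᶠ n in atTop, ∃ z ∈ Set.Icc y (y + ρ),
      |maxCdf X μ n (normLevel u v n z) - maxCdf X μ (a n) (normLevel u v n z) ^ (n / a n)|
        ≤ R n := by
  obtain ⟨κ, s, c, hκ, hs, hc, hcov, hks, hkc⟩ := hmix.exists_width hu ha
  set T : ℕ → ℝ := fun n => (n : ℝ) * (1 - marginalCdf X μ (normLevel u v n y)) with hTdef
  have hla' := hla.tendsto_div_nhds_zero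
  have han' := han.tendsto_div_nhds_zero
  have hk := tendsto_div_atTop_of_isLittleO ha han
  have hs0 : Tendsto s atTop (𝓝 0) := by
    refine squeeze_zero' (Eventually.of_forall fun n => (hs n).le) ?_ hks
    filter_upwards [hk.eventually_ge_atTop 1] with n hn
    have h1 : (1 : ℝ) ≤ (n : ℝ) / a n := by
      refine le_trans ?_ (Nat.cast_div_le (m := n) (n := a n))
      exact_mod_cast hn
    exact le_mul_of_one_le_left (hs n).le h1
  refine ⟨fun n => (n : ℝ) / a n * (c n * (n * (1 / (s n / u n)) +
      κ * (n * a n * (1 / (s n / u n)) * (1 / (s n / u n))))) +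
      2 / ρ * ((n : ℝ) / a n * s n) * T n + ((a n : ℝ) / n + 2 * ((l n : ℝ) / a n)) * T n, ?_, ?_⟩
  · have := (hkc.add ((hks.const_mul (2 / ρ)).mul htail)).add
      ((han'.add (hla'.const_mul 2)).mul htail)
    simpa using this
  filter_upwards [hcov, hs0.eventually_le_const hρ, hla'.eventually_lt_const one_pos,
    eventually_gt_atTop 0] with n hcovn hsn hln hn
  have hn' : (0 : ℝ) < n := by exact_mod_cast hn
  have ha' : (0 : ℝ) < a n := by exact_mod_cast ha n
  have hun := hu n
  have hlan : l n < a n := by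
    rw [div_lt_one ha'] at hln
    exact_mod_cast hln
  -- The increment of `n F` over the width `s` is then at most `2 * (s / ρ) * T n`. Summed over at
  -- most `n / a` blocks it still tends to zero, because `n / a * s` does.
  obtain ⟨z, hz, hinc⟩ := exists_small_increment
    (T := fun x => (n : ℝ) * marginalCdf X μ (normLevel u v n x))
    (fun x x' hx => mul_le_mul_of_nonneg_left
      (marginalCdf_mono (normLevel_mono hu v n hx)) hn'.le) y (hs n) hsn
  refine ⟨z, hz, ?_⟩
  have hmain := nonExceed_sample_bounds hX hstat hcovn hκ (hc n) hlan (Nat.div_mul_le_self n (a n))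
    hn (normLevel u v n z) (div_pos (hs n) hun)
  refine hmain.trans ?_
  have hlev : normLevel u v n z + s n / u n = normLevel u v n (z + s n) := by
    simp only [normLevel]
    ring
  rw [hlev]
  have hkle : ((n / a n : ℕ) : ℝ) ≤ (n : ℝ) / a n := Nat.cast_div_le
  have hFz : 1 - marginalCdf X μ (normLevel u v n z) ≤ 1 - marginalCdf X μ (normLevel u v n y) := by
    have := marginalCdf_mono (X := X) (μ := μ) (normLevel_mono hu v n hz.1)
    linarith
  have hF0 : 0 ≤ 1 - marginalCdf X μ (normLevel u v n y) := sub_nonneg.2 (marginalCdf_le_one _)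
  have hT0 : 0 ≤ T n := mul_nonneg hn'.le hF0
  have hincT : (n : ℝ) * (marginalCdf X μ (normLevel u v n (z + s n)) -
      marginalCdf X μ (normLevel u v n z)) ≤ 2 * (s n / ρ) * T n := by
    rw [mul_sub]
    refine hinc.trans (mul_le_mul_of_nonneg_left ?_ (by have := hs n; positivity))
    rw [← mul_sub]
    refine mul_le_mul_of_nonneg_left ?_ hn'.le
    linarith [marginalCdf_le_one (X := X) (μ := μ) (normLevel u v n (y + ρ))]
  have hsn0 := hs n
  have hcn := hc n
  refine add_le_add ?_ ?_
  · calc _ ≤ (n : ℝ) / a n * (c n * (n * (1 / (s n / u n)) +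
          κ * (n * a n * (1 / (s n / u n)) * (1 / (s n / u n)))) + 2 * (s n / ρ) * T n) := by
          refine mul_le_mul hkle (add_le_add le_rfl hincT) ?_ (by positivity)
          refine add_nonneg (by positivity) (mul_nonneg hn'.le (sub_nonneg.2 ?_))
          exact marginalCdf_mono (normLevel_mono hu v n (by linarith))
      _ = _ := by ring
  · have hmod : (n : ℝ) - ((n / a n : ℕ) : ℝ) * a n ≤ a n := by
      have := (Nat.lt_div_mul_add (a := n) (ha n)).le
      have h2 : (n : ℝ) ≤ ((n / a n : ℕ) : ℝ) * a n + a n := by exact_mod_cast this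
      linarith
    have hcoef : (n : ℝ) - ((n / a n : ℕ) : ℝ) * a n + 2 * (((n / a n : ℕ) : ℝ) * l n) ≤
        a n + 2 * ((n : ℝ) / a n * l n) := by
      gcongr
    calc _ ≤ (a n + 2 * ((n : ℝ) / a n * l n)) * (1 - marginalCdf X μ (normLevel u v n y)) := by
          refine mul_le_mul hcoef hFz (sub_nonneg.2 (marginalCdf_le_one _)) (by positivity)
      _ = _ := by
          simp only [hTdef]
          field_simp

/-- Convergence of normalized maxima of a weakly dependent process with extremal index `θ`. -/
theorem tendsto_maxCdf (hX : ∀ t, Measurable (X t)) (hstat : StrictlyStationary X μ)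
    {γ : ℝ} {u v : ℕ → ℝ} (hu : ∀ n, 0 < u n)
    (hattr : ∀ x : ℝ, Tendsto (fun n : ℕ => marginalCdf X μ (normLevel u v n x) ^ n)
      atTop (𝓝 (gev γ x)))
    {a l : ℕ → ℕ} (ha : ∀ n, 0 < a n)
    (han : (fun n => (a n : ℝ)) =o[atTop] (fun n : ℕ => (n : ℝ)))
    (hla : (fun n => (l n : ℝ)) =o[atTop] (fun n => (a n : ℝ)))
    {θ : ℝ} (hθ : 0 < θ)
    (hindex : ∀ x : ℝ, 0 < 1 + γ * x → Tendsto (fun n : ℕ =>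
        μ.real {ω | normLevel u v n x < blockMax X 0 (a n) ω}
          / ((a n : ℝ) * (1 - marginalCdf X μ (normLevel u v n x)))) atTop (𝓝 θ))
    (hmix : ExtremalMixing X μ u a l) (x : ℝ) :
    Tendsto (fun n => maxCdf X μ n (normLevel u v n x)) atTop (𝓝 (limitCdf γ θ x)) := by
  have hH := isRegularCdf_limitCdf γ hθ
  have hopen : IsOpen {y : ℝ | 0 < 1 + γ * y} := isOpen_lt continuous_const (by fun_prop)
  have htail : ∀ y, 0 < 1 + γ * y → ∃ τ : ℝ, 0 < τ ∧ gev γ y = Real.exp (-τ) ∧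
      Tendsto (fun n : ℕ => (n : ℝ) * (1 - marginalCdf X μ (normLevel u v n y))) atTop (𝓝 τ) := by
    intro y hy
    obtain ⟨τ, hτ, he⟩ := exists_gev_eq_exp_neg hy
    refine ⟨τ, hτ, he, tendsto_mul_one_sub_of_pow (fun n => marginalCdf_nonneg _) ?_⟩
    rw [← he]
    exact hattr y
  have hblock : ∀ y, 0 < 1 + γ * y →
      Tendsto (fun n => maxCdf X μ (a n) (normLevel u v n y) ^ (n / a n)) atTop
        (𝓝 (limitCdf γ θ y)) := by
    intro y hy
    obtain ⟨τ, hτ, he, ht⟩ := htail y hy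
    have h := tendsto_maxCdf_pow hX ha han hτ ht (hindex y hy)
    have e : limitCdf γ θ y = Real.exp (-(θ * τ)) := by
      rw [limitCdf, he, ← Real.exp_mul]
      congr 1
      ring
    rwa [e]
  have hmono : ∀ m n, Monotone fun z => maxCdf X μ m (normLevel u v n z) := fun m n =>
    (maxCdf_mono m).comp (normLevel_mono hu v n)
  -- The good level `z` lies between `y` and `y'`: monotonicity in the level bounds the law of the
  -- maximum at `y` by that at `z`, and the block power at `z` by the one at `y'`.
  have hupper : ∀ y y', 0 < 1 + γ * y → 0 < 1 + γ * y' → y < y' → ∀ B, limitCdf γ θ y' < B →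
      ∀ᶠ n in atTop, maxCdf X μ n (normLevel u v n y) < B := by
    intro y y' hy hy' hyy B hB
    obtain ⟨τ, hτ, -, ht⟩ := htail y hy
    obtain ⟨R, hR, hev⟩ := exists_level_maxCdf_close hX hstat hu ha han hla hmix ht
      (sub_pos.2 hyy)
    have hlim := (hblock y' hy').add hR
    rw [add_zero] at hlim
    filter_upwards [hev, hlim.eventually_lt_const hB] with n hn hlt
    obtain ⟨z, hz, hclose⟩ := hn
    rw [add_sub_cancel] at hz
    have h1 := hmono n n hz.1
    have h2 := pow_le_pow_left₀ (maxCdf_nonneg _ _) (hmono (a n) n hz.2) (n / a n)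
    have h3 := (abs_le.1 hclose).2
    simp only at h1 h2
    linarith
  have hlower : ∀ y y', 0 < 1 + γ * y → y < y' → ∀ B, B < limitCdf γ θ y →
      ∀ᶠ n in atTop, B < maxCdf X μ n (normLevel u v n y') := by
    intro y y' hy hyy B hB
    obtain ⟨τ, hτ, -, ht⟩ := htail y hy
    obtain ⟨R, hR, hev⟩ := exists_level_maxCdf_close hX hstat hu ha han hla hmix ht
      (sub_pos.2 hyy)
    have hlim := (hblock y hy).sub hR
    rw [sub_zero] at hlim
    filter_upwards [hev, hlim.eventually_const_lt hB] with n hn hlt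
    obtain ⟨z, hz, hclose⟩ := hn
    rw [add_sub_cancel] at hz
    have h1 := hmono n n hz.2
    have h2 := pow_le_pow_left₀ (maxCdf_nonneg _ _) (hmono (a n) n hz.1) (n / a n)
    have h3 := (abs_le.1 hclose).1
    simp only at h1 h2
    linarith
  refine tendsto_order.2 ⟨fun B hB => ?_, fun B hB => ?_⟩
  · rcases lt_or_ge B 0 with hB0 | hB0
    · exact Eventually.of_forall fun n => hB0.trans_le (maxCdf_nonneg _ _)
    obtain ⟨y, hyx, hy, hBy⟩ : ∃ y < x, 0 < 1 + γ * y ∧ B < limitCdf γ θ y := by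
      have hleft : ∀ x₀, B < limitCdf γ θ x₀ → (∀ᶠ y in 𝓝[<] x₀, 0 < 1 + γ * y) →
          ∃ y < x₀, 0 < 1 + γ * y ∧ B < limitCdf γ θ y := by
        intro x₀ hx₀ hev
        have h1 : ∀ᶠ y in 𝓝[<] x₀, B < limitCdf γ θ y :=
          nhdsWithin_le_nhds ((hH.continuous.tendsto x₀).eventually_const_lt hx₀)
        obtain ⟨y, hy1, hy2, hy3⟩ := (h1.and (hev.and self_mem_nhdsWithin)).exists
        exact ⟨y, hy3, hy2, hy1⟩
      by_cases hx : 0 < 1 + γ * x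
      · exact hleft x hB (nhdsWithin_le_nhds (hopen.mem_nhds hx))
      -- Outside the support a nonnegative `B` below the limit leaves only `γ < 0`, with `x` at or
      -- beyond the right endpoint; the limit there equals its value at the endpoint, which is
      -- approached from inside.
      · have hγ : γ < 0 := by
          by_contra! hγ
          rcases hγ.eq_or_lt with h0 | h0
          · rw [← h0] at hx
            norm_num at hx
          · rw [limitCdf, gev, if_neg h0.ne', if_neg hx, if_neg (not_lt.2 hγ),
              Real.zero_rpow hθ.ne'] at hB
            exact absurd hB (not_lt.2 hB0)
        have hx₀ : -1 / γ ≤ x := by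
          rw [div_le_iff_of_neg hγ]
          linarith
        have hzero : ¬ 0 < 1 + γ * (-1 / γ) := by
          rw [mul_div_cancel₀ _ hγ.ne]
          norm_num
        have e : limitCdf γ θ x = limitCdf γ θ (-1 / γ) := by
          simp only [limitCdf, gev, if_neg hγ.ne, if_neg hx, if_neg hzero]
        rw [e] at hB
        obtain ⟨y, h1, h2⟩ := hleft (-1 / γ) hB (by
          filter_upwards [self_mem_nhdsWithin] with y hy
          have hy' : y < -1 / γ := hy
          rw [lt_div_iff_of_neg hγ] at hy'
          linarith)
        exact ⟨y, h1.trans_le hx₀, h2⟩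
    exact hlower y x hy hyx B hBy
  · rcases lt_or_ge 1 B with hB1 | hB1
    · exact Eventually.of_forall fun n => (maxCdf_le_one _ _).trans_lt hB1
    have hright : ∀ x₀, limitCdf γ θ x₀ < B → (∀ᶠ y in 𝓝[>] x₀, 0 < 1 + γ * y) →
        ∃ y > x₀, 0 < 1 + γ * y ∧ limitCdf γ θ y < B := by
      intro x₀ hx₀ hev
      have h1 : ∀ᶠ y in 𝓝[>] x₀, limitCdf γ θ y < B :=
        nhdsWithin_le_nhds ((hH.continuous.tendsto x₀).eventually_lt_const hx₀)
      obtain ⟨y, hy1, hy2, hy3⟩ := (h1.and (hev.and self_mem_nhdsWithin)).exists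
      exact ⟨y, hy3, hy2, hy1⟩
    by_cases hx : 0 < 1 + γ * x
    · obtain ⟨y, h1, h2, h3⟩ := hright x hB (nhdsWithin_le_nhds (hopen.mem_nhds hx))
      exact hupper x y hx h2 h1 B h3
    -- Symmetrically, `x` lies at or below the left endpoint. The level `x'` is placed strictly
    -- inside the support because `hupper` needs both levels there.
    · have hγ : 0 < γ := by
        by_contra! hγ
        rcases hγ.eq_or_lt with h0 | h0
        · rw [h0] at hx
          norm_num at hx
        · rw [limitCdf, gev, if_neg h0.ne, if_neg hx, if_pos h0, Real.one_rpow] at hB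
          exact absurd hB (not_lt.2 hB1)
      have hx₀ : x ≤ -1 / γ := by
        rw [le_div_iff₀ hγ]
        linarith
      have hzero : ¬ 0 < 1 + γ * (-1 / γ) := by
        rw [mul_div_cancel₀ _ hγ.ne']
        norm_num
      have e : limitCdf γ θ x = limitCdf γ θ (-1 / γ) := by
        simp only [limitCdf, gev, if_neg hγ.ne', if_neg hx, if_neg hzero]
      rw [e] at hB
      have hdom : ∀ y, -1 / γ < y → 0 < 1 + γ * y := fun y hy => by
        rw [div_lt_iff₀ hγ] at hy
        linarith
      obtain ⟨y, h1, h2, h3⟩ := hright (-1 / γ) hB (by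
        filter_upwards [self_mem_nhdsWithin] with y hy
        exact hdom y hy)
      obtain ⟨x', hx'1, hx'2⟩ := exists_between h1
      filter_upwards [hupper x' y (hdom x' hx'1) h2 hx'2 B h3] with n hn
      exact (hmono n n (hx₀.trans hx'1.le)).trans_lt hn

end MaximaLimit

/-! ### Convergence of the mean and almost sure convergence. -/

section AlmostSureConvergence

variable {Ω : Type*} [MeasurableSpace Ω] {μ : Measure Ω} {X : ℤ → Ω → ℝ} [IsProbabilityMeasure μ]

lemma integral_smoothSubsampler_eq (hX : ∀ t, Measurable (X t)) (hstat : StrictlyStationary X μ)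
    (S : Scheme) {n b : ℕ} (hN : 0 < numBlocks S n b) (e x : ℝ) :
    ∫ ω, smoothSubsampler S X n b e ω x ∂μ = ∫ ω, ramp ((blockMax X 0 b ω - x) / e) ∂μ := by
  have hshift : ∀ s : ℤ, ∫ ω, ramp ((blockMax X s b ω - x) / e) ∂μ =
      ∫ y, ramp ((y - x) / e) ∂(μ.map (blockMax X 0 b)) := by
    intro s
    have hr : Measurable fun y : ℝ => ramp ((y - x) / e) :=
      continuous_ramp.measurable.comp ((measurable_id.sub_const x).div_const e)
    rw [← map_blockMax hX hstat s b,
      integral_map (measurable_blockMax hX s b).aemeasurable hr.aestronglyMeasurable]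
  have hN' : (numBlocks S n b : ℝ) ≠ 0 := by positivity
  rw [integral_smoothSubsampler hX, hshift 0, Finset.sum_congr rfl fun i _ => hshift _,
    Finset.sum_const, Finset.card_range, nsmul_eq_mul, one_div, inv_mul_cancel_left₀ hN']

lemma integral_ramp_blockMax_bounds (hX : ∀ t, Measurable (X t)) (b : ℕ) {e : ℝ} (he : 0 < e)
    (w : ℝ) : maxCdf X μ b w ≤ ∫ ω, ramp ((blockMax X 0 b ω - w) / e) ∂μ ∧
      ∫ ω, ramp ((blockMax X 0 b ω - w) / e) ∂μ ≤ maxCdf X μ b (w + e) := by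
  refine measureReal_le_integral_le (measurable_rampBlock hX 0 b w e)
    (measurableSet_le (measurable_blockMax hX 0 b) measurable_const)
    (measurableSet_le (measurable_blockMax hX 0 b) measurable_const)
    (fun ω => ramp_nonneg _) (fun ω => ramp_le_one _) (fun ω hω => ?_) (fun ω hω => ?_)
  · exact ramp_of_nonpos (div_nonpos_of_nonpos_of_nonneg (sub_nonpos.2 hω) he.le)
  · refine ramp_of_one_le ?_
    have : w + e < blockMax X 0 b ω := not_le.1 hω
    rw [le_div_iff₀ he]
    linarith

lemma eventually_numBlocks_pos {b : ℕ → ℕ} (hb : Tendsto b atTop atTop)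
    (hnb : Tendsto (fun n : ℕ => (n : ℝ) / (b n : ℝ)) atTop atTop) (S : Scheme) :
    ∀ᶠ n in atTop, 0 < numBlocks S n (b n) := by
  filter_upwards [hb.eventually_ge_atTop 1, hnb.eventually_ge_atTop 2] with n h1 h2
  rw [le_div_iff₀ (by exact_mod_cast h1)] at h2
  have h3 : 2 * b n ≤ n := by exact_mod_cast h2
  rcases S with _ | _
  · simp only [numBlocks]; omega
  · exact Nat.div_pos (by omega) h1

/-- Smoothing shifts the level by at most `ε n`, that is by `ε n * u (b n) → 0` in normalized
coordinates, which continuity of `H` absorbs. -/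
lemma tendsto_integral_smoothSubsampler (hX : ∀ t, Measurable (X t))
    (hstat : StrictlyStationary X μ) {u v : ℕ → ℝ} (hu : ∀ n, 0 < u n) {H : ℝ → ℝ}
    (hH : Continuous H)
    (hmax : ∀ x, Tendsto (fun n => maxCdf X μ n (normLevel u v n x)) atTop (𝓝 (H x)))
    {b : ℕ → ℕ} (hb : Tendsto b atTop atTop)
    (hnb : Tendsto (fun n : ℕ => (n : ℝ) / (b n : ℝ)) atTop atTop)
    {ε : ℕ → ℝ} (hε : ∀ n, 0 < ε n) (hεu : Tendsto (fun n => ε n * u (b n)) atTop (𝓝 0))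
    (S : Scheme) (x : ℝ) :
    Tendsto (fun n => ∫ ω, smoothSubsampler S X n (b n) (ε n) ω (normLevel u v (b n) x) ∂μ) atTop
      (𝓝 (H x)) := by
  have hmax' := fun y => (hmax y).comp hb
  have hN := eventually_numBlocks_pos hb hnb S
  refine tendsto_order.2 ⟨fun B hB => ?_, fun B hB => ?_⟩
  · filter_upwards [hN, (hmax' x).eventually_const_lt hB] with n hn hlt
    rw [integral_smoothSubsampler_eq hX hstat S hn]
    exact hlt.trans_le (integral_ramp_blockMax_bounds hX (b n) (hε n) _).1
  · have h1 : ∀ᶠ y in 𝓝[>] x, H y < B :=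
      nhdsWithin_le_nhds ((hH.tendsto x).eventually_lt_const hB)
    obtain ⟨y, hy, hxy⟩ := (h1.and self_mem_nhdsWithin).exists
    have hxy' : 0 < y - x := sub_pos.2 hxy
    filter_upwards [hN, (hmax' y).eventually_lt_const hy, hεu.eventually_lt_const hxy']
      with n hn hlt hsmall
    rw [integral_smoothSubsampler_eq hX hstat S hn]
    refine ((integral_ramp_blockMax_bounds hX (b n) (hε n) _).2.trans ?_).trans_lt hlt
    have hub := hu (b n)
    have e : normLevel u v (b n) x + ε n = normLevel u v (b n) (x + ε n * u (b n)) := by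
      simp only [normLevel]
      field_simp
      ring
    rw [e]
    exact maxCdf_mono _ (normLevel_mono hu v _ (by linarith))

/-- A sequence with summable even moments converges to zero almost surely. -/
lemma ae_tendsto_zero_of_moment_le {Y : ℕ → Ω → ℝ} (hY : ∀ n, Measurable (Y n))
    (hY1 : ∀ n ω, |Y n ω| ≤ 1) {p : ℕ} (hp : Even p) (hp0 : p ≠ 0) {K s : ℝ} (hs : 1 < s)
    (hmom : ∀ n : ℕ, 1 ≤ n → |∫ ω, Y n ω ^ p ∂μ| ≤ K * (n : ℝ) ^ (-s)) :
    ∀ᵐ ω ∂μ, Tendsto (fun n => Y n ω) atTop (𝓝 0) := by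
  have hint : ∀ n, Integrable (fun ω => Y n ω ^ p) μ := fun n =>
    integrable_of_abs_le ((hY n).pow_const p) (c := 1) fun ω => by
      rw [abs_pow]
      exact pow_le_one₀ (abs_nonneg _) (hY1 n ω)
  have hsum : Summable fun n : ℕ => K * ((n + 1 : ℕ) : ℝ) ^ (-s) :=
    ((summable_nat_add_iff 1).2 (Real.summable_nat_rpow.2 (by linarith))).mul_left K
  -- Finite expectation of the series makes it finite almost surely, so its terms tend to zero. The
  -- shift by one avoids the index `0`, for which no moment bound is given.
  have hfin : ∑' n, ∫⁻ ω, ENNReal.ofReal (Y (n + 1) ω ^ p) ∂μ ≠ ⊤ := by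
    refine ne_top_of_le_ne_top hsum.tsum_ofReal_ne_top (ENNReal.tsum_le_tsum fun n => ?_)
    rw [← ofReal_integral_eq_lintegral_ofReal (hint _) (ae_of_all _ fun ω => hp.pow_nonneg _)]
    exact ENNReal.ofReal_le_ofReal ((le_abs_self _).trans (hmom (n + 1) (by omega)))
  rw [← lintegral_tsum fun n => ((hY _).pow_const p).ennreal_ofReal.aemeasurable] at hfin
  have hmeas : Measurable fun ω => ∑' n, ENNReal.ofReal (Y (n + 1) ω ^ p) :=
    Measurable.tsum fun n => ((hY _).pow_const p).ennreal_ofReal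
  filter_upwards [ae_lt_top hmeas hfin] with ω hω
  have h1 := ENNReal.tendsto_atTop_zero_of_tsum_ne_top hω.ne
  have h2 := (ENNReal.tendsto_toReal ENNReal.zero_ne_top).comp h1
  have h3 : Tendsto (fun n => Y (n + 1) ω ^ p) atTop (𝓝 0) :=
    h2.congr fun n => ENNReal.toReal_ofReal (hp.pow_nonneg _)
  have h4 := h3.rpow_const (p := (p : ℝ)⁻¹) (Or.inr (by positivity))
  rw [Real.zero_rpow (by positivity)] at h4
  refine (tendsto_add_atTop_iff_nat 1).1 ((tendsto_zero_iff_abs_tendsto_zero _).2 (h4.congr ?_))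
  intro n
  simp only [Function.comp]
  rw [← hp.pow_abs, Real.pow_rpow_inv_natCast (abs_nonneg _) hp0]

/-- A countable set of points suffices, so the exceptional null set can be chosen independently of
`x`. -/
lemma tendsto_of_monotone_of_rat {f : ℕ → ℝ → ℝ} {g : ℝ → ℝ} (hf : ∀ n, Monotone (f n))
    (hg : Continuous g) (h : ∀ q : ℚ, Tendsto (fun n => f n q) atTop (𝓝 (g q))) (x : ℝ) :
    Tendsto (fun n => f n x) atTop (𝓝 (g x)) := by
  refine tendsto_order.2 ⟨fun B hB => ?_, fun B hB => ?_⟩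
  · obtain ⟨a, b, ⟨ha, hb⟩, hab⟩ := mem_nhds_iff_exists_Ioo_subset.1
      ((hg.tendsto x).eventually_const_lt hB)
    obtain ⟨q, hq1, hq2⟩ := exists_rat_btwn ha
    filter_upwards [(h q).eventually_const_lt (hab ⟨hq1, hq2.trans hb⟩)] with n hn
    exact lt_of_lt_of_le hn (hf n hq2.le)
  · obtain ⟨a, b, ⟨ha, hb⟩, hab⟩ := mem_nhds_iff_exists_Ioo_subset.1
      ((hg.tendsto x).eventually_lt_const hB)
    obtain ⟨q, hq1, hq2⟩ := exists_rat_btwn hb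
    filter_upwards [(h q).eventually_lt_const (hab ⟨ha.trans hq1, hq2⟩)] with n hn
    exact lt_of_le_of_lt (hf n hq1.le) hn

end AlmostSureConvergence

end

end ExtremeSubsampling

/-! ### Assembly of the moment bound and the almost sure convergence. -/

theorem theorem6 {Ω : Type*} [MeasurableSpace Ω] (μ : Measure Ω) [IsProbabilityMeasure μ]
    (X : ℤ → Ω → ℝ) (hX : ∀ t, Measurable (X t))
    (hstat : ExtremeSubsampling.StrictlyStationary X μ)
    -- the marginal law: absolutely continuous, attracted to `G_γ` with norming `u, v`
    (γ : ℝ) (u v : ℕ → ℝ) (hu : ∀ n, 0 < u n)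
    (hac : μ.map (X 0) ≪ volume)
    (hattr : ∀ x : ℝ, Tendsto (fun n : ℕ =>
        ExtremeSubsampling.marginalCdf X μ (ExtremeSubsampling.normLevel u v n x) ^ n)
      atTop (𝓝 (ExtremeSubsampling.gev γ x)))
    (hderiv : ∀ x : ℝ, 0 < 1 + γ * x → Tendsto (fun n : ℕ =>
        deriv (fun y : ℝ =>
          ExtremeSubsampling.marginalCdf X μ (ExtremeSubsampling.normLevel u v n y) ^ n) x)
      atTop (𝓝 (deriv (ExtremeSubsampling.gev γ) x)))
    -- the extremal index
    (a l : ℕ → ℕ) (ha : ∀ n, 0 < a n) (hl : ∀ n, 0 < l n)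
    (han : (fun n => (a n : ℝ)) =o[atTop] (fun n : ℕ => (n : ℝ)))
    (hla : (fun n => (l n : ℝ)) =o[atTop] (fun n => (a n : ℝ)))
    (θ : ℝ) (hθ : θ ∈ Set.Ioc (0 : ℝ) 1)
    (hindex : ∀ x : ℝ, 0 < 1 + γ * x → Tendsto (fun n : ℕ =>
        μ.real {ω | ExtremeSubsampling.normLevel u v n x < ExtremeSubsampling.blockMax X 0 (a n) ω}
          / ((a n : ℝ) * (1 - ExtremeSubsampling.marginalCdf X μ
              (ExtremeSubsampling.normLevel u v n x))))
      atTop (𝓝 θ))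
    (hmix : ExtremeSubsampling.ExtremalMixing X μ u a l)
    -- subsample size and smoothing parameter
    (b : ℕ → ℕ) (hb : Tendsto b atTop atTop)
    (hnb : Tendsto (fun n : ℕ => (n : ℝ) / (b n : ℝ)) atTop atTop)
    (ε : ℕ → ℝ) (hε : ∀ n, 0 < ε n) (hε0 : Tendsto ε atTop (𝓝 0))
    (hεu : Tendsto (fun n => ε n * u (b n)) atTop (𝓝 0))
    (S : ExtremeSubsampling.Scheme) (p : ℕ) (hp : 1 ≤ p) (δ : ℝ) (hδ : 0 < δ)
    (hsub : ExtremeSubsampling.SubsamplingCondition S X μ p δ b ε) :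
    (∃ K : ℝ, ∀ n : ℕ, 1 ≤ n → ∀ x : ℝ,
      |∫ ω, (ExtremeSubsampling.smoothSubsampler S X n (b n) (ε n) ω
              (ExtremeSubsampling.normLevel u v (b n) x)
            - ∫ ω', ExtremeSubsampling.smoothSubsampler S X n (b n) (ε n) ω'
              (ExtremeSubsampling.normLevel u v (b n) x) ∂μ) ^ p ∂μ|
        ≤ K * (n : ℝ) ^ (-(((p / 2 : ℕ) : ℝ) * δ))) ∧
    (Even p → 2 < (p : ℝ) * δ → ∀ t₁ t₂ : ℝ, 0 < t₁ → t₁ < t₂ → t₂ < 1 →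
      ∀ᵐ ω ∂μ, TendstoUniformly
        (fun (n : ℕ) (x : ℝ) =>
          ExtremeSubsampling.smoothSubsampler S X n (b n) (ε n) ω
            (ExtremeSubsampling.estCenter
                (ExtremeSubsampling.smoothSubsampler S X n (b n) (ε n) ω)
              + x / ExtremeSubsampling.estScale
                (ExtremeSubsampling.smoothSubsampler S X n (b n) (ε n) ω) t₁ t₂))
        (fun x : ℝ => ExtremeSubsampling.limitCdf γ θ
          (ExtremeSubsampling.genInv (ExtremeSubsampling.limitCdf γ θ) (1 / 2)
            + (ExtremeSubsampling.genInv (ExtremeSubsampling.limitCdf γ θ) t₂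
              - ExtremeSubsampling.genInv (ExtremeSubsampling.limitCdf γ θ) t₁) * x))
        atTop) := by
  obtain ⟨K, hK⟩ := ExtremeSubsampling.exists_moment_le hX hb hnb hε hε0 S hp hδ hsub
  refine ⟨⟨K, fun n hn x => hK n hn _⟩, fun heven hpδ t₁ t₂ ht₁ ht ht₂ => ?_⟩
  have hH := ExtremeSubsampling.isRegularCdf_limitCdf γ hθ.1
  have hmax := ExtremeSubsampling.tendsto_maxCdf hX hstat hu hattr ha han hla hθ.1 hindex hmix
  have hmean := ExtremeSubsampling.tendsto_integral_smoothSubsampler hX hstat hu hH.continuous hmax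
    hb hnb hε hεu S
  -- For even `p` the floor is exact, so `p δ > 2` is precisely summability of the moment bounds.
  have hs : 1 < ((p / 2 : ℕ) : ℝ) * δ := by
    obtain ⟨k, rfl⟩ := heven
    have hk : (k + k) / 2 = k := by omega
    rw [hk]
    push_cast at hpδ
    linarith
  have hpoint : ∀ x : ℝ, ∀ᵐ ω ∂μ, Tendsto (fun n =>
      ExtremeSubsampling.smoothSubsampler S X n (b n) (ε n) ω
        (ExtremeSubsampling.normLevel u v (b n) x)) atTop
      (𝓝 (ExtremeSubsampling.limitCdf γ θ x)) := by
    intro x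
    have hae := ExtremeSubsampling.ae_tendsto_zero_of_moment_le (μ := μ)
      (Y := fun n ω => ExtremeSubsampling.smoothSubsampler S X n (b n) (ε n) ω
        (ExtremeSubsampling.normLevel u v (b n) x) -
        ∫ ω', ExtremeSubsampling.smoothSubsampler S X n (b n) (ε n) ω'
          (ExtremeSubsampling.normLevel u v (b n) x) ∂μ)
      (fun n => (ExtremeSubsampling.measurable_smoothSubsampler hX S n (b n) (ε n) _).sub_const _)
      (fun n ω => ExtremeSubsampling.abs_smoothSubsampler_sub_integral_le S n (b n) (ε n) _ ω)
      heven (by omega) hs (fun n hn => hK n hn _)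
    filter_upwards [hae] with ω hω
    simpa using hω.add (hmean x)
  -- From here on the argument is deterministic, for one fixed path.
  have hall : ∀ᵐ ω ∂μ, ∀ q : ℚ, Tendsto (fun n =>
      ExtremeSubsampling.smoothSubsampler S X n (b n) (ε n) ω
        (ExtremeSubsampling.normLevel u v (b n) q)) atTop
      (𝓝 (ExtremeSubsampling.limitCdf γ θ q)) :=
    ae_all_iff.2 fun q => hpoint q
  filter_upwards [hall] with ω hω
  have hmono : ∀ n, Monotone (ExtremeSubsampling.smoothSubsampler S X n (b n) (ε n) ω) := fun n =>
    ExtremeSubsampling.smoothSubsampler_monotone S X n (b n) (hε n) ω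
  exact ExtremeSubsampling.tendstoUniformly_estimated_normalization
    (U := fun n => u (b n)) (V := fun n => v (b n)) (fun n => hu (b n)) hmono
    (fun n x => ExtremeSubsampling.smoothSubsampler_nonneg S X n (b n) (ε n) ω x)
    (fun n x => ExtremeSubsampling.smoothSubsampler_le_one S X n (b n) (ε n) ω x) hH
    (ExtremeSubsampling.tendsto_of_monotone_of_rat
      (fun n => (hmono n).comp (ExtremeSubsampling.normLevel_mono hu v (b n))) hH.continuous hω)
    ht₁ ht ht₂
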